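/- \textbf{Setting.} Let $\mathcal R$ be a finite nonempty set of regions. Consider $$\min_x\ \sum_{\ell\in\mathcal R} f_\ell(x_\ell)\quad\text{s.t.}\quad \sum_{\ell} A_\ell x_\ell=b,\qquad c^E_\ell(x_\ell)=0,\qquad c^I_\ell(x_\ell)\le 0\quad(\ell\in\mathcal R),\tag{P}$$ with $x_\ell\in\mathbb R^{n_\ell}$, and for $\mu>0$ the barrier problem $$\min_{x,\,s>0}\ \sum_\ell \Big(f_\ell(x_\ell)-\mu\sum_m\ln s^{(m)}_\ell\Big)\quad\text{s.t.}\quad \sum_\ell A_\ell x_\ell=b,\quad c^E_\ell(x_\ell)=0,\quad c^I_\ell(x_\ell)+s_\ell=0.\tag{P$_\mu$}$$ Solutions are understood as local minimizers. Write $L_\ell(x,\kappa,\gamma)=f_\ell(x)+\kappa^\top c^I_\ell(x)+\gamma^\top c^E_\ell(x)$, $J_\ell=\nabla c^E_\ell(x_\ell)^\top$, $R_\ell=\nabla c^I_\ell(x_\ell)^\top$, $S_\ell=\mathrm{diag}(s_\ell)$, $K_\ell=\mathrm{diag}(\kappa_\ell)$ and $B_\ell=\nabla^2_{xx}L_\ell+R_\ell^\top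 S_\ell^{-1}K_\ell R_\ell$. \textbf{Inner iteration} (fixed $\mu>0$; parameters $\rho>0$, symmetric $\Sigma_\ell\succ0$, $\tau_{\min}\in(0,1)$, $\tau=\max(\tau_{\min},1-\mu)$). Given $(z,\lambda)$: \begin{enumerate} \item For every $\ell$ compute a local primal-dual solution $(x_\ell,s_\ell,\gamma_\ell,\kappa_\ell)$ of $\min_{x_\ell,\,s_\ell>0} f_\ell(x_\ell)-\mu\sum_m\ln s_\ell^{(m)}+\lambda^\top A_\ell x_\ell+\frac\rho2(x_\ell-z_\ell)^\top\Sigma_\ell(x_\ell-z_\ell)$ s.t. $c^E_\ell(x_\ell)=0$, $c^I_\ell(x_\ell)+s_\ell=0$. \item Choose matrices $H_\ell$ and compute $(\Delta x,\Delta\gamma,\Delta\lambda)$ with, for all $\ell$, $H_\ell\Delta x_\ell+J_\ell^\top\Delta\gamma_\ell+A_\ell^\top\Delta\lambda=-g_\ell$ and $J_\ell\Delta x_\ell=-c^E_\ell(x_\ell)$, and with $\sum_\ell A_\ell\Delta x_\ell=b-\sum_\ell A_\ell x_\ell$, where $g_\ell=\nabla_xL_\ell+A_\ell^\top\lambda+R_\ell^\top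 S_\ell^{-1}(\mu\mathbf 1+K_\ell c^I_\ell(x_\ell))$. (If all $\bar H_\ell=\begin{pmatrix}H_\ell&J_\ell^\top\\J_\ell&0\end{pmatrix}$ are nonsingular this system is solved through its Schur complement in $\Delta\lambda$.) Put $\Delta s_\ell=-c^I_\ell(x_\ell)-s_\ell-R_\ell\Delta x_\ell$ and $\Delta\kappa_\ell=-\kappa_\ell+S_\ell^{-1}(\mu\mathbf 1-K_\ell\Delta s_\ell)$. \item Let $\beta^p=\min_\ell\max\{\beta\in(0,1]:s_\ell+\beta\Delta s_\ell\ge(1-\tau)s_\ell\}$, $\beta^d=\min_\ell\max\{\beta\in(0,1]:\kappa_\ell+\beta\Delta\kappa_\ell\ge(1-\tau)\kappa_\ell\}$, and update $z_\ell^+=z_\ell+\alpha_1(x_\ell-z_\ell)+\alpha_2\beta^p\Delta x_\ell$, $\lambda^+=\lambda+\alpha_3\beta^d\Delta\lambda$. \end{enumerate} \textbf{Theorem (local quadratic convergence to $x^\star(\mu)$).} Assume that (i) each of $f_\ell,c^E_\ell,c^I_\ell$ is twice continuously differentiable on an open set containing $F_\ell=\{x_\ell: c^E_\ell(x_\ell)=0,\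 c^I_\ell(x_\ell)\le0\}$, with second derivative locally Lipschitz on $F_\ell$; (ii) $x^*$ is a solution of (P) which, with multipliers, satisfies the KKT conditions, the linear independence constraint qualification, strict complementarity and the second-order sufficient condition. Then there are $r_0,\bar\mu>0$ and, for every $\mu\in(0,\bar\mu)$, a solution $(x^\star(\mu),s^\star(\mu))$ of (P$_\mu$) with multipliers $(\lambda^\star(\mu),\gamma^\star(\mu),\kappa^\star(\mu))$ satisfying the perturbed KKT conditions, such that it is the only solution of (P$_\mu$) with $\|x-x^*\|<r_0$, and $x^\star(\mu)\to x^*$ as $\mu\downarrow0$. Moreover, fix $\mu\in(0,\bar\mu)$, $\tau_{\min}\in(0,1)$, $M\ge0$, symmetric $\Sigma_\ell\succ0$, and $\rho>0$ so large that for each $\ell$ the matrix $B_\ell+\rho\Sigma_\ell$ is positive definite on $\ker J_\ell$ at $x^\star(\mu)$ (which is the decoupled solution for $z=x^\star(\mu)$, $\lambda=\lambda^\star(\mu)$). Then there are $r,\delta,C>0$ such that the following holds. \begin{enumerate} \item[(A)] For all $(z,\lambda)$ with $\|z-x^\star(\mu)\|<\delta$ and $\|\lambda-\lambda^\star(\mu)\|<\delta$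 the decoupled problems have exactly one primal-dual solution with $\|x-x^\star(\mu)\|<r$, and for all $H_\ell$ with $\|B_\ell-H_\ell\|\le M\|x_\ell-z_\ell\|$ at this solution the system in step 2 has exactly one solution. \item[(B)] Consider infinite runs with full steps $\alpha_1=\alpha_2=\alpha_3=1$ in which, at every iteration $k$, $\|B_\ell^k-H_\ell^k\|\le M\|x_\ell^k-z_\ell^k\|$ for all $\ell$ and the decoupled solution is the one with $\|x^k-x^\star(\mu)\|<r$. From every $(z^0,\lambda^0)$ with $\|z^0-x^\star(\mu)\|<\delta$, $\|\lambda^0-\lambda^\star(\mu)\|<\delta$ such a run exists, and for every such run $x^k\to x^\star(\mu)$, $z^k\to x^\star(\mu)$, $\lambda^k\to\lambda^\star(\mu)$ and, with $e_k=\|z^k-x^\star(\mu)\|+\|\lambda^k-\lambda^\star(\mu)\|$, for all $k$ $$e_{k+1}\le C\,e_k^2,\qquad \|x^k-x^\star(\mu)\|\le C\,e_k,\qquad \|x^{k+1}-x^\star(\mu)\|\le C\,e_k\,\|x^k-x^\star(\mu)\|.$$ \end{enumerate} That is, the iterates $(z^k,\lambda^k)$ converge locally Q-quadratically, and the decoupled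 iterates $x^k$ converge R-quadratically (and Q-superlinearly) to $x^\star(\mu)$. -/

import Mathlib

open Filter Topology
open scoped RealInnerProductSpace

noncomputable section

namespace BarrierALADIN

/-- `ℝᵏ` with the Euclidean norm. -/
abbrev Vec (k : ℕ) : Type := EuclideanSpace ℝ (Fin k)

/-- `g` is twice Lipschitz-continuously differentiable on `S`: it is twice continuously
differentiable on an open set containing `S`, and its second derivative is (locally)
Lipschitz on `S`. -/
def TwiceLipschitzDiffOn {E F : Type*} [NormedAddCommGroup E] [NormedSpace ℝ E]
    [NormedAddCommGroup F] [NormedSpace ℝ F] (g : E → F) (S : Set E) : Prop :=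
  ∃ U : Set E, IsOpen U ∧ S ⊆ U ∧ ContDiffOn ℝ 2 g U ∧
    LocallyLipschitzOn S (fun x => fderiv ℝ (fderiv ℝ g) x)

/-- The diagonal operator `diag(v)` on `ℝᵏ`. -/
def diagOp {k : ℕ} (v : Fin k → ℝ) : Vec k →L[ℝ] Vec k :=
  Matrix.toEuclideanCLM (𝕜 := ℝ) (Matrix.diagonal v)

/-- The distributed problem
`min ∑ f_ℓ(x_ℓ)  s.t.  ∑ A_ℓ x_ℓ = b,  cE_ℓ(x_ℓ) = 0,  cI_ℓ(x_ℓ) ≤ 0`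
over the regions `ℓ : R`. -/
structure DistNLP (R : Type*) (n mE mI : R → ℕ) (p : ℕ) where
  f : ∀ l, Vec (n l) → ℝ
  cE : ∀ l, Vec (n l) → Vec (mE l)
  cI : ∀ l, Vec (n l) → Vec (mI l)
  A : ∀ l, Vec (n l) →L[ℝ] Vec p
  b : Vec p

/-- Region-wise primal, slack and dual variables `(x, s, γ, κ)`. -/
@[ext] structure LocalVars (R : Type*) (n mE mI : R → ℕ) where
  x : ∀ l : R, Vec (n l)
  s : ∀ l : R, Vec (mI l)
  gam : ∀ l : R, Vec (mE l)
  kap : ∀ l : R, Vec (mI l)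

/-- Primal-dual variables `(x, s, γ, κ, λ)` of the coupled barrier problem. -/
structure PrimalDual (R : Type*) (n mE mI : R → ℕ) (p : ℕ) extends LocalVars R n mE mI where
  lam : Vec p

/-- A coordination step `(Δx, Δγ, Δλ)`. -/
@[ext] structure CoordStep (R : Type*) (n mE : R → ℕ) (p : ℕ) where
  dx : ∀ l : R, Vec (n l)
  dgam : ∀ l : R, Vec (mE l)
  dlam : Vec p

namespace DistNLP

variable {R : Type*} {n mE mI : R → ℕ} {p : ℕ} (P : DistNLP R n mE mI p)

/-- The local feasible set `F_ℓ`. -/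
def localFeasible (l : R) : Set (Vec (n l)) :=
  {x | P.cE l x = 0 ∧ ∀ m, P.cI l x m ≤ 0}

/-- Smoothness of the problem data on the local feasible sets. -/
def Smooth : Prop := ∀ l,
  TwiceLipschitzDiffOn (P.f l) (P.localFeasible l) ∧
  TwiceLipschitzDiffOn (P.cE l) (P.localFeasible l) ∧
  TwiceLipschitzDiffOn (P.cI l) (P.localFeasible l)

/-- The Jacobian `J_ℓ` of `cE_ℓ`. -/
def J (l : R) (x : Vec (n l)) : Vec (n l) →L[ℝ] Vec (mE l) := fderiv ℝ (P.cE l) x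

/-- The Jacobian `R_ℓ` of `cI_ℓ`. -/
def Rjac (l : R) (x : Vec (n l)) : Vec (n l) →L[ℝ] Vec (mI l) := fderiv ℝ (P.cI l) x

/-- The local Lagrangian `L_ℓ(x, κ, γ) = f_ℓ(x) + κᵀ cI_ℓ(x) + γᵀ cE_ℓ(x)`. -/
def lagrangian (l : R) (kap : Vec (mI l)) (gam : Vec (mE l)) (x : Vec (n l)) : ℝ :=
  P.f l x + ⟪kap, P.cI l x⟫ + ⟪gam, P.cE l x⟫

/-- `∇ₓ L_ℓ`. -/
def gradLag (l : R) (kap : Vec (mI l)) (gam : Vec (mE l)) (x : Vec (n l)) : Vec (n l) :=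
  gradient (P.lagrangian l kap gam) x

/-- `∇²ₓₓ L_ℓ`. -/
def hessLag (l : R) (kap : Vec (mI l)) (gam : Vec (mE l)) (x : Vec (n l)) :
    Vec (n l) →L[ℝ] Vec (n l) :=
  fderiv ℝ (P.gradLag l kap gam) x

/-- The barrier Hessian `∇²ₓₓ L_ℓ + R_ℓᵀ S_ℓ⁻¹ K_ℓ R_ℓ`. -/
def barrierHess (l : R) (y : LocalVars R n mE mI) : Vec (n l) →L[ℝ] Vec (n l) :=
  P.hessLag l (y.kap l) (y.gam l) (y.x l) +
    (ContinuousLinearMap.adjoint (P.Rjac l (y.x l))) ∘L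
      (diagOp fun m => y.kap l m / y.s l m) ∘L (P.Rjac l (y.x l))

section Original

variable [Fintype R]

/-- The feasible set of the original problem. -/
def feasible : Set (∀ l, Vec (n l)) :=
  {x | ∑ l, P.A l (x l) = P.b ∧ ∀ l, x l ∈ P.localFeasible l}

/-- `x` is a (local) solution of the original problem. -/
def IsSolution (x : ∀ l, Vec (n l)) : Prop :=
  x ∈ P.feasible ∧ IsLocalMinOn (fun y : ∀ l, Vec (n l) => ∑ l, P.f l (y l)) P.feasible x

/-- The KKT conditions of the original problem. -/
structure IsKKT (x : ∀ l, Vec (n l)) (lam : Vec p) (gam : ∀ l, Vec (mE l))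
    (kap : ∀ l, Vec (mI l)) : Prop where
  feas : x ∈ P.feasible
  stat : ∀ l, P.gradLag l (kap l) (gam l) (x l) + ContinuousLinearMap.adjoint (P.A l) lam = 0
  nonneg : ∀ l m, 0 ≤ kap l m
  compl : ∀ l m, kap l m * P.cI l (x l) m = 0

/-- Linear independence constraint qualification: the gradients of all equality constraints
(the rows of `∑ A_ℓ x_ℓ = b` and the `cE_ℓ`) and of the inequality constraints that are active
at `x` are linearly independent, i.e. only their trivial linear combination vanishes. -/
def LICQ (x : ∀ l, Vec (n l)) : Prop :=
  ∀ (u : Vec p) (v : ∀ l, Vec (mE l)) (w : ∀ l, Vec (mI l)),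
    (∀ l m, P.cI l (x l) m ≠ 0 → w l m = 0) →
    (∀ l, ContinuousLinearMap.adjoint (P.A l) u +
      ContinuousLinearMap.adjoint (P.J l (x l)) (v l) +
      ContinuousLinearMap.adjoint (P.Rjac l (x l)) (w l) = 0) →
    u = 0 ∧ v = 0 ∧ w = 0

/-- Strict complementarity: multipliers of active inequality constraints are positive. -/
def SCC (x : ∀ l, Vec (n l)) (kap : ∀ l, Vec (mI l)) : Prop :=
  ∀ l m, P.cI l (x l) m = 0 → 0 < kap l m

/-- The critical cone at `x` for the inequality multipliers `kap`. -/
def criticalCone (x : ∀ l, Vec (n l)) (kap : ∀ l, Vec (mI l)) : Set (∀ l, Vec (n l)) :=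
  {d | ∑ l, P.A l (d l) = 0 ∧ (∀ l, P.J l (x l) (d l) = 0) ∧
    ∀ l m, P.cI l (x l) m = 0 →
      (P.Rjac l (x l) (d l) m ≤ 0 ∧ (0 < kap l m → P.Rjac l (x l) (d l) m = 0))}

/-- Second-order sufficient condition: the Hessian of the Lagrangian is positive definite on
the critical cone. -/
def SOSC (x : ∀ l, Vec (n l)) (gam : ∀ l, Vec (mE l)) (kap : ∀ l, Vec (mI l)) : Prop :=
  ∀ d ∈ P.criticalCone x kap, d ≠ 0 →
    0 < ∑ l, ⟪d l, P.hessLag l (kap l) (gam l) (x l) (d l)⟫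

end Original

section Barrier

/-- The local constraints `cE_ℓ(x) = 0`, `cI_ℓ(x) + s = 0` of the barrier problems, on the
domain `s > 0` of the logarithmic barrier. -/
def barrierLocalFeasible (l : R) : Set (Vec (n l) × Vec (mI l)) :=
  {y | P.cE l y.1 = 0 ∧ P.cI l y.1 + y.2 = 0 ∧ ∀ m, 0 < y.2 m}

/-- The local barrier objective `f_ℓ(x) - μ ∑ ln(s⁽ᵐ⁾)`. -/
def barrierObj (μ : ℝ) (l : R) (y : Vec (n l) × Vec (mI l)) : ℝ :=
  P.f l y.1 - μ * ∑ m, Real.log (y.2 m)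

variable [Fintype R]

/-- The feasible set of the coupled barrier problem. -/
def barrierFeasible : Set ((∀ l, Vec (n l)) × (∀ l, Vec (mI l))) :=
  {y | ∑ l, P.A l (y.1 l) = P.b ∧ ∀ l, (y.1 l, y.2 l) ∈ P.barrierLocalFeasible l}

/-- `(x, s)` is a (local) solution of the coupled barrier problem with parameter `μ`. -/
def IsBarrierSolution (μ : ℝ) (x : ∀ l, Vec (n l)) (s : ∀ l, Vec (mI l)) : Prop :=
  (x, s) ∈ P.barrierFeasible ∧
    IsLocalMinOn (fun y : (∀ l, Vec (n l)) × (∀ l, Vec (mI l)) =>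
      ∑ l, P.barrierObj μ l (y.1 l, y.2 l)) P.barrierFeasible (x, s)

/-- The perturbed KKT conditions with parameter `μ`. -/
structure IsPerturbedKKT (μ : ℝ) (w : PrimalDual R n mE mI p) : Prop where
  stat : ∀ l, P.gradLag l (w.kap l) (w.gam l) (w.x l) +
    ContinuousLinearMap.adjoint (P.A l) w.lam = 0
  compl : ∀ l m, -μ + w.s l m * w.kap l m = 0
  eqE : ∀ l, P.cE l (w.x l) = 0
  eqI : ∀ l, P.cI l (w.x l) + w.s l = 0
  cons : ∑ l, P.A l (w.x l) - P.b = 0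

end Barrier

section Algorithm

/-- The objective of the decoupled problem of region `l`. -/
def decoupledObj (μ ρ : ℝ) (Sg : ∀ l, Vec (n l) →L[ℝ] Vec (n l)) (z : ∀ l, Vec (n l))
    (lam : Vec p) (l : R) (y : Vec (n l) × Vec (mI l)) : ℝ :=
  P.barrierObj μ l y + ⟪lam, P.A l y.1⟫ + ρ / 2 * ⟪y.1 - z l, Sg l (y.1 - z l)⟫

/-- `(x_ℓ, s_ℓ, γ_ℓ, κ_ℓ)` is a (local) primal-dual solution of the decoupled barrier problem
`min f^μ_ℓ(x_ℓ, s_ℓ) + λᵀ A_ℓ x_ℓ + ρ/2 ‖x_ℓ - z_ℓ‖²_{Σ_ℓ}  s.t.  cE_ℓ(x_ℓ) = 0, cI_ℓ(x_ℓ) + s_ℓ = 0`: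
a local minimizer together with multipliers satisfying the KKT conditions. -/
structure IsDecoupledSolution (μ ρ : ℝ) (Sg : ∀ l, Vec (n l) →L[ℝ] Vec (n l))
    (z : ∀ l, Vec (n l)) (lam : Vec p) (y : LocalVars R n mE mI) (l : R) : Prop where
  feas : (y.x l, y.s l) ∈ P.barrierLocalFeasible l
  isMin : IsLocalMinOn (P.decoupledObj μ ρ Sg z lam l) (P.barrierLocalFeasible l) (y.x l, y.s l)
  stat : P.gradLag l (y.kap l) (y.gam l) (y.x l) + ContinuousLinearMap.adjoint (P.A l) lam +
    ρ • Sg l (y.x l - z l) = 0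
  compl : ∀ m, y.s l m * y.kap l m = μ

/-- The gradient
`g_ℓ = ∇ₓL_ℓ + A_ℓᵀ λ + R_ℓᵀ S_ℓ⁻¹ (μ 𝟙 + K_ℓ cI_ℓ(x_ℓ))` of the condensed Newton system. -/
def newtonGrad (μ : ℝ) (lam : Vec p) (y : LocalVars R n mE mI) (l : R) : Vec (n l) :=
  P.gradLag l (y.kap l) (y.gam l) (y.x l) + ContinuousLinearMap.adjoint (P.A l) lam +
    ContinuousLinearMap.adjoint (P.Rjac l (y.x l))
      (WithLp.toLp 2 fun m => (μ + y.kap l m * P.cI l (y.x l) m) / y.s l m)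

/-- The bound `‖∇²ₓₓL_ℓ + R_ℓᵀ S_ℓ⁻¹ K_ℓ R_ℓ - H_ℓ‖ ≤ M ‖x_ℓ - z_ℓ‖` in every region. -/
def HessAccurate (M : ℝ) (z : ∀ l, Vec (n l)) (y : LocalVars R n mE mI)
    (H : ∀ l, Vec (n l) →L[ℝ] Vec (n l)) : Prop :=
  ∀ l, ‖P.barrierHess l y - H l‖ ≤ M * ‖y.x l - z l‖

/-- `∇²ₓₓL_ℓ + R_ℓᵀ S_ℓ⁻¹ K_ℓ R_ℓ + ρ Σ_ℓ` is positive definite on `ker J_ℓ` in every region. -/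
def PenaltyLarge (ρ : ℝ) (Sg : ∀ l, Vec (n l) →L[ℝ] Vec (n l))
    (y : LocalVars R n mE mI) : Prop :=
  ∀ l (d : Vec (n l)), P.J l (y.x l) d = 0 → d ≠ 0 →
    0 < ⟪d, (P.barrierHess l y + ρ • Sg l) d⟫

variable [Fintype R]

/-- The coupled Newton system
`[H Jᵀ Aᵀ; J 0 0; A 0 0] (Δx, Δγ, Δλ) = -(g, cE(x), Ax - b)`,
evaluated at a decoupled solution `y`. -/
structure IsCoordStep (μ : ℝ) (lam : Vec p) (y : LocalVars R n mE mI)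
    (H : ∀ l, Vec (n l) →L[ℝ] Vec (n l)) (d : CoordStep R n mE p) : Prop where
  dual : ∀ l, H l (d.dx l) + ContinuousLinearMap.adjoint (P.J l (y.x l)) (d.dgam l) +
    ContinuousLinearMap.adjoint (P.A l) d.dlam = -P.newtonGrad μ lam y l
  primal : ∀ l, P.J l (y.x l) (d.dx l) = -P.cE l (y.x l)
  coupling : ∑ l, P.A l (d.dx l) = -(∑ l, P.A l (y.x l) - P.b)

/-- `H̄_ℓ = [H_ℓ J_ℓᵀ; J_ℓ 0]`. -/
def barH (y : LocalVars R n mE mI) (H : ∀ l, Vec (n l) →L[ℝ] Vec (n l)) (l : R) :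
    (Vec (n l) × Vec (mE l)) →L[ℝ] (Vec (n l) × Vec (mE l)) :=
  ((H l) ∘L (ContinuousLinearMap.fst ℝ _ _) +
    (ContinuousLinearMap.adjoint (P.J l (y.x l))) ∘L (ContinuousLinearMap.snd ℝ _ _)).prod
  ((P.J l (y.x l)) ∘L (ContinuousLinearMap.fst ℝ _ _))

/-- `ḡ_ℓ = (g_ℓ, cE_ℓ(x_ℓ))`. -/
def barG (μ : ℝ) (lam : Vec p) (y : LocalVars R n mE mI) (l : R) : Vec (n l) × Vec (mE l) :=
  (P.newtonGrad μ lam y l, P.cE l (y.x l))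

/-- `Ā_ℓ = [A_ℓ 0]`. -/
def barA (l : R) : (Vec (n l) × Vec (mE l)) →L[ℝ] Vec p :=
  (P.A l) ∘L (ContinuousLinearMap.fst ℝ _ _)

/-- `Ā_ℓᵀ`. -/
def barAT (l : R) : Vec p →L[ℝ] (Vec (n l) × Vec (mE l)) :=
  (ContinuousLinearMap.adjoint (P.A l)).prod 0

/-- The condensed form of the coordination step:
`W Δλ = -h` with `W = ∑ W_ℓ`, `W_ℓ = -Ā_ℓ H̄_ℓ⁻¹ Ā_ℓᵀ`, `h = -b + ∑ h_ℓ`,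
`h_ℓ = A_ℓ x_ℓ - Ā_ℓ H̄_ℓ⁻¹ ḡ_ℓ`, and `(Δx_ℓ, Δγ_ℓ) = -H̄_ℓ⁻¹ (Ā_ℓᵀ Δλ + ḡ_ℓ)`. -/
structure IsCondensedStep (μ : ℝ) (lam : Vec p) (y : LocalVars R n mE mI)
    (H : ∀ l, Vec (n l) →L[ℝ] Vec (n l)) (d : CoordStep R n mE p) : Prop where
  coord : (∑ l, -((P.barA l) ∘L (P.barH y H l).inverse ∘L (P.barAT l))) d.dlam =
    -(-P.b + ∑ l, (P.A l (y.x l) - P.barA l ((P.barH y H l).inverse (P.barG μ lam y l))))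
  recover : ∀ l, (d.dx l, d.dgam l) =
    -(P.barH y H l).inverse (P.barAT l d.dlam + P.barG μ lam y l)

/-- Whenever the local matrices `H̄_ℓ` are nonsingular, so that the condensed quantities exist,
the condensed step is the solution of the coupled Newton system. -/
theorem isCoordStep_iff_isCondensedStep (μ : ℝ) (lam : Vec p) (y : LocalVars R n mE mI)
    (H : ∀ l, Vec (n l) →L[ℝ] Vec (n l)) (d : CoordStep R n mE p)
    (hH : ∀ l, (P.barH y H l).IsInvertible) :
    P.IsCoordStep μ lam y H d ↔ P.IsCondensedStep μ lam y H d := by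
  have key : ∀ l, ((d.dx l, d.dgam l) =
      -(P.barH y H l).inverse (P.barAT l d.dlam + P.barG μ lam y l)) ↔
      (H l (d.dx l) + ContinuousLinearMap.adjoint (P.J l (y.x l)) (d.dgam l) +
        ContinuousLinearMap.adjoint (P.A l) d.dlam = -P.newtonGrad μ lam y l ∧
      P.J l (y.x l) (d.dx l) = -P.cE l (y.x l)) := by
    intro l
    obtain ⟨e, he⟩ := hH l
    have h1 : (H l (d.dx l) + ContinuousLinearMap.adjoint (P.J l (y.x l)) (d.dgam l) +
        ContinuousLinearMap.adjoint (P.A l) d.dlam = -P.newtonGrad μ lam y l ∧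
        P.J l (y.x l) (d.dx l) = -P.cE l (y.x l)) ↔
        P.barH y H l (d.dx l, d.dgam l) = -(P.barAT l d.dlam + P.barG μ lam y l) := by
      have h2 : P.barH y H l (d.dx l, d.dgam l) =
          (H l (d.dx l) + ContinuousLinearMap.adjoint (P.J l (y.x l)) (d.dgam l),
            P.J l (y.x l) (d.dx l)) := rfl
      have h3 : P.barAT l d.dlam + P.barG μ lam y l =
          (ContinuousLinearMap.adjoint (P.A l) d.dlam + P.newtonGrad μ lam y l,
            0 + P.cE l (y.x l)) := rfl
      rw [h2, h3, Prod.neg_mk, Prod.mk.injEq, zero_add, neg_add, ← eq_sub_iff_add_eq,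
        sub_eq_add_neg, add_comm (-P.newtonGrad μ lam y l)]
    rw [h1, ← he, ContinuousLinearMap.inverse_equiv, ← map_neg]
    exact ContinuousLinearEquiv.eq_symm_apply e
  have hsum : (∀ l, (d.dx l, d.dgam l) =
      -(P.barH y H l).inverse (P.barAT l d.dlam + P.barG μ lam y l)) →
      ((∑ l, -((P.barA l) ∘L (P.barH y H l).inverse ∘L (P.barAT l))) d.dlam =
        -(-P.b + ∑ l, (P.A l (y.x l) - P.barA l ((P.barH y H l).inverse (P.barG μ lam y l)))) ↔
      ∑ l, P.A l (d.dx l) = -(∑ l, P.A l (y.x l) - P.b)) := by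
    intro hr
    have hA : ∀ l, P.A l (d.dx l) =
        (-((P.barA l) ∘L (P.barH y H l).inverse ∘L (P.barAT l))) d.dlam -
          P.barA l ((P.barH y H l).inverse (P.barG μ lam y l)) := by
      intro l
      have : P.A l (d.dx l) = P.barA l (d.dx l, d.dgam l) := rfl
      rw [this, hr l, map_neg, map_add, map_add, neg_add, sub_eq_add_neg]
      rfl
    rw [Finset.sum_congr rfl fun l _ => hA l, Finset.sum_sub_distrib, Finset.sum_sub_distrib,
      sum_apply, sub_eq_iff_eq_add]
    refine Eq.congr_right ?_
    abel
  constructor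
  · rintro ⟨h1, h2, h3⟩
    have hr := fun l => (key l).2 ⟨h1 l, h2 l⟩
    exact ⟨(hsum hr).2 h3, hr⟩
  · rintro ⟨h1, h2⟩
    exact ⟨fun l => ((key l).1 (h2 l)).1, fun l => ((key l).1 (h2 l)).2, (hsum h2).1 h1⟩

end Algorithm

end DistNLP

/-- All quantities computed in one inner iteration: the current `(z, λ)`, the decoupled solution
`(x, s, γ, κ)`, the Hessian approximations `H_ℓ`, the step `(Δx, Δγ, Δλ, Δs, Δκ)`, the local
step lengths `βᵖ_ℓ`, `βᵈ_ℓ` and their minima `βᵖ`, `βᵈ`. -/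
structure Iterate (R : Type*) (n mE mI : R → ℕ) (p : ℕ) where
  z : ∀ l : R, Vec (n l)
  lam : Vec p
  sol : LocalVars R n mE mI
  H : ∀ l : R, Vec (n l) →L[ℝ] Vec (n l)
  step : CoordStep R n mE p
  ds : ∀ l : R, Vec (mI l)
  dkap : ∀ l : R, Vec (mI l)
  betaPLoc : R → ℝ
  betaDLoc : R → ℝ
  betaP : ℝ
  betaD : ℝ

/-- The admissible step lengths `{β ∈ (0,1] : v + β Δv ≥ (1 - τ) v}` of the
fraction-to-boundary rule. -/
def boundarySteps {k : ℕ} (τ : ℝ) (v dv : Vec k) : Set ℝ :=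
  {β | 0 < β ∧ β ≤ 1 ∧ ∀ m, (1 - τ) * v m ≤ v m + β * dv m}

namespace DistNLP

variable {R : Type*} {n mE mI : R → ℕ} {p : ℕ} (P : DistNLP R n mE mI p) [Fintype R]

/-- `w` is one pass through the algorithm with barrier parameter `μ`, penalty `ρ`, scalings `Sg`
and fraction-to-boundary parameter `τ`, up to the final update. -/
structure IsIteration (μ ρ : ℝ) (Sg : ∀ l, Vec (n l) →L[ℝ] Vec (n l)) (τ : ℝ)
    (w : Iterate R n mE mI p) : Prop where
  decoupled : ∀ l, P.IsDecoupledSolution μ ρ Sg w.z w.lam w.sol l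
  coord : P.IsCoordStep μ w.lam w.sol w.H w.step
  slack : ∀ l, w.ds l =
    -P.cI l (w.sol.x l) - w.sol.s l - P.Rjac l (w.sol.x l) (w.step.dx l)
  dual : ∀ l m, w.dkap l m =
    -w.sol.kap l m + (μ - w.sol.kap l m * w.ds l m) / w.sol.s l m
  betaPLoc : ∀ l, IsGreatest (boundarySteps τ (w.sol.s l) (w.ds l)) (w.betaPLoc l)
  betaDLoc : ∀ l, IsGreatest (boundarySteps τ (w.sol.kap l) (w.dkap l)) (w.betaDLoc l)
  betaP : IsLeast (Set.range w.betaPLoc) w.betaP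
  betaD : IsLeast (Set.range w.betaDLoc) w.betaD

/-- `w` is a sequence of inner iterations (`μ` fixed) with step sizes `α₁, α₂, α₃`:
`z⁺ = z + α₁ (x - z) + α₂ βᵖ Δx` and `λ⁺ = λ + α₃ βᵈ Δλ`. -/
structure IsInnerRun (μ ρ : ℝ) (Sg : ∀ l, Vec (n l) →L[ℝ] Vec (n l)) (τ α₁ α₂ α₃ : ℝ)
    (w : ℕ → Iterate R n mE mI p) : Prop where
  iter : ∀ k, P.IsIteration μ ρ Sg τ (w k)
  updateZ : ∀ k l, (w (k + 1)).z l = (w k).z l + α₁ • ((w k).sol.x l - (w k).z l) +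
    (α₂ * (w k).betaP) • (w k).step.dx l
  updateLam : ∀ k, (w (k + 1)).lam = (w k).lam + (α₃ * (w k).betaD) • (w k).step.dlam

/-- A full-step run (`α₁ = α₂ = α₃ = 1`) with Hessian error at most `M ‖x_ℓ - z_ℓ‖` whose
decoupled problems are solved locally, within distance `r` of `xbar`. -/
structure IsLocalFullStepRun (μ ρ : ℝ) (Sg : ∀ l, Vec (n l) →L[ℝ] Vec (n l)) (τ M r : ℝ)
    (xbar : ∀ l, Vec (n l)) (w : ℕ → Iterate R n mE mI p) : Prop where
  run : P.IsInnerRun μ ρ Sg τ 1 1 1 w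
  hess : ∀ k, P.HessAccurate M (w k).z (w k).sol (w k).H
  near : ∀ k, dist (w k).sol.x xbar < r

end DistNLP

end BarrierALADIN

end

/-!
The theorem has two halves: the central path near `xs`, and the inner iteration at a fixed `μ`.
Throughout, slacks and inequality multipliers are eliminated through `s = -cI(x)` and
`κ = μ S⁻¹ 𝟙` (`kapOf`), which turns the barrier Hessian into a function `condHess` of `(x, γ)`,
the derivative in `x` of the condensed gradient `x ↦ ∇ₓL(x, κ(x), γ)`.

**Central path.** The perturbed KKT system is the equation `kktMap w = kktTarget μ`. At the KKT
point of the original problem the derivative of `kktMap` is nonsingular (`kktDeriv_injective`, from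
LICQ, strict complementarity and the second-order condition), so the inverse function theorem gives
the path and its local uniqueness (`exists_centralPath`). Near that point its solutions are
strictly feasible and satisfy the second-order condition of the barrier problem
(`eventually_perturbedKKT_regular`): by Finsler's lemma the Hessian of the Lagrangian is positive
definite after adding a multiple of the squared active constraints, and the barrier contributes the
weights `κ/s`, which are arbitrarily large there. Hence they are local minimizers. Conversely every
barrier solution near `xs` has multipliers, and for small `μ` these are close to the given ones,
because LICQ bounds them uniformly (`eventually_barrierSolution_multipliers`); so local uniqueness
of the path is uniqueness of the barrier solution.

**Inner iteration.** The penalty makes the decoupled KKT systems nonsingular at the base point, so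
that their solutions exist, are locally unique and Lipschitz in `(z, λ)`
(`IsDecoupledRegular.eventually_exists`, `IsDecoupledRegular.eventually_norm_le`). The error after
the coordination step solves the Newton system with the Taylor remainder
`H (x - x̄) - (Ψ(x) - Ψ(x̄))` of the condensed gradient `Ψ` as right-hand side, together with the
defect `J(x) (x - x̄)` (`IsBarrierRegular.newtonOp_error`). The Newton matrix is uniformly
invertible near the base point, and both terms are of the order `‖x - x̄‖ · e`, where
`e = ‖z - x̄‖ + ‖λ - λ̄‖`. Second derivatives are Lipschitz only on the feasible sets, so the
remainder is integrated along curves in the level set `cE = 0`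
(`isBigO_taylor_on_levelSet`). Finally the fraction-to-boundary rule admits the full step near the
base point, since the primal step tends to zero while the slacks stay bounded below.
-/

noncomputable section

namespace BarrierALADIN

/-! ### Quadratic forms and injective operators in finite dimension -/

section Finite

variable {E F : Type*} [NormedAddCommGroup E] [NormedSpace ℝ E] [FiniteDimensional ℝ E]
  [NormedAddCommGroup F] [NormedSpace ℝ F]

/-- Finsler's lemma: a quadratic form that is positive on `ker L` becomes coercive after adding a
multiple of `‖L x‖²`. -/
theorem exists_forall_le_add_penalty (Q : E →L[ℝ] E →L[ℝ] ℝ) (L : E →L[ℝ] F)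
    (h : ∀ x, x ≠ 0 → L x = 0 → 0 < Q x x) :
    ∃ c > 0, ∃ σ > 0, ∀ x, σ * ‖x‖ ^ 2 ≤ Q x x + c * ‖L x‖ ^ 2 := by
  have hS : IsCompact (Metric.sphere (0 : E) 1) := isCompact_sphere 0 1
  have hQ : Continuous fun x => Q x x := by fun_prop
  -- away from the set where `Q` is positive, `L` is bounded below
  have hK : IsCompact (Metric.sphere (0 : E) 1 ∩ {x | Q x x ≤ 0}) :=
    hS.inter_right (isClosed_le hQ continuous_const)
  obtain ⟨m, hm, hmK⟩ : ∃ m > 0, ∀ x ∈ Metric.sphere (0 : E) 1 ∩ {x | Q x x ≤ 0},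
      m ≤ ‖L x‖ ^ 2 := by
    refine hK.exists_forall_le' (f := fun x => ‖L x‖ ^ 2) (by fun_prop) (a := 0) ?_
    rintro x ⟨hx1, hx2⟩
    have hx0 : x ≠ 0 := by
      rintro rfl
      simp at hx1
    have : L x ≠ 0 := fun h0 => absurd (h x hx0 h0) (not_lt.2 hx2)
    positivity
  obtain ⟨B, hB⟩ := hS.exists_bound_of_continuousOn hQ.continuousOn
  have hB' : 0 < |B| + 1 := by positivity
  obtain ⟨σ, hσ, hσS⟩ : ∃ σ > 0, ∀ x ∈ Metric.sphere (0 : E) 1,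
      σ ≤ Q x x + (|B| + 1) / m * ‖L x‖ ^ 2 := by
    refine hS.exists_forall_le' (f := fun x => Q x x + (|B| + 1) / m * ‖L x‖ ^ 2)
      (by fun_prop) (a := 0) ?_
    intro x hx
    by_cases hx0 : Q x x ≤ 0
    · have h1 := hmK x ⟨hx, hx0⟩
      have h2 := hB x hx
      rw [Real.norm_eq_abs] at h2
      have h3 : (|B| + 1) / m * m ≤ (|B| + 1) / m * ‖L x‖ ^ 2 := by gcongr
      rw [div_mul_cancel₀ _ hm.ne'] at h3
      have := neg_abs_le (Q x x)
      have := le_abs_self B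
      linarith
    · have : 0 ≤ (|B| + 1) / m * ‖L x‖ ^ 2 := by positivity
      linarith
  refine ⟨(|B| + 1) / m, by positivity, σ, hσ, fun x => ?_⟩
  rcases eq_or_ne x 0 with rfl | hx
  · simp
  have hn : ‖x‖ ≠ 0 := norm_ne_zero_iff.2 hx
  have h1 := hσS (‖x‖⁻¹ • x) (by simp [norm_smul, hn])
  simp only [map_smul, smul_apply, smul_eq_mul, norm_smul, norm_inv, norm_norm] at h1
  have h2 := mul_le_mul_of_nonneg_left h1 (sq_nonneg ‖x‖)
  calc σ * ‖x‖ ^ 2 = ‖x‖ ^ 2 * σ := mul_comm _ _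
    _ ≤ _ := h2
    _ = _ := by field_simp

/-- Positive definiteness on the kernel is stable under perturbation, after adding a penalty. -/
theorem eventually_pos_add_penalty {W : Type*} [TopologicalSpace W] {w₀ : W}
    {Q : W → E →L[ℝ] E →L[ℝ] ℝ} {L : W → E →L[ℝ] F} (hQ : ContinuousAt Q w₀)
    (hL : ContinuousAt L w₀) (h : ∀ x, x ≠ 0 → L w₀ x = 0 → 0 < Q w₀ x x) :
    ∃ c > 0, ∀ᶠ w in 𝓝 w₀, ∀ x, x ≠ 0 → 0 < Q w x x + c * ‖L w x‖ ^ 2 := by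
  obtain ⟨c, hc, σ, hσ, hle⟩ := exists_forall_le_add_penalty (Q w₀) (L w₀) h
  have hev : ∀ᶠ w in 𝓝 w₀, ∀ x ∈ Metric.sphere (0 : E) 1, 0 < Q w x x + c * ‖L w x‖ ^ 2 := by
    refine (isCompact_sphere 0 1).eventually_forall_of_forall_eventually fun x hx => ?_
    have hcont : ContinuousAt (fun z : W × E => Q z.1 z.2 z.2 + c * ‖L z.1 z.2‖ ^ 2) (w₀, x) := by
      have h1 : ContinuousAt (fun z : W × E => Q z.1) (w₀, x) := hQ.comp_of_eq continuousAt_fst rfl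
      have h2 : ContinuousAt (fun z : W × E => L z.1) (w₀, x) := hL.comp_of_eq continuousAt_fst rfl
      have h3 : ContinuousAt (fun z : W × E => z.2) (w₀, x) := continuousAt_snd
      exact ((h1.clm_apply h3).clm_apply h3).add
        (continuousAt_const.mul ((h2.clm_apply h3).norm.pow 2))
    refine hcont.eventually (lt_mem_nhds ?_)
    have h1 := hle x
    rw [mem_sphere_zero_iff_norm] at hx
    rw [hx] at h1
    linarith
  refine ⟨c, hc, hev.mono fun w hw x hx => ?_⟩
  have hn : ‖x‖ ≠ 0 := norm_ne_zero_iff.2 hx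
  have h1 := hw (‖x‖⁻¹ • x) (by simp [norm_smul, hn])
  simp only [map_smul, smul_apply, smul_eq_mul, norm_smul, norm_inv, norm_norm] at h1
  have h2 : 0 < ‖x‖ ^ 2 * (‖x‖⁻¹ * (‖x‖⁻¹ * Q w x x) + c * (‖x‖⁻¹ * ‖L w x‖) ^ 2) := by
    positivity
  convert h2 using 1
  field_simp

theorem eventually_pos_on_ker {W : Type*} [TopologicalSpace W] {w₀ : W}
    {Q : W → E →L[ℝ] E →L[ℝ] ℝ} {L : W → E →L[ℝ] F} (hQ : ContinuousAt Q w₀)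
    (hL : ContinuousAt L w₀) (h : ∀ x, x ≠ 0 → L w₀ x = 0 → 0 < Q w₀ x x) :
    ∀ᶠ w in 𝓝 w₀, ∀ x, x ≠ 0 → L w x = 0 → 0 < Q w x x := by
  obtain ⟨c, -, hev⟩ := eventually_pos_add_penalty hQ hL h
  refine hev.mono fun w hw x hx hLx => ?_
  simpa [hLx] using hw x hx

theorem exists_norm_le_mul_norm_apply (N : E →L[ℝ] F) (h : ∀ v, N v = 0 → v = 0) :
    ∃ C > 0, ∀ v, ‖v‖ ≤ C * ‖N v‖ := by
  obtain ⟨K, hK, hN⟩ := (N : E →ₗ[ℝ] F).exists_antilipschitzWith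
    (LinearMap.ker_eq_bot'.2 fun v hv => h v hv)
  refine ⟨K, by exact_mod_cast hK, fun v => ?_⟩
  simpa using hN.le_mul_dist v 0

/-- The lower bound of an injective operator holds uniformly near it. -/
theorem eventually_norm_le_mul_norm_apply {W : Type*} [TopologicalSpace W] {w₀ : W}
    {N : W → E →L[ℝ] F} (hN : ContinuousAt N w₀) (h : ∀ v, N w₀ v = 0 → v = 0) :
    ∃ C > 0, ∀ᶠ w in 𝓝 w₀, ∀ v, ‖v‖ ≤ C * ‖N w v‖ := by
  obtain ⟨C, hC, hle⟩ := exists_norm_le_mul_norm_apply (N w₀) h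
  refine ⟨2 * C, by positivity, ?_⟩
  have hball := hN.eventually (Metric.ball_mem_nhds (N w₀) (ε := 1 / (2 * C)) (by positivity))
  refine hball.mono fun w hw v => ?_
  rw [dist_eq_norm] at hw
  have h1 : ‖N w₀ v‖ ≤ ‖N w v‖ + 1 / (2 * C) * ‖v‖ := by
    have h2 : ‖(N w - N w₀) v‖ ≤ 1 / (2 * C) * ‖v‖ := (N w - N w₀).le_of_opNorm_le hw.le v
    rw [sub_apply] at h2
    have h3 := norm_sub_norm_le (N w₀ v) (N w v)
    rw [norm_sub_rev] at h3
    linarith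
  have h4 := (hle v).trans (mul_le_mul_of_nonneg_left h1 hC.le)
  have h5 : C * (‖N w v‖ + 1 / (2 * C) * ‖v‖) = C * ‖N w v‖ + ‖v‖ / 2 := by field_simp
  linarith

/-- The inverse function theorem for an endomorphism whose strict derivative is injective: a
Lipschitz bound for the local inverse, and openness. -/
theorem hasStrictFDerivAt_inverse {f : E → E} {T : E →L[ℝ] E} {a : E}
    (hf : HasStrictFDerivAt f T a) (hT : ∀ v, T v = 0 → v = 0) :
    (∃ C > 0, ∀ᶠ q : E × E in 𝓝 (a, a), ‖q.1 - q.2‖ ≤ C * ‖f q.1 - f q.2‖) ∧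
      map f (𝓝 a) = 𝓝 (f a) := by
  have : CompleteSpace E := FiniteDimensional.complete ℝ E
  constructor
  · obtain ⟨C, hC, hle⟩ := exists_norm_le_mul_norm_apply T hT
    refine ⟨2 * C, by positivity, ?_⟩
    have ho := hf.isLittleO.def (c := 1 / (2 * C)) (by positivity)
    refine ho.mono fun q hq => ?_
    have h1 := hle (q.1 - q.2)
    have h2 : ‖T (q.1 - q.2)‖ ≤ ‖f q.1 - f q.2‖ + 1 / (2 * C) * ‖q.1 - q.2‖ := by
      have h3 := norm_sub_norm_le (T (q.1 - q.2)) (f q.1 - f q.2)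
      rw [norm_sub_rev (T (q.1 - q.2))] at h3
      linarith
    have h4 := h1.trans (mul_le_mul_of_nonneg_left h2 hC.le)
    have h5 : C * (‖f q.1 - f q.2‖ + 1 / (2 * C) * ‖q.1 - q.2‖) =
        C * ‖f q.1 - f q.2‖ + ‖q.1 - q.2‖ / 2 := by field_simp
    linarith
  · refine hf.map_nhds_eq_of_surj ?_
    have : Function.Injective (T : E →ₗ[ℝ] E) :=
      LinearMap.ker_eq_bot.1 (LinearMap.ker_eq_bot'.2 fun v hv => hT v hv)
    exact LinearMap.range_eq_top.2 (LinearMap.injective_iff_surjective.1 this)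

/-- Second-order sufficient condition for equality constraints: `g` is the Lagrangian, which on
the feasible set `S` equals the objective up to a constant. -/
theorem isLocalMinOn_of_pos_on_ker {g : E → ℝ} {G : E → E →L[ℝ] ℝ} {Q : E →L[ℝ] E →L[ℝ] ℝ}
    {c : E → F} {L : E →L[ℝ] F} {a : E} {S : Set E}
    (hg : ∀ᶠ x in 𝓝 a, HasFDerivAt g (G x) x) (hG0 : G a = 0) (hG : HasFDerivAt G Q a)
    (hc : HasFDerivAt c L a) (hS : ∀ x ∈ S, c x = c a)
    (hpos : ∀ x, x ≠ 0 → L x = 0 → 0 < Q x x) : IsLocalMinOn g S a := by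
  obtain ⟨k, hk, σ, hσ, hle⟩ := exists_forall_le_add_penalty Q L hpos
  have hε : 0 < √(σ / (2 * k)) := by positivity
  have h1 := hc.isLittleO.def hε
  have h2 := hG.isLittleO.def (half_pos hσ)
  obtain ⟨r, hr, hball⟩ := Metric.eventually_nhds_iff_ball.1 (hg.and (h1.and h2))
  have hev : ∀ᶠ x in 𝓝[S] a, x ∈ Metric.ball a r ∧ x ∈ S :=
    (eventually_mem_nhdsWithin.and (mem_nhdsWithin_of_mem_nhds (Metric.ball_mem_nhds a hr))).mono
      fun _ h => h.symm
  refine hev.mono fun x ⟨hxr, hxS⟩ => ?_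
  set d := x - a with hd
  have hseg : ∀ t ∈ Set.Icc (0 : ℝ) 1, a + t • d ∈ Metric.ball a r := by
    intro t ht
    rw [mem_ball_iff_norm] at hxr ⊢
    rw [add_sub_cancel_left, norm_smul, Real.norm_of_nonneg ht.1]
    exact (mul_le_of_le_one_left (norm_nonneg _) ht.2).trans_lt hxr
  have hder : ∀ t ∈ Set.Icc (0 : ℝ) 1,
      HasDerivAt (fun t : ℝ => g (a + t • d)) (G (a + t • d) d) t := by
    intro t ht
    have h3 : HasDerivAt (fun t : ℝ => a + t • d) d t := by
      simpa using ((hasDerivAt_id t).smul_const d).const_add a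
    exact (hball _ (hseg t ht)).1.comp_hasDerivAt t h3
  -- feasible directions are almost in the kernel of `L`, so `Q` is coercive along `d`
  have hQd : σ / 2 * ‖d‖ ^ 2 ≤ Q d d := by
    have h3 := (hball x hxr).2.1
    rw [hS x hxS, sub_self, zero_sub, norm_neg] at h3
    have h4 : ‖L d‖ ^ 2 ≤ σ / (2 * k) * ‖d‖ ^ 2 := by
      calc ‖L d‖ ^ 2 ≤ (√(σ / (2 * k)) * ‖d‖) ^ 2 := by gcongr
        _ = _ := by rw [mul_pow, Real.sq_sqrt (by positivity)]
    have h5 := hle d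
    have h6 : k * ‖L d‖ ^ 2 ≤ k * (σ / (2 * k) * ‖d‖ ^ 2) := by gcongr
    have h7 : k * (σ / (2 * k) * ‖d‖ ^ 2) = σ / 2 * ‖d‖ ^ 2 := by field_simp
    linarith
  obtain ⟨t, ht, hslope⟩ := exists_hasDerivAt_eq_slope (fun t : ℝ => g (a + t • d))
    (fun t => G (a + t • d) d) one_pos
    (fun t ht => (hder t ht).continuousAt.continuousWithinAt)
    (fun t ht => hder t ⟨ht.1.le, ht.2.le⟩)
  have h8 := (hball _ (hseg t ⟨ht.1.le, ht.2.le⟩)).2.2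
  rw [hG0, sub_zero, add_sub_cancel_left, map_smul] at h8
  have h9 : ‖(G (a + t • d) - t • Q d) d‖ ≤ σ / 2 * ‖t • d‖ * ‖d‖ :=
    (G (a + t • d) - t • Q d).le_of_opNorm_le h8 d
  rw [sub_apply, smul_apply, norm_smul, Real.norm_of_nonneg ht.1.le, smul_eq_mul,
    Real.norm_eq_abs] at h9
  have h10 := (abs_le.1 h9).1
  have h11 : t * (σ / 2 * ‖d‖ ^ 2) ≤ t * Q d d := mul_le_mul_of_nonneg_left hQd ht.1.le
  have h12 : 0 ≤ G (a + t • d) d := by nlinarith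
  rw [hslope] at h12
  simp only [one_smul, zero_smul, add_zero, sub_zero, div_one] at h12
  have h13 : a + d = x := by rw [hd]; abel
  rw [h13] at h12
  change g a ≤ g x
  linarith

end Finite

/-- A `C¹` map whose derivative is Lipschitz at `a` only along the level set `{c = c a}` of a
submersion still has a quadratic Taylor remainder along that level set: the remainder is
integrated along curves in the level set, given by the implicit function theorem. -/
theorem isBigO_taylor_on_levelSet {E F G : Type*} [NormedAddCommGroup E] [NormedSpace ℝ E]
    [FiniteDimensional ℝ E] [NormedAddCommGroup F] [NormedSpace ℝ F] [FiniteDimensional ℝ F]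
    [NormedAddCommGroup G] [NormedSpace ℝ G] {c : E → F} {a : E} (hc : ContDiffAt ℝ 1 c a)
    (hsurj : (fderiv ℝ c a).range = ⊤) {h : E → G} {h' : E → E →L[ℝ] G}
    (hh : ∀ᶠ x in 𝓝 a, HasFDerivAt h (h' x) x)
    (hlip : (fun x => h' x - h' a) =O[𝓝[{x | c x = c a}] a] fun x => x - a) :
    (fun x => h x - h a - h' a (x - a)) =O[𝓝[{x | c x = c a}] a] fun x => ‖x - a‖ ^ 2 := by
  have : CompleteSpace E := FiniteDimensional.complete ℝ E
  have : CompleteSpace F := FiniteDimensional.complete ℝ F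
  have hstrict : HasStrictFDerivAt c (fderiv ℝ c a) a := hc.hasStrictFDerivAt one_ne_zero
  have hker : (fderiv ℝ c a).ker.ClosedComplemented :=
    Submodule.ClosedComplemented.of_finiteDimensional_quotient
      (ContinuousLinearMap.isClosed_ker _)
  set φ := HasStrictFDerivAt.implicitFunctionDataOfComplemented c (fderiv ℝ c a) hstrict hsurj
    hker with hφ
  set pr : E →L[ℝ] (fderiv ℝ c a).ker := Classical.choose hker with hpr
  have hpt : φ.pt = a := rfl
  have hleft : φ.leftFun = c := rfl
  have hright : ∀ x, φ.rightFun x = pr (x - a) := fun x => rfl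
  have hpr0 : φ.rightFun a = 0 := by rw [hright, sub_self, map_zero]
  set ψ : (fderiv ℝ c a).ker → E := φ.implicitFunction (c a) with hψ
  have hψC : ContDiffAt ℝ 1 ψ 0 := by
    have h1 : ContDiffAt ℝ 1 φ.implicitFunction.uncurry (φ.prodFun φ.pt) := by
      refine φ.contDiffAt_implicitFunction hc ?_ one_ne_zero
      have : ContDiff ℝ 1 fun x => pr (x - a) := by fun_prop
      exact this.contDiffAt
    have h2 : φ.prodFun φ.pt = (c a, 0) := by
      rw [φ.prodFun_apply, hpt, hleft, hpr0]
    rw [h2] at h1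
    exact h1.comp (0 : (fderiv ℝ c a).ker) (contDiffAt_const.prodMk contDiffAt_id)
  have hinv : ∀ᶠ x in 𝓝 a, c x = c a ↔ ψ (pr (x - a)) = x := φ.leftFun_eq_iff_implicitFunction
  have hψ0 : ψ 0 = a := by
    have := hinv.self_of_nhds.1 rfl
    rwa [sub_self, map_zero] at this
  have hψc : ∀ᶠ u in 𝓝 0, c (ψ u) = c a := by
    have h1 := φ.leftFun_implicitFunction
    have h2 : φ.prodFun φ.pt = (c a, 0) := by
      rw [φ.prodFun_apply, hpt, hleft, hpr0]
    rw [h2] at h1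
    exact (Continuous.prodMk_right (c a)).continuousAt.eventually h1
  have hψt : Tendsto ψ (𝓝 0) (𝓝 a) := by
    have := hψC.continuousAt.tendsto
    rwa [hψ0] at this
  obtain ⟨C, hC⟩ := hlip.bound
  rw [eventually_nhdsWithin_iff] at hC
  obtain ⟨K, hK⟩ : ∃ K, ∀ᶠ u in 𝓝 0, ‖fderiv ℝ ψ u‖ ≤ K := by
    have h1 := (hψC.fderiv_right (m := 0) le_rfl).continuousAt.norm
    exact ⟨_, (h1.eventually (gt_mem_nhds (lt_add_one _))).mono fun u hu => hu.le⟩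
  have hψd : ∀ᶠ u in 𝓝 0, HasFDerivAt ψ (fderiv ℝ ψ u) u :=
    (hψC.eventually (by simp)).mono fun u hu => (hu.differentiableAt one_ne_zero).hasFDerivAt
  obtain ⟨r, hr, hball⟩ := Metric.eventually_nhds_iff_ball.1
    (hψd.and (hK.and (hψc.and ((hψt.eventually hh).and (hψt.eventually hC)))))
  have hK0 : 0 ≤ K := (norm_nonneg (fderiv ℝ ψ 0)).trans (hball 0 (Metric.mem_ball_self hr)).2.1
  have hψlip : ∀ u ∈ Metric.ball 0 r, ‖ψ u - a‖ ≤ K * ‖u‖ := by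
    intro u hu
    have := (convex_ball (0 : (fderiv ℝ c a).ker) r).norm_image_sub_le_of_norm_hasFDerivWithin_le
      (fun v hv => (hball v hv).1.hasFDerivWithinAt) (fun v hv => (hball v hv).2.1)
      (Metric.mem_ball_self hr) hu
    rwa [hψ0, sub_zero] at this
  have hmain : ∀ u ∈ Metric.ball 0 r,
      ‖h (ψ u) - h a - h' a (ψ u - a)‖ ≤ |C| * (K * ‖u‖) * K * ‖u‖ := by
    intro u hu
    have hsub : ∀ v ∈ Metric.closedBall (0 : (fderiv ℝ c a).ker) ‖u‖, v ∈ Metric.ball 0 r := by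
      intro v hv
      rw [mem_closedBall_zero_iff] at hv
      rw [mem_ball_zero_iff] at hu ⊢
      exact hv.trans_lt hu
    have h1 := (convex_closedBall (0 : (fderiv ℝ c a).ker)
      ‖u‖).norm_image_sub_le_of_norm_hasFDerivWithin_le
      (f := fun v => h (ψ v) - h' a (ψ v)) (f' := fun v => (h' (ψ v) - h' a) ∘L fderiv ℝ ψ v)
      (C := |C| * (K * ‖u‖) * K) (x := 0) (y := u) ?_ ?_ (by simp) (by simp)
    · simp only [hψ0, sub_zero] at h1
      convert h1 using 2
      rw [map_sub]
      abel
    · intro v hv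
      obtain ⟨b1, -, -, b4, -⟩ := hball v (hsub v hv)
      rw [ContinuousLinearMap.sub_comp]
      exact ((b4.comp v b1).sub ((h' a).hasFDerivAt.comp v b1)).hasFDerivWithinAt
    · intro v hv
      obtain ⟨b1, b2, b3, b4, b5⟩ := hball v (hsub v hv)
      refine (ContinuousLinearMap.opNorm_comp_le _ _).trans ?_
      have h2 : ‖h' (ψ v) - h' a‖ ≤ |C| * (K * ‖u‖) := by
        refine (b5 b3).trans ?_
        have h3 := hψlip v (hsub v hv)
        rw [mem_closedBall_zero_iff] at hv
        calc C * ‖ψ v - a‖ ≤ |C| * ‖ψ v - a‖ := by gcongr; exact le_abs_self C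
          _ ≤ |C| * (K * ‖v‖) := by gcongr
          _ ≤ |C| * (K * ‖u‖) := by gcongr
      exact mul_le_mul h2 b2 (norm_nonneg _) (by positivity)
  refine Asymptotics.IsBigO.of_bound (|C| * K * K * ‖pr‖ ^ 2) ?_
  have hprt : Tendsto (fun x => pr (x - a)) (𝓝 a) (𝓝 0) := by
    have : ContinuousAt (fun x => pr (x - a)) a := by fun_prop
    have h1 := this.tendsto
    rwa [sub_self, map_zero] at h1
  rw [eventually_nhdsWithin_iff]
  filter_upwards [hinv, hprt.eventually (Metric.ball_mem_nhds 0 hr)] with x hx hxr hxc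
  have h1 := hmain _ hxr
  rw [hx.1 hxc] at h1
  refine h1.trans ?_
  have h2 : ‖pr (x - a)‖ ≤ ‖pr‖ * ‖x - a‖ := pr.le_opNorm _
  rw [norm_pow, norm_norm]
  calc |C| * (K * ‖pr (x - a)‖) * K * ‖pr (x - a)‖ = |C| * K * K * ‖pr (x - a)‖ ^ 2 := by ring
    _ ≤ |C| * K * K * (‖pr‖ * ‖x - a‖) ^ 2 := by gcongr
    _ = _ := by ring

/-! ### Calculus of the local Lagrangians -/

section Adjoint

variable (E F : Type*) [NormedAddCommGroup E] [InnerProductSpace ℝ E] [CompleteSpace E]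
  [NormedAddCommGroup F] [InnerProductSpace ℝ F] [CompleteSpace F]

/-- The adjoint as a continuous linear map (over `ℝ` it is not only conjugate-linear). -/
def adjointL : (E →L[ℝ] F) →L[ℝ] (F →L[ℝ] E) :=
  LinearMap.mkContinuous
    { toFun := fun T => ContinuousLinearMap.adjoint T
      map_add' := fun S T => map_add _ S T
      map_smul' := fun c T => by simp } 1 fun T => by simp

variable {E F}

theorem adjointL_apply (T : E →L[ℝ] F) : adjointL E F T = ContinuousLinearMap.adjoint T := rfl

end Adjoint

/-- `diagOp` as a continuous linear map. -/
def diagOpL (k : ℕ) : (Fin k → ℝ) →L[ℝ] (Vec k →L[ℝ] Vec k) :=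
  LinearMap.toContinuousLinearMap
    { toFun := fun v => diagOp v
      map_add' := fun v w => by
        rw [diagOp, diagOp, diagOp, ← map_add, Matrix.diagonal_add]; rfl
      map_smul' := fun c v => by
        rw [diagOp, diagOp, Matrix.diagonal_smul, map_smul]; rfl }

theorem diagOp_apply {k : ℕ} (v : Fin k → ℝ) (d : Vec k) (m : Fin k) :
    diagOp v d m = v m * d m := by
  simp [diagOp, Matrix.ofLp_toEuclideanCLM, Matrix.mulVec_diagonal]

/-- The bilinear map `(T, v) ↦ (d ↦ (T d)ᵀ v)`: the second derivative `T` of a vector-valued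
function, contracted with the multiplier `v`. -/
def contract (E F : Type*) [NormedAddCommGroup E] [InnerProductSpace ℝ E] [CompleteSpace E]
    [NormedAddCommGroup F] [InnerProductSpace ℝ F] [CompleteSpace F] :
    (E →L[ℝ] E →L[ℝ] F) →L[ℝ] F →L[ℝ] E →L[ℝ] E :=
  (ContinuousLinearMap.flipₗᵢ ℝ E F E).toContinuousLinearEquiv.toContinuousLinearMap ∘L
    ContinuousLinearMap.compL ℝ E (E →L[ℝ] F) (F →L[ℝ] E) (adjointL E F)

theorem contract_apply {E F : Type*} [NormedAddCommGroup E] [InnerProductSpace ℝ E]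
    [CompleteSpace E] [NormedAddCommGroup F] [InnerProductSpace ℝ F] [CompleteSpace F]
    (T : E →L[ℝ] E →L[ℝ] F) (v : F) : contract E F T v = ((adjointL E F).comp T).flip v := rfl

section Gradient

variable {E F G : Type*} [NormedAddCommGroup E] [InnerProductSpace ℝ E] [CompleteSpace E]
  [NormedAddCommGroup F] [InnerProductSpace ℝ F] [CompleteSpace F]
  [NormedAddCommGroup G] [InnerProductSpace ℝ G] [CompleteSpace G]
  {a : E → E →L[ℝ] ℝ} {b : E → E →L[ℝ] F} {c : E → E →L[ℝ] G} {x : E}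

theorem contDiffAt_adjoint_gradient (ha : ContDiffAt ℝ 1 a x) (hb : ContDiffAt ℝ 1 b x)
    (hc : ContDiffAt ℝ 1 c x) (u : F) (v : G) :
    ContDiffAt ℝ 1 (fun q : E × F × G =>
      adjointL E ℝ (a q.1) 1 + adjointL E F (b q.1) q.2.1 + adjointL E G (c q.1) q.2.2)
      (x, u, v) := by
  have h1 : ContDiffAt ℝ 1 (fun q : E × F × G => a q.1) (x, u, v) :=
    ha.comp (x, u, v) contDiffAt_fst
  have h2 : ContDiffAt ℝ 1 (fun q : E × F × G => b q.1) (x, u, v) :=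
    hb.comp (x, u, v) contDiffAt_fst
  have h3 : ContDiffAt ℝ 1 (fun q : E × F × G => c q.1) (x, u, v) :=
    hc.comp (x, u, v) contDiffAt_fst
  fun_prop

theorem hasFDerivAt_adjoint_gradient {a' : E →L[ℝ] E →L[ℝ] ℝ} {b' : E →L[ℝ] E →L[ℝ] F}
    {c' : E →L[ℝ] E →L[ℝ] G} (ha : HasFDerivAt a a' x) (hb : HasFDerivAt b b' x)
    (hc : HasFDerivAt c c' x) (u : F) (v : G) :
    HasFDerivAt (fun q : E × F × G =>
      adjointL E ℝ (a q.1) 1 + adjointL E F (b q.1) q.2.1 + adjointL E G (c q.1) q.2.2)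
      ((contract E ℝ a' 1 + contract E F b' u + contract E G c' v) ∘L
          ContinuousLinearMap.fst ℝ _ _ +
        adjointL E F (b x) ∘L ContinuousLinearMap.fst ℝ _ _ ∘L ContinuousLinearMap.snd ℝ _ _ +
        adjointL E G (c x) ∘L ContinuousLinearMap.snd ℝ _ _ ∘L ContinuousLinearMap.snd ℝ _ _)
      (x, u, v) := by
  have hfst : HasFDerivAt (fun q : E × F × G => q.1) (ContinuousLinearMap.fst ℝ _ _) (x, u, v) :=
    hasFDerivAt_fst
  have hu : HasFDerivAt (fun q : E × F × G => q.2.1)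
    (ContinuousLinearMap.fst ℝ _ _ ∘L ContinuousLinearMap.snd ℝ _ _) (x, u, v) :=
    HasFDerivAt.comp (x, u, v) hasFDerivAt_fst hasFDerivAt_snd
  have hv : HasFDerivAt (fun q : E × F × G => q.2.2)
    (ContinuousLinearMap.snd ℝ _ _ ∘L ContinuousLinearMap.snd ℝ _ _) (x, u, v) :=
    HasFDerivAt.comp (x, u, v) hasFDerivAt_snd hasFDerivAt_snd
  have h1 : HasFDerivAt (fun q : E × F × G => adjointL E ℝ (a q.1))
      (adjointL E ℝ ∘L a' ∘L ContinuousLinearMap.fst ℝ _ _) (x, u, v) :=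
    (adjointL E ℝ).hasFDerivAt.comp (x, u, v) (HasFDerivAt.comp (x, u, v) ha hfst)
  have h2 : HasFDerivAt (fun q : E × F × G => adjointL E F (b q.1))
      (adjointL E F ∘L b' ∘L ContinuousLinearMap.fst ℝ _ _) (x, u, v) :=
    (adjointL E F).hasFDerivAt.comp (x, u, v) (HasFDerivAt.comp (x, u, v) hb hfst)
  have h3 : HasFDerivAt (fun q : E × F × G => adjointL E G (c q.1))
      (adjointL E G ∘L c' ∘L ContinuousLinearMap.fst ℝ _ _) (x, u, v) :=
    (adjointL E G).hasFDerivAt.comp (x, u, v) (HasFDerivAt.comp (x, u, v) hc hfst)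
  refine (((h1.clm_apply (hasFDerivAt_const (1 : ℝ) (x, u, v))).add (h2.clm_apply hu)).add
    (h3.clm_apply hv)).congr_fderiv (ContinuousLinearMap.ext fun d => ?_)
  simp [contract_apply]
  abel

theorem continuousAt_contract {a : E → E →L[ℝ] E →L[ℝ] ℝ} {b : E → E →L[ℝ] E →L[ℝ] F}
    {c : E → E →L[ℝ] E →L[ℝ] G} (ha : ContinuousAt a x) (hb : ContinuousAt b x)
    (hc : ContinuousAt c x) (u : F) (v : G) :
    ContinuousAt (fun q : E × F × G =>
      contract E ℝ (a q.1) 1 + contract E F (b q.1) q.2.1 + contract E G (c q.1) q.2.2)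
      (x, u, v) := by
  have h1 : ContinuousAt (fun q : E × F × G => contract E ℝ (a q.1)) (x, u, v) :=
    (contract E ℝ).continuous.continuousAt.comp (ha.comp_of_eq continuousAt_fst rfl)
  have h2 : ContinuousAt (fun q : E × F × G => contract E F (b q.1)) (x, u, v) :=
    (contract E F).continuous.continuousAt.comp (hb.comp_of_eq continuousAt_fst rfl)
  have h3 : ContinuousAt (fun q : E × F × G => contract E G (c q.1)) (x, u, v) :=
    (contract E G).continuous.continuousAt.comp (hc.comp_of_eq continuousAt_fst rfl)
  have hu : ContinuousAt (fun q : E × F × G => q.2.1) (x, u, v) := by fun_prop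
  have hv : ContinuousAt (fun q : E × F × G => q.2.2) (x, u, v) := by fun_prop
  exact ((h1.clm_apply continuousAt_const).add (h2.clm_apply hu)).add (h3.clm_apply hv)

end Gradient

namespace DistNLP

variable {R : Type*} {n mE mI : R → ℕ} {p : ℕ} (P : DistNLP R n mE mI p)

/-- The data of region `l` are twice continuously differentiable at `x`. -/
structure SmoothAt (l : R) (x : Vec (n l)) : Prop where
  f : ContDiffAt ℝ 2 (P.f l) x
  cE : ContDiffAt ℝ 2 (P.cE l) x
  cI : ContDiffAt ℝ 2 (P.cI l) x

variable {P} {l : R} {x : Vec (n l)}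

theorem Smooth.smoothAt (h : P.Smooth) (hx : x ∈ P.localFeasible l) : P.SmoothAt l x := by
  obtain ⟨⟨U, hU, hSU, hf, -⟩, ⟨V, hV, hSV, hE, -⟩, ⟨W, hW, hSW, hI, -⟩⟩ := h l
  exact ⟨hf.contDiffAt (hU.mem_nhds (hSU hx)), hE.contDiffAt (hV.mem_nhds (hSV hx)),
    hI.contDiffAt (hW.mem_nhds (hSW hx))⟩

theorem SmoothAt.eventually (h : P.SmoothAt l x) : ∀ᶠ y in 𝓝 x, P.SmoothAt l y := by
  filter_upwards [h.f.eventually (by simp), h.cE.eventually (by simp), h.cI.eventually (by simp)]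
    with y h1 h2 h3 using ⟨h1, h2, h3⟩

theorem SmoothAt.hasFDerivAt_f (h : P.SmoothAt l x) :
    HasFDerivAt (P.f l) (fderiv ℝ (P.f l) x) x :=
  (h.f.differentiableAt (by simp)).hasFDerivAt

theorem SmoothAt.hasFDerivAt_cE (h : P.SmoothAt l x) : HasFDerivAt (P.cE l) (P.J l x) x :=
  (h.cE.differentiableAt (by simp)).hasFDerivAt

theorem SmoothAt.hasFDerivAt_cI (h : P.SmoothAt l x) : HasFDerivAt (P.cI l) (P.Rjac l x) x :=
  (h.cI.differentiableAt (by simp)).hasFDerivAt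

theorem SmoothAt.contDiffAt_fderiv_f (h : P.SmoothAt l x) :
    ContDiffAt ℝ 1 (fderiv ℝ (P.f l)) x := h.f.fderiv_right (by norm_num)

theorem SmoothAt.contDiffAt_J (h : P.SmoothAt l x) : ContDiffAt ℝ 1 (P.J l) x :=
  h.cE.fderiv_right (by norm_num)

theorem SmoothAt.contDiffAt_Rjac (h : P.SmoothAt l x) : ContDiffAt ℝ 1 (P.Rjac l) x :=
  h.cI.fderiv_right (by norm_num)

theorem SmoothAt.continuousAt_cI (h : P.SmoothAt l x) : ContinuousAt (P.cI l) x :=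
  h.cI.continuousAt

theorem SmoothAt.continuousAt_cI_apply (h : P.SmoothAt l x) (m : Fin (mI l)) :
    ContinuousAt (fun y => P.cI l y m) x :=
  (EuclideanSpace.proj (𝕜 := ℝ) m).continuous.continuousAt.comp h.continuousAt_cI

theorem SmoothAt.continuousAt_J (h : P.SmoothAt l x) : ContinuousAt (P.J l) x :=
  h.contDiffAt_J.continuousAt

theorem SmoothAt.continuousAt_Rjac (h : P.SmoothAt l x) : ContinuousAt (P.Rjac l) x :=
  h.contDiffAt_Rjac.continuousAt

theorem SmoothAt.gradLag_eq (h : P.SmoothAt l x) (kap : Vec (mI l)) (gam : Vec (mE l)) :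
    P.gradLag l kap gam x = ContinuousLinearMap.adjoint (fderiv ℝ (P.f l) x) 1 +
      ContinuousLinearMap.adjoint (P.Rjac l x) kap +
      ContinuousLinearMap.adjoint (P.J l x) gam := by
  refine HasGradientAt.gradient (hasGradientAt_iff_hasFDerivAt.2 ?_)
  have h1 := (h.hasFDerivAt_f.add ((innerSL ℝ kap).hasFDerivAt.comp x h.hasFDerivAt_cI)).add
    ((innerSL ℝ gam).hasFDerivAt.comp x h.hasFDerivAt_cE)
  convert! h1 using 1
  ext d
  simp [ContinuousLinearMap.adjoint_inner_left]

/-- The derivative of `(x, κ, γ) ↦ ∇ₓL(x, κ, γ)` before identifying its `x`-part with the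
Hessian. -/
theorem SmoothAt.hasFDerivAt_gradLag_aux (h : P.SmoothAt l x) (kap : Vec (mI l))
    (gam : Vec (mE l)) :
    HasFDerivAt (fun q : Vec (n l) × Vec (mI l) × Vec (mE l) => P.gradLag l q.2.1 q.2.2 q.1)
      ((contract _ _ (fderiv ℝ (fderiv ℝ (P.f l)) x) 1 + contract _ _ (fderiv ℝ (P.Rjac l) x) kap
          + contract _ _ (fderiv ℝ (P.J l) x) gam) ∘L ContinuousLinearMap.fst ℝ _ _ +
        (ContinuousLinearMap.adjoint (P.Rjac l x)) ∘L ContinuousLinearMap.fst ℝ _ _ ∘L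
          ContinuousLinearMap.snd ℝ _ _ +
        (ContinuousLinearMap.adjoint (P.J l x)) ∘L ContinuousLinearMap.snd ℝ _ _ ∘L
          ContinuousLinearMap.snd ℝ _ _) (x, kap, gam) := by
  have hev : ∀ᶠ q : Vec (n l) × Vec (mI l) × Vec (mE l) in 𝓝 (x, kap, gam), P.SmoothAt l q.1 :=
    continuousAt_fst.eventually h.eventually
  exact (hasFDerivAt_adjoint_gradient
    (h.contDiffAt_fderiv_f.differentiableAt one_ne_zero).hasFDerivAt
    (h.contDiffAt_Rjac.differentiableAt one_ne_zero).hasFDerivAt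
    (h.contDiffAt_J.differentiableAt one_ne_zero).hasFDerivAt
    kap gam).congr_of_eventuallyEq (hev.mono fun q hq => hq.gradLag_eq _ _)

theorem SmoothAt.hessLag_eq (h : P.SmoothAt l x) (kap : Vec (mI l)) (gam : Vec (mE l)) :
    P.hessLag l kap gam x = contract _ _ (fderiv ℝ (fderiv ℝ (P.f l)) x) 1 +
      contract _ _ (fderiv ℝ (P.Rjac l) x) kap + contract _ _ (fderiv ℝ (P.J l) x) gam := by
  have h1 : HasFDerivAt (fun y : Vec (n l) => (y, kap, gam))
      (ContinuousLinearMap.inl ℝ (Vec (n l)) (Vec (mI l) × Vec (mE l))) x :=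
    hasFDerivAt_prodMk_left x (kap, gam)
  refine ((h.hasFDerivAt_gradLag_aux kap gam).comp x h1).fderiv.trans ?_
  ext1 d
  simp

theorem SmoothAt.hasFDerivAt_gradLag (h : P.SmoothAt l x) (kap : Vec (mI l))
    (gam : Vec (mE l)) :
    HasFDerivAt (fun q : Vec (n l) × Vec (mI l) × Vec (mE l) => P.gradLag l q.2.1 q.2.2 q.1)
      (P.hessLag l kap gam x ∘L ContinuousLinearMap.fst ℝ _ _ +
        (ContinuousLinearMap.adjoint (P.Rjac l x)) ∘L ContinuousLinearMap.fst ℝ _ _ ∘L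
          ContinuousLinearMap.snd ℝ _ _ +
        (ContinuousLinearMap.adjoint (P.J l x)) ∘L ContinuousLinearMap.snd ℝ _ _ ∘L
          ContinuousLinearMap.snd ℝ _ _) (x, kap, gam) := by
  rw [h.hessLag_eq]
  exact h.hasFDerivAt_gradLag_aux kap gam

theorem SmoothAt.contDiffAt_gradLag (h : P.SmoothAt l x) (kap : Vec (mI l)) (gam : Vec (mE l)) :
    ContDiffAt ℝ 1 (fun q : Vec (n l) × Vec (mI l) × Vec (mE l) => P.gradLag l q.2.1 q.2.2 q.1)
      (x, kap, gam) := by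
  have hev : ∀ᶠ q : Vec (n l) × Vec (mI l) × Vec (mE l) in 𝓝 (x, kap, gam), P.SmoothAt l q.1 :=
    continuousAt_fst.eventually h.eventually
  exact (contDiffAt_adjoint_gradient h.contDiffAt_fderiv_f h.contDiffAt_Rjac h.contDiffAt_J kap
    gam).congr_of_eventuallyEq (hev.mono fun q hq => hq.gradLag_eq _ _)

theorem SmoothAt.continuousAt_hessLag (h : P.SmoothAt l x) (kap : Vec (mI l))
    (gam : Vec (mE l)) :
    ContinuousAt (fun q : Vec (n l) × Vec (mI l) × Vec (mE l) => P.hessLag l q.2.1 q.2.2 q.1)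
      (x, kap, gam) := by
  have hev : ∀ᶠ q : Vec (n l) × Vec (mI l) × Vec (mE l) in 𝓝 (x, kap, gam), P.SmoothAt l q.1 :=
    continuousAt_fst.eventually h.eventually
  exact (continuousAt_contract (h.contDiffAt_fderiv_f.fderiv_right (m := 0) le_rfl).continuousAt
    (h.contDiffAt_Rjac.fderiv_right (m := 0) le_rfl).continuousAt
    (h.contDiffAt_J.fderiv_right (m := 0) le_rfl).continuousAt kap gam).congr
    (hev.mono fun q hq => (hq.hessLag_eq _ _).symm)

end DistNLP

/-! ### Elimination of slacks and inequality multipliers -/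

/-- A bilinear expression in two quantities that are `O(e)`-close to their limits is `O(e)`-close
to its own limit. -/
theorem isBigO_clm_apply_sub {X Y Z V W : Type*} [NormedAddCommGroup X] [NormedSpace ℝ X]
    [NormedAddCommGroup Y] [NormedSpace ℝ Y] [NormedAddCommGroup Z] [NormedSpace ℝ Z]
    [NormedAddCommGroup V] {fl : Filter W} {e : W → V} (he : Tendsto e fl (𝓝 0))
    (L : X →L[ℝ] Y →L[ℝ] Z) {a : W → X} {u : W → Y} {a₀ : X} {u₀ : Y}
    (ha : (fun w => a w - a₀) =O[fl] e) (hu : (fun w => u w - u₀) =O[fl] e) :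
    (fun w => L (a w) (u w) - L a₀ u₀) =O[fl] e := by
  have hd : DifferentiableAt ℝ (fun z : X × Y => L z.1 z.2) (a₀, u₀) := by fun_prop
  have hz : (fun w => (a w, u w) - (a₀, u₀)) =O[fl] e := ha.prod_left hu
  have ht : Tendsto (fun w => (a w, u w)) fl (𝓝 (a₀, u₀)) :=
    tendsto_sub_nhds_zero_iff.1 (hz.trans_tendsto he)
  exact (hd.isBigO_sub.comp_tendsto ht).trans hz

namespace DistNLP

variable {R : Type*} {n mE mI : R → ℕ} {p : ℕ} (P : DistNLP R n mE mI p)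

/-- The inequality multipliers `κ = μ S⁻¹ 𝟙` of the barrier problems, with the slack
`s = -cI_ℓ(x)` eliminated. -/
def kapOf (μ : ℝ) (l : R) (x : Vec (n l)) : Vec (mI l) :=
  WithLp.toLp 2 fun m => -μ / P.cI l x m

/-- The barrier Hessian as a function of `x` and `γ` only: slacks and inequality multipliers
are eliminated through `s = -cI_ℓ(x)` and `κ = μ S⁻¹ 𝟙`. -/
def condHess (μ : ℝ) (l : R) (x : Vec (n l)) (gam : Vec (mE l)) : Vec (n l) →L[ℝ] Vec (n l) :=
  P.hessLag l (P.kapOf μ l x) gam x +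
    (ContinuousLinearMap.adjoint (P.Rjac l x)) ∘L
      (diagOp fun m => P.kapOf μ l x m / (-P.cI l x m)) ∘L (P.Rjac l x)

@[simp] theorem kapOf_apply (μ : ℝ) (l : R) (x : Vec (n l)) (m : Fin (mI l)) :
    P.kapOf μ l x m = -μ / P.cI l x m := rfl

variable {P} {l : R} {x : Vec (n l)}

theorem barrierHess_eq_condHess {μ : ℝ} {y : LocalVars R n mE mI}
    (hs : P.cI l (y.x l) + y.s l = 0) (hk : y.kap l = P.kapOf μ l (y.x l)) :
    P.barrierHess l y = P.condHess μ l (y.x l) (y.gam l) := by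
  have hs' : y.s l = -P.cI l (y.x l) := (neg_eq_of_add_eq_zero_right hs).symm
  rw [barrierHess, condHess, hk, hs']
  rfl

theorem eq_kapOf {μ : ℝ} {s kap : Vec (mI l)} (hs : P.cI l x + s = 0)
    (hpos : ∀ m, 0 < s m) (hk : ∀ m, s m * kap m = μ) : kap = P.kapOf μ l x := by
  ext m
  have h1 : P.cI l x m + s m = 0 := by
    rw [← PiLp.add_apply, hs]; rfl
  have h2 : P.cI l x m = -s m := by linarith
  rw [kapOf_apply, h2, ← hk m, neg_div_neg_eq, mul_comm, mul_div_assoc, div_self (hpos m).ne',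
    mul_one]

theorem SmoothAt.hasFDerivAt_cI_apply (h : P.SmoothAt l x) (m : Fin (mI l)) :
    HasFDerivAt (fun y => P.cI l y m) (EuclideanSpace.proj (𝕜 := ℝ) m ∘L P.Rjac l x) x :=
  (EuclideanSpace.proj (𝕜 := ℝ) m).hasFDerivAt.comp x h.hasFDerivAt_cI

theorem SmoothAt.contDiffAt_kapOf (h : P.SmoothAt l x) (hI : ∀ m, P.cI l x m < 0) (μ : ℝ) :
    ContDiffAt ℝ 1 (P.kapOf μ l) x := by
  refine contDiffAt_euclidean.2 fun m => ?_
  have h1 : ContDiffAt ℝ 1 (fun y => P.cI l y m) x :=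
    contDiffAt_euclidean.1 (h.cI.of_le (by norm_num)) m
  exact contDiffAt_const.div h1 (hI m).ne

theorem SmoothAt.hasFDerivAt_kapOf (h : P.SmoothAt l x) (hI : ∀ m, P.cI l x m < 0) (μ : ℝ) :
    HasFDerivAt (P.kapOf μ l)
      ((diagOp fun m => P.kapOf μ l x m / (-P.cI l x m)) ∘L P.Rjac l x) x := by
  rw [← hasFDerivWithinAt_univ]
  refine hasFDerivWithinAt_euclidean.2 fun m => ?_
  rw [hasFDerivWithinAt_univ]
  have h1 : HasDerivAt (fun t : ℝ => -μ / t) (μ / P.cI l x m ^ 2) (P.cI l x m) := by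
    simpa using (hasDerivAt_const (P.cI l x m) (-μ)).fun_div (hasDerivAt_id' _) (hI m).ne
  refine (h1.comp_hasFDerivAt x (h.hasFDerivAt_cI_apply m)).congr_fderiv
    (ContinuousLinearMap.ext fun d => ?_)
  have h2 := (hI m).ne
  change μ / P.cI l x m ^ 2 * P.Rjac l x d m = diagOp _ (P.Rjac l x d) m
  rw [diagOp_apply, kapOf_apply]
  field_simp

theorem SmoothAt.hasStrictFDerivAt_gradLag (h : P.SmoothAt l x) (kap : Vec (mI l))
    (gam : Vec (mE l)) :
    HasStrictFDerivAt (fun q : Vec (n l) × Vec (mI l) × Vec (mE l) => P.gradLag l q.2.1 q.2.2 q.1)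
      (P.hessLag l kap gam x ∘L ContinuousLinearMap.fst ℝ _ _ +
        (ContinuousLinearMap.adjoint (P.Rjac l x)) ∘L ContinuousLinearMap.fst ℝ _ _ ∘L
          ContinuousLinearMap.snd ℝ _ _ +
        (ContinuousLinearMap.adjoint (P.J l x)) ∘L ContinuousLinearMap.snd ℝ _ _ ∘L
          ContinuousLinearMap.snd ℝ _ _) (x, kap, gam) :=
  (h.contDiffAt_gradLag kap gam).hasStrictFDerivAt' (h.hasFDerivAt_gradLag kap gam) one_ne_zero

/-- The derivative of the condensed gradient `(x, γ) ↦ ∇ₓL(x, κ(x), γ)`. -/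
theorem SmoothAt.hasStrictFDerivAt_condGrad (h : P.SmoothAt l x) (hI : ∀ m, P.cI l x m < 0)
    (μ : ℝ) (gam : Vec (mE l)) :
    HasStrictFDerivAt (fun q : Vec (n l) × Vec (mE l) => P.gradLag l (P.kapOf μ l q.1) q.2 q.1)
      (P.condHess μ l x gam ∘L ContinuousLinearMap.fst ℝ _ _ +
        ContinuousLinearMap.adjoint (P.J l x) ∘L ContinuousLinearMap.snd ℝ _ _) (x, gam) := by
  have h1 : HasStrictFDerivAt (fun q : Vec (n l) × Vec (mE l) => q.1)
    (ContinuousLinearMap.fst ℝ _ _) (x, gam) := hasStrictFDerivAt_fst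
  have h2 : HasStrictFDerivAt (fun q : Vec (n l) × Vec (mE l) => q.2)
    (ContinuousLinearMap.snd ℝ _ _) (x, gam) := hasStrictFDerivAt_snd
  have h3 : HasStrictFDerivAt (fun q : Vec (n l) × Vec (mE l) => P.kapOf μ l q.1) _ (x, gam) :=
    HasStrictFDerivAt.comp (g := P.kapOf μ l) (x, gam)
      ((h.contDiffAt_kapOf hI μ).hasStrictFDerivAt' (h.hasFDerivAt_kapOf hI μ) one_ne_zero) h1
  refine (HasStrictFDerivAt.comp
    (g := fun q : Vec (n l) × Vec (mI l) × Vec (mE l) => P.gradLag l q.2.1 q.2.2 q.1)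
    (x, gam) (h.hasStrictFDerivAt_gradLag (P.kapOf μ l x) gam)
    (h1.prodMk (h3.prodMk h2))).congr_fderiv (ContinuousLinearMap.ext fun d => ?_)
  simp [condHess]

theorem SmoothAt.hasFDerivAt_condGrad_left (h : P.SmoothAt l x) (hI : ∀ m, P.cI l x m < 0)
    (μ : ℝ) (gam : Vec (mE l)) :
    HasFDerivAt (fun y : Vec (n l) => P.gradLag l (P.kapOf μ l y) gam y)
      (P.condHess μ l x gam) x := by
  have h1 : HasFDerivAt (fun y : Vec (n l) => (y, gam)) (ContinuousLinearMap.inl ℝ _ _) x :=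
    hasFDerivAt_prodMk_left x gam
  refine (HasFDerivAt.comp x (h.hasStrictFDerivAt_condGrad hI μ gam).hasFDerivAt h1).congr_fderiv
    (ContinuousLinearMap.ext fun d => ?_)
  simp

theorem SmoothAt.differentiableAt_barrierTerm (h : P.SmoothAt l x) (hI : ∀ m, P.cI l x m < 0)
    (μ : ℝ) :
    DifferentiableAt ℝ (fun y => (ContinuousLinearMap.adjoint (P.Rjac l y)) ∘L
      (diagOp fun m => P.kapOf μ l y m / (-P.cI l y m)) ∘L (P.Rjac l y)) x := by
  have hR : DifferentiableAt ℝ (fun y => P.Rjac l y) x :=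
    h.contDiffAt_Rjac.differentiableAt one_ne_zero
  have hadj : DifferentiableAt ℝ (fun y => adjointL _ _ (P.Rjac l y)) x := by
    fun_prop
  have hdiag : DifferentiableAt ℝ
      (fun y => diagOpL (mI l) fun m => P.kapOf μ l y m / (-P.cI l y m)) x := by
    have hv : DifferentiableAt ℝ (fun y m => P.kapOf μ l y m / (-P.cI l y m)) x := by
      refine differentiableAt_pi.2 fun m => ?_
      have h1 := (h.hasFDerivAt_cI_apply m).differentiableAt
      have h2 := (hI m).ne
      simp only [kapOf_apply]
      simp only [div_eq_mul_inv]
      exact ((h1.fun_inv h2).const_mul (-μ)).mul (h1.fun_neg.fun_inv (neg_ne_zero.2 h2))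
    exact DifferentiableAt.comp (g := fun v => diagOpL (mI l) v) x (diagOpL _).differentiableAt hv
  exact hadj.clm_comp (hdiag.clm_comp hR)

theorem SmoothAt.eventually_cI_neg (h : P.SmoothAt l x) (hI : ∀ m, P.cI l x m < 0) :
    ∀ᶠ y in 𝓝 x, ∀ m, P.cI l y m < 0 :=
  eventually_all.2 fun m => (h.continuousAt_cI_apply m).eventually (gt_mem_nhds (hI m))

theorem SmoothAt.continuousAt_condHess (h : P.SmoothAt l x) (hI : ∀ m, P.cI l x m < 0) (μ : ℝ)
    (gam : Vec (mE l)) :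
    ContinuousAt (fun q : Vec (n l) × Vec (mE l) => P.condHess μ l q.1 q.2) (x, gam) := by
  have h1 : ContinuousAt (fun q : Vec (n l) × Vec (mE l) => (q.1, P.kapOf μ l q.1, q.2))
      (x, gam) :=
    continuousAt_fst.prodMk
      (((h.contDiffAt_kapOf hI μ).continuousAt.comp_of_eq continuousAt_fst rfl).prodMk
        continuousAt_snd)
  have h2 := (h.continuousAt_hessLag (P.kapOf μ l x) gam).comp_of_eq h1 rfl
  have h3 := (h.differentiableAt_barrierTerm hI μ).continuousAt.comp_of_eq
    (f := fun q : Vec (n l) × Vec (mE l) => q.1) (x := (x, gam)) continuousAt_fst rfl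
  exact h2.add h3

theorem isBigO_of_locallyLipschitzOn {E F : Type*} [NormedAddCommGroup E] [NormedAddCommGroup F]
    {g : E → F} {S : Set E} {a : E} (hg : LocallyLipschitzOn S g) (ha : a ∈ S) :
    (fun y => g y - g a) =O[𝓝[S] a] fun y => y - a := by
  obtain ⟨K, t, ht, hK⟩ := hg ha
  refine Asymptotics.IsBigO.of_bound K ?_
  filter_upwards [ht] with y hy
  simpa [dist_eq_norm] using hK.dist_le_mul y hy a (mem_of_mem_nhdsWithin ha ht)

/-- Along the local feasible set the condensed Hessian is Lipschitz at a point. -/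
theorem Smooth.isBigO_condHess (hP : P.Smooth) (hx : x ∈ P.localFeasible l)
    (hI : ∀ m, P.cI l x m < 0) (μ : ℝ) (gam : Vec (mE l)) :
    (fun q : Vec (n l) × Vec (mE l) => P.condHess μ l q.1 q.2 - P.condHess μ l x gam)
      =O[𝓝[{q | q.1 ∈ P.localFeasible l}] (x, gam)] fun q => q - (x, gam) := by
  have h := hP.smoothAt hx
  set fl := 𝓝[{q : Vec (n l) × Vec (mE l) | q.1 ∈ P.localFeasible l}] (x, gam) with hfl
  have hle : fl ≤ 𝓝 (x, gam) := nhdsWithin_le_nhds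
  have hfst : Tendsto (fun q : Vec (n l) × Vec (mE l) => q.1) fl (𝓝 x) :=
    continuousAt_fst.tendsto.mono_left hle
  have hfst' : Tendsto (fun q : Vec (n l) × Vec (mE l) => q.1) fl (𝓝[P.localFeasible l] x) :=
    tendsto_nhdsWithin_iff.2 ⟨hfst, eventually_mem_nhdsWithin⟩
  have he : Tendsto (fun q : Vec (n l) × Vec (mE l) => q - (x, gam)) fl (𝓝 0) :=
    tendsto_sub_nhds_zero_iff.2 hle
  have h1 : (fun q : Vec (n l) × Vec (mE l) => q.1 - x) =O[fl] fun q => q - (x, gam) :=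
    Asymptotics.IsBigO.of_bound 1 (.of_forall fun q => by
      simpa using norm_fst_le (q - (x, gam)))
  have h2 : (fun q : Vec (n l) × Vec (mE l) => q.2 - gam) =O[fl] fun q => q - (x, gam) :=
    Asymptotics.IsBigO.of_bound 1 (.of_forall fun q => by
      simpa using norm_snd_le (q - (x, gam)))
  obtain ⟨⟨-, -, -, -, hf⟩, ⟨-, -, -, -, hE⟩, ⟨-, -, -, -, hIl⟩⟩ := hP l
  have hk : (fun q : Vec (n l) × Vec (mE l) => P.kapOf μ l q.1 - P.kapOf μ l x)
      =O[fl] fun q => q - (x, gam) :=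
    ((h.hasFDerivAt_kapOf hI μ).isBigO_sub.comp_tendsto hfst).trans h1
  have hB1 := isBigO_clm_apply_sub he (contract (Vec (n l)) ℝ)
    (((isBigO_of_locallyLipschitzOn hf hx).comp_tendsto hfst').trans h1)
    (u := fun _ => (1 : ℝ)) (u₀ := 1) (by simpa using Asymptotics.isBigO_zero _ _)
  have hB2 := isBigO_clm_apply_sub he (contract (Vec (n l)) (Vec (mI l)))
    (((isBigO_of_locallyLipschitzOn hIl hx).comp_tendsto hfst').trans h1) hk
  have hB3 := isBigO_clm_apply_sub he (contract (Vec (n l)) (Vec (mE l)))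
    (((isBigO_of_locallyLipschitzOn hE hx).comp_tendsto hfst').trans h1) h2
  have hT := ((h.differentiableAt_barrierTerm hI μ).isBigO_sub.comp_tendsto hfst).trans h1
  refine (((hB1.add hB2).add hB3).add hT).congr' ?_ EventuallyEq.rfl
  filter_upwards [hfst.eventually h.eventually] with q hq
  rw [condHess, condHess, hq.hessLag_eq, h.hessLag_eq, add_sub_add_comm, add_sub_add_comm,
    add_sub_add_comm]
  rfl

end DistNLP

/-! ### Second-order sufficient conditions for the barrier problems -/

/-- The real inner product as a continuous bilinear map. -/
def innerL (E : Type*) [NormedAddCommGroup E] [InnerProductSpace ℝ E] : E →L[ℝ] E →L[ℝ] ℝ :=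
  LinearMap.mkContinuous₂ (innerₗ E) 1 fun x y => by
    simpa using abs_real_inner_le_norm x y

theorem innerL_apply {E : Type*} [NormedAddCommGroup E] [InnerProductSpace ℝ E] (x y : E) :
    innerL E x y = ⟪x, y⟫ := rfl

/-- A local minimizer of the reduced problem, in which the second component (the slack) is
eliminated, is a local minimizer of the full problem. -/
theorem IsLocalMinOn.of_reduced {X Y : Type*} [TopologicalSpace X] [TopologicalSpace Y]
    {S : Set X} {g : X → ℝ} {T : Set (X × Y)} {h : X × Y → ℝ} {z : X × Y}
    (hg : IsLocalMinOn g S z.1) (hz : z ∈ T) (hT : ∀ w ∈ T, w.1 ∈ S)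
    (hgh : ∀ w ∈ T, h w = g w.1) : IsLocalMinOn h T z := by
  have ht : Tendsto (fun w : X × Y => w.1) (𝓝[T] z) (𝓝[S] z.1) :=
    tendsto_nhdsWithin_iff.2 ⟨continuousAt_fst.tendsto.mono_left nhdsWithin_le_nhds,
      eventually_mem_nhdsWithin.mono hT⟩
  filter_upwards [ht.eventually hg, eventually_mem_nhdsWithin] with w hw hwT
  rw [hgh w hwT, hgh z hz]
  exact hw

namespace DistNLP

variable {R : Type*} {n mE mI : R → ℕ} {p : ℕ} {P : DistNLP R n mE mI p}

section Region

variable {l : R} {x : Vec (n l)}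

theorem SmoothAt.inner_gradLag (h : P.SmoothAt l x) (kap : Vec (mI l)) (gam : Vec (mE l))
    (d : Vec (n l)) :
    ⟪P.gradLag l kap gam x, d⟫ =
      fderiv ℝ (P.f l) x d + ⟪kap, P.Rjac l x d⟫ + ⟪gam, P.J l x d⟫ := by
  rw [h.gradLag_eq]
  simp [inner_add_left, ContinuousLinearMap.adjoint_inner_left]

theorem neg_cI_pos_of_mem {y : Vec (n l) × Vec (mI l)} (hy : y ∈ P.barrierLocalFeasible l) :
    y.2 = -P.cI l y.1 ∧ ∀ m, P.cI l y.1 m < 0 := by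
  obtain ⟨-, h2, h3⟩ := hy
  have h4 : y.2 = -P.cI l y.1 := (neg_eq_of_add_eq_zero_right h2).symm
  refine ⟨h4, fun m => ?_⟩
  have h5 := h3 m
  rw [h4] at h5
  simpa using h5

theorem mem_barrierLocalFeasible (hE : P.cE l x = 0) (hI : ∀ m, P.cI l x m < 0) :
    (x, -P.cI l x) ∈ P.barrierLocalFeasible l :=
  ⟨hE, add_neg_cancel _, fun m => by simpa using hI m⟩

/-- The gradient of the barrier objective with eliminated slack is `∇f + Rᵀ κ(x)`. -/
theorem SmoothAt.hasFDerivAt_barrierObj (h : P.SmoothAt l x) (hI : ∀ m, P.cI l x m < 0) (μ : ℝ) :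
    HasFDerivAt (fun y => P.barrierObj μ l (y, -P.cI l y))
      (innerL _ (P.gradLag l (P.kapOf μ l x) 0 x)) x := by
  have hlog : ∀ m, HasFDerivAt (fun y => Real.log ((-P.cI l y) m))
      ((-P.cI l x m)⁻¹ • (-(EuclideanSpace.proj (𝕜 := ℝ) m ∘L P.Rjac l x))) x := by
    intro m
    have h1 := (h.hasFDerivAt_cI_apply m).fun_neg
    exact h1.log (neg_ne_zero.2 (hI m).ne)
  have h2 := h.hasFDerivAt_f.sub ((HasFDerivAt.fun_sum (u := Finset.univ)
    fun m _ => hlog m).const_mul μ)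
  refine (h2 : HasFDerivAt (fun y => P.barrierObj μ l (y, -P.cI l y)) _ x).congr_fderiv
    (ContinuousLinearMap.ext fun d => ?_)
  rw [innerL_apply, h.inner_gradLag, inner_zero_left, add_zero, PiLp.inner_apply, sub_apply,
    sub_eq_add_neg]
  congr 1
  rw [smul_apply, sum_apply, smul_eq_mul, Finset.mul_sum, ← Finset.sum_neg_distrib]
  refine Finset.sum_congr rfl fun m _ => ?_
  have h3 := (hI m).ne
  change -(μ * ((-P.cI l x m)⁻¹ * -(P.Rjac l x d m))) = P.Rjac l x d m * (-μ / P.cI l x m)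
  field_simp

/-- The equality constraints enter the gradient of the barrier Lagrangian through `Jᵀ γ`. -/
theorem SmoothAt.hasFDerivAt_barrierLag (h : P.SmoothAt l x) (hI : ∀ m, P.cI l x m < 0) (μ : ℝ)
    (gam : Vec (mE l)) :
    HasFDerivAt (fun y => P.barrierObj μ l (y, -P.cI l y) + ⟪gam, P.cE l y⟫)
      (innerL _ (P.gradLag l (P.kapOf μ l x) gam x)) x := by
  refine ((h.hasFDerivAt_barrierObj hI μ).add
    ((innerL _ gam).hasFDerivAt.comp x h.hasFDerivAt_cE)).congr_fderiv
    (ContinuousLinearMap.ext fun d => ?_)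
  rw [add_apply, ContinuousLinearMap.comp_apply]
  simp only [innerL_apply]
  rw [h.inner_gradLag, h.inner_gradLag, inner_zero_left, add_zero]

/-- Second-order sufficiency for the decoupled problem of one region. -/
theorem SmoothAt.isLocalMinOn_decoupledObj (h : P.SmoothAt l x) (hE : P.cE l x = 0)
    (hI : ∀ m, P.cI l x m < 0) {μ ρ : ℝ} {Sg : ∀ l, Vec (n l) →L[ℝ] Vec (n l)}
    (hSg : IsSelfAdjoint (Sg l)) {z : ∀ l, Vec (n l)} {lam : Vec p} {gam : Vec (mE l)}
    (hstat : P.gradLag l (P.kapOf μ l x) gam x + ContinuousLinearMap.adjoint (P.A l) lam +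
      ρ • Sg l (x - z l) = 0)
    (hpos : ∀ d, d ≠ 0 → P.J l x d = 0 → 0 < ⟪d, (P.condHess μ l x gam + ρ • Sg l) d⟫) :
    IsLocalMinOn (P.decoupledObj μ ρ Sg z lam l) (P.barrierLocalFeasible l)
      (x, -P.cI l x) := by
  have hmin : IsLocalMinOn (fun y => P.barrierObj μ l (y, -P.cI l y) + ⟪gam, P.cE l y⟫ +
      ⟪lam, P.A l y⟫ + ρ / 2 * ⟪y - z l, Sg l (y - z l)⟫)
      {y | P.cE l y = 0} x := by
    refine isLocalMinOn_of_pos_on_ker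
      (G := fun y => innerL _ (P.gradLag l (P.kapOf μ l y) gam y +
        ContinuousLinearMap.adjoint (P.A l) lam + ρ • Sg l (y - z l)))
      (Q := innerL _ ∘L (P.condHess μ l x gam + ρ • Sg l)) (c := P.cE l) (L := P.J l x)
      ?_ ?_ ?_ h.hasFDerivAt_cE (fun y hy => hy.trans hE.symm) ?_
    · filter_upwards [h.eventually, h.eventually_cI_neg hI] with y hy hyI
      have h1 := (hy.hasFDerivAt_barrierLag hyI μ gam).add
        ((innerL _ lam).hasFDerivAt.comp y (P.A l).hasFDerivAt)
      have h2 : HasFDerivAt (fun y => y - z l) (ContinuousLinearMap.id ℝ _) y :=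
        (hasFDerivAt_id y).sub_const _
      have h3 : HasFDerivAt (fun y => Sg l (y - z l)) (Sg l ∘L ContinuousLinearMap.id ℝ _) y :=
        (Sg l).hasFDerivAt.comp y h2
      refine (h1.add ((h2.inner ℝ h3).const_mul (ρ / 2))).congr_fderiv
        (ContinuousLinearMap.ext fun d => ?_)
      have h4 : ⟪y - z l, Sg l d⟫ = ⟪Sg l (y - z l), d⟫ := by
        rw [← ContinuousLinearMap.adjoint_inner_left, hSg.adjoint_eq]
      simp only [add_apply, smul_apply, ContinuousLinearMap.comp_apply,
        ContinuousLinearMap.prod_apply, fderivInnerCLM_apply, ContinuousLinearMap.id_apply,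
        innerL_apply, inner_add_left, real_inner_smul_left,
        ContinuousLinearMap.adjoint_inner_left, smul_eq_mul]
      rw [h4, real_inner_comm (Sg l (y - z l)) d]
      ring
    · rw [hstat, map_zero]
    · have h1 := ((h.hasFDerivAt_condGrad_left hI μ gam).add_const
        (ContinuousLinearMap.adjoint (P.A l) lam)).add
        (((Sg l).hasFDerivAt.comp x ((hasFDerivAt_id x).sub_const (z l))).const_smul ρ)
      refine ((innerL (Vec (n l))).hasFDerivAt.comp x h1).congr_fderiv
        (ContinuousLinearMap.ext fun d => ?_)
      simp
    · intro d hd hJ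
      have := hpos d hd hJ
      rwa [real_inner_comm] at this
  refine IsLocalMinOn.of_reduced (z := (x, -P.cI l x))
    hmin (mem_barrierLocalFeasible hE hI) (fun w hw => hw.1) fun w hw => ?_
  have hE' : P.cE l w.1 = 0 := hw.1
  simp only [decoupledObj, hE', inner_zero_right, add_zero, ← (neg_cI_pos_of_mem hw).1]

end Region

section Coupled

variable [Fintype R]

/-- The equality constraints `(∑ A_ℓ x_ℓ, (cE_ℓ(x_ℓ))_ℓ)` of the coupled problem. -/
def constr (P : DistNLP R n mE mI p) (x : ∀ l, Vec (n l)) : Vec p × (∀ l, Vec (mE l)) :=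
  (∑ l, P.A l (x l), fun l => P.cE l (x l))

/-- The Jacobian of the equality constraints of the coupled problem. -/
def constrJac (P : DistNLP R n mE mI p) (x : ∀ l, Vec (n l)) :
    (∀ l, Vec (n l)) →L[ℝ] Vec p × (∀ l, Vec (mE l)) :=
  (∑ l, P.A l ∘L ContinuousLinearMap.proj l).prod
    (ContinuousLinearMap.pi fun l => P.J l (x l) ∘L ContinuousLinearMap.proj l)

theorem constrJac_apply (x d : ∀ l, Vec (n l)) :
    P.constrJac x d = (∑ l, P.A l (d l), fun l => P.J l (x l) (d l)) := by
  simp [constrJac, ContinuousLinearMap.pi]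
  rfl

/-- The block-diagonal bilinear form `(d, d') ↦ ∑ ⟨B_ℓ d_ℓ, d'_ℓ⟩`. -/
def blockForm (B : ∀ l, Vec (n l) →L[ℝ] Vec (n l)) :
    (∀ l, Vec (n l)) →L[ℝ] (∀ l, Vec (n l)) →L[ℝ] ℝ :=
  ∑ l, (ContinuousLinearMap.compL ℝ (∀ l, Vec (n l)) (Vec (n l)) ℝ).flip
    (ContinuousLinearMap.proj l) ∘L innerL (Vec (n l)) ∘L B l ∘L ContinuousLinearMap.proj l

theorem blockForm_apply (B : ∀ l, Vec (n l) →L[ℝ] Vec (n l)) (d d' : ∀ l, Vec (n l)) :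
    blockForm B d d' = ∑ l, ⟪B l (d l), d' l⟫ := by
  simp [blockForm, innerL_apply]

theorem hasStrictFDerivAt_constr {x : ∀ l, Vec (n l)} (h : ∀ l, P.SmoothAt l (x l)) :
    HasStrictFDerivAt P.constr (P.constrJac x) x := by
  refine HasStrictFDerivAt.prodMk ?_ (hasStrictFDerivAt_pi.2 fun l => ?_)
  · have h1 := (∑ l, P.A l ∘L ContinuousLinearMap.proj (R := ℝ) (φ := fun l => Vec (n l))
      l).hasStrictFDerivAt (x := x)
    refine h1.congr_of_eventuallyEq (.of_forall fun y => ?_)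
    simp
  · have h1 : HasStrictFDerivAt (P.cE l) (P.J l (x l)) (x l) :=
      (h l).cE.hasStrictFDerivAt (by simp)
    exact HasStrictFDerivAt.comp x h1
      (ContinuousLinearMap.proj (R := ℝ) (φ := fun l => Vec (n l)) l).hasStrictFDerivAt

/-- Second-order sufficiency for the coupled barrier problem. -/
theorem isBarrierSolution_of_pos {x : ∀ l, Vec (n l)} (h : ∀ l, P.SmoothAt l (x l))
    (hE : ∀ l, P.cE l (x l) = 0) (hI : ∀ l m, P.cI l (x l) m < 0)
    (hA : ∑ l, P.A l (x l) = P.b) {μ : ℝ} {lam : Vec p} {gam : ∀ l, Vec (mE l)}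
    (hstat : ∀ l, P.gradLag l (P.kapOf μ l (x l)) (gam l) (x l) +
      ContinuousLinearMap.adjoint (P.A l) lam = 0)
    (hpos : ∀ d : ∀ l, Vec (n l), d ≠ 0 → ∑ l, P.A l (d l) = 0 →
      (∀ l, P.J l (x l) (d l) = 0) → 0 < ∑ l, ⟪d l, P.condHess μ l (x l) (gam l) (d l)⟫) :
    P.IsBarrierSolution μ x fun l => -P.cI l (x l) := by
  have hfeas : (x, fun l => -P.cI l (x l)) ∈ P.barrierFeasible :=
    ⟨hA, fun l => mem_barrierLocalFeasible (hE l) (hI l)⟩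
  refine ⟨hfeas, ?_⟩
  have hmin : IsLocalMinOn (fun y : ∀ l, Vec (n l) =>
      ∑ l, (P.barrierObj μ l (y l, -P.cI l (y l)) + ⟪gam l, P.cE l (y l)⟫ +
        ⟪lam, P.A l (y l)⟫)) {y | P.constr y = P.constr x} x := by
    have hproj : ∀ (l : R) (y : ∀ l, Vec (n l)), HasFDerivAt (fun y : ∀ l, Vec (n l) => y l)
        (ContinuousLinearMap.proj (R := ℝ) (φ := fun l => Vec (n l)) l) y :=
      fun l y => (ContinuousLinearMap.proj (R := ℝ) (φ := fun l => Vec (n l)) l).hasFDerivAt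
    have hlin : ∀ l, HasFDerivAt
        (fun y : Vec (n l) => P.gradLag l (P.kapOf μ l y) (gam l) y +
          ContinuousLinearMap.adjoint (P.A l) lam) (P.condHess μ l (x l) (gam l)) (x l) :=
      fun l => ((h l).hasFDerivAt_condGrad_left (hI l) μ (gam l)).add_const _
    refine isLocalMinOn_of_pos_on_ker
      (G := fun y => ∑ l, (innerL _ (P.gradLag l (P.kapOf μ l (y l)) (gam l) (y l) +
        ContinuousLinearMap.adjoint (P.A l) lam)) ∘L ContinuousLinearMap.proj l)
      (Q := blockForm fun l => P.condHess μ l (x l) (gam l)) (c := P.constr)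
      (L := P.constrJac x) ?_ ?_ ?_ (hasStrictFDerivAt_constr h).hasFDerivAt
      (fun y hy => hy) ?_
    · have hev : ∀ᶠ y in 𝓝 x, ∀ l, P.SmoothAt l (y l) ∧ ∀ m, P.cI l (y l) m < 0 :=
        eventually_all.2 fun l => (continuous_apply l).continuousAt.eventually
          ((h l).eventually.and ((h l).eventually_cI_neg (hI l)))
      filter_upwards [hev] with y hy
      refine HasFDerivAt.fun_sum fun l _ => ?_
      have h1 : HasFDerivAt (fun y => P.barrierObj μ l (y, -P.cI l y) + ⟪gam l, P.cE l y⟫ +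
          ⟪lam, P.A l y⟫) (innerL _ (P.gradLag l (P.kapOf μ l (y l)) (gam l) (y l) +
        ContinuousLinearMap.adjoint (P.A l) lam)) (y l) := by
        refine (((hy l).1.hasFDerivAt_barrierLag (hy l).2 μ (gam l)).add
          ((innerL _ lam).hasFDerivAt.comp (y l) (P.A l).hasFDerivAt)).congr_fderiv
          (ContinuousLinearMap.ext fun d => ?_)
        simp [innerL_apply, ContinuousLinearMap.adjoint_inner_left]
      exact HasFDerivAt.comp y h1 (hproj l y)
    · simp only [hstat, map_zero, ContinuousLinearMap.zero_comp, Finset.sum_const_zero]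
    · refine HasFDerivAt.fun_sum fun l _ => ?_
      exact ((ContinuousLinearMap.compL ℝ (∀ l, Vec (n l)) (Vec (n l)) ℝ).flip
        (ContinuousLinearMap.proj l)).hasFDerivAt.comp x
        ((innerL (Vec (n l))).hasFDerivAt.comp x (HasFDerivAt.comp (g := fun y : Vec (n l) =>
          P.gradLag l (P.kapOf μ l y) (gam l) y + ContinuousLinearMap.adjoint (P.A l) lam)
          x (hlin l) (hproj l x)))
    · intro d hd hL
      rw [constrJac_apply, Prod.mk_eq_zero] at hL
      rw [blockForm_apply]
      simp only [real_inner_comm]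
      exact hpos d hd hL.1 fun l => congrFun hL.2 l
  -- on the feasible set the Lagrangian exceeds the objective by the constant `⟪lam, b⟫`
  refine IsLocalMinOn.of_reduced (z := (x, fun l => -P.cI l (x l)))
    (hmin.add (isMinFilter_const (b := -⟪lam, P.b⟫))) hfeas (fun w hw => ?_) fun w hw => ?_
  · have h1 : ∀ l, P.cE l (w.1 l) = 0 := fun l => (hw.2 l).1
    simp only [Set.mem_ofPred_eq, constr, hE, h1, hA, hw.1]
  · have h1 : ∀ l, P.cE l (w.1 l) = 0 := fun l => (hw.2 l).1
    have h2 : ∀ l, w.2 l = -P.cI l (w.1 l) := fun l => (neg_cI_pos_of_mem (hw.2 l)).1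
    simp only [h1, inner_zero_right, add_zero, ← h2, Finset.sum_add_distrib, ← inner_sum, hw.1]
    ring

end Coupled

end DistNLP

/-! ### The perturbed KKT system near a regular solution -/

theorem sq_norm_le_sum_sq_norm {ι : Type*} [Fintype ι] {E : ι → Type*}
    [∀ i, NormedAddCommGroup (E i)] (f : ∀ i, E i) : ‖f‖ ^ 2 ≤ ∑ i, ‖f i‖ ^ 2 := by
  have h0 : 0 ≤ ∑ i, ‖f i‖ ^ 2 := Finset.sum_nonneg fun i _ => sq_nonneg _
  have h : ‖f‖ ≤ √(∑ i, ‖f i‖ ^ 2) :=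
    (pi_norm_le_iff_of_nonneg (Real.sqrt_nonneg _)).2 fun i => by
      refine Real.le_sqrt_of_sq_le ?_
      exact Finset.single_le_sum (f := fun i => ‖f i‖ ^ 2) (fun i _ => sq_nonneg _)
        (Finset.mem_univ i)
  calc ‖f‖ ^ 2 ≤ √(∑ i, ‖f i‖ ^ 2) ^ 2 := by gcongr
    _ = _ := Real.sq_sqrt h0

theorem diagOp_comm {k : ℕ} (v w : Vec k) : diagOp (fun m => v m) w = diagOp (fun m => w m) v := by
  ext m
  rw [diagOp_apply, diagOp_apply, mul_comm]

namespace DistNLP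

variable {R : Type*} {n mE mI : R → ℕ} {p : ℕ} (P : DistNLP R n mE mI p)

/-- The local part `(∇ₓL_ℓ, K_ℓ cI_ℓ(x), cE_ℓ(x))` of the KKT residual at `(x, κ, γ)`; the slacks
are eliminated. -/
def kktLoc (l : R) (q : Vec (n l) × Vec (mI l) × Vec (mE l)) :
    Vec (n l) × Vec (mI l) × Vec (mE l) :=
  (P.gradLag l q.2.1 q.2.2 q.1, diagOp (fun m => q.2.1 m) (P.cI l q.1), P.cE l q.1)

/-- The derivative of `kktLoc`. -/
def kktLocDeriv (l : R) (q : Vec (n l) × Vec (mI l) × Vec (mE l)) :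
    Vec (n l) × Vec (mI l) × Vec (mE l) →L[ℝ] Vec (n l) × Vec (mI l) × Vec (mE l) :=
  (P.hessLag l q.2.1 q.2.2 q.1 ∘L ContinuousLinearMap.fst ℝ _ _ +
    (ContinuousLinearMap.adjoint (P.Rjac l q.1)) ∘L ContinuousLinearMap.fst ℝ _ _ ∘L
      ContinuousLinearMap.snd ℝ _ _ +
    (ContinuousLinearMap.adjoint (P.J l q.1)) ∘L ContinuousLinearMap.snd ℝ _ _ ∘L
      ContinuousLinearMap.snd ℝ _ _).prod
  ((diagOp (fun m => q.2.1 m) ∘L P.Rjac l q.1 ∘L ContinuousLinearMap.fst ℝ _ _ +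
    diagOp (fun m => P.cI l q.1 m) ∘L ContinuousLinearMap.fst ℝ _ _ ∘L
      ContinuousLinearMap.snd ℝ _ _).prod
  (P.J l q.1 ∘L ContinuousLinearMap.fst ℝ _ _))

variable {P} {l : R}

theorem SmoothAt.hasStrictFDerivAt_kktLoc {q : Vec (n l) × Vec (mI l) × Vec (mE l)}
    (h : P.SmoothAt l q.1) : HasStrictFDerivAt (P.kktLoc l) (P.kktLocDeriv l q) q := by
  have hfst : HasStrictFDerivAt (fun q : Vec (n l) × Vec (mI l) × Vec (mE l) => q.1)
    (ContinuousLinearMap.fst ℝ _ _) q := hasStrictFDerivAt_fst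
  have hE : HasStrictFDerivAt (P.cE l) (P.J l q.1) q.1 := h.cE.hasStrictFDerivAt (by simp)
  have hI : HasStrictFDerivAt (P.cI l) (P.Rjac l q.1) q.1 := h.cI.hasStrictFDerivAt (by simp)
  have hI' : HasStrictFDerivAt
      (fun q : Vec (n l) × Vec (mI l) × Vec (mE l) => P.cI l q.1)
      (P.Rjac l q.1 ∘L ContinuousLinearMap.fst ℝ _ _) q := HasStrictFDerivAt.comp q hI hfst
  set D : Vec (n l) × Vec (mI l) × Vec (mE l) →L[ℝ] (Vec (mI l) →L[ℝ] Vec (mI l)) :=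
    diagOpL (mI l) ∘L (PiLp.continuousLinearEquiv 2 ℝ fun _ => ℝ).toContinuousLinearMap ∘L
      ContinuousLinearMap.fst ℝ _ _ ∘L ContinuousLinearMap.snd ℝ _ _ with hD
  have hDq : ∀ q, D q = diagOp (fun m => q.2.1 m) := fun q => rfl
  refine (h.hasStrictFDerivAt_gradLag q.2.1 q.2.2).prodMk (HasStrictFDerivAt.prodMk ?_
    (HasStrictFDerivAt.comp q hE hfst))
  refine (D.hasStrictFDerivAt.clm_apply hI').congr_fderiv (ContinuousLinearMap.ext fun d => ?_)
  simp only [add_apply, ContinuousLinearMap.comp_apply, ContinuousLinearMap.flip_apply, hDq]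
  rw [diagOp_comm d.2.1 (P.cI l q.1)]
  rfl

variable [Fintype R]

/-- The KKT residual of the coupled problem at `((x_ℓ, κ_ℓ, γ_ℓ)_ℓ, λ)`. -/
def kktMap (P : DistNLP R n mE mI p) (w : (∀ l, Vec (n l) × Vec (mI l) × Vec (mE l)) × Vec p) :
    (∀ l, Vec (n l) × Vec (mI l) × Vec (mE l)) × Vec p :=
  (fun l => P.kktLoc l (w.1 l) + (ContinuousLinearMap.adjoint (P.A l) w.2, 0),
    ∑ l, P.A l (w.1 l).1)

/-- The derivative of `kktMap`. -/
def kktDeriv (P : DistNLP R n mE mI p) (w : (∀ l, Vec (n l) × Vec (mI l) × Vec (mE l)) × Vec p) :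
    (∀ l, Vec (n l) × Vec (mI l) × Vec (mE l)) × Vec p →L[ℝ]
      (∀ l, Vec (n l) × Vec (mI l) × Vec (mE l)) × Vec p :=
  (ContinuousLinearMap.pi fun l =>
    P.kktLocDeriv l (w.1 l) ∘L ContinuousLinearMap.proj l ∘L ContinuousLinearMap.fst ℝ _ _ +
      ((ContinuousLinearMap.adjoint (P.A l)).prod 0) ∘L ContinuousLinearMap.snd ℝ _ _).prod
  (∑ l, P.A l ∘L ContinuousLinearMap.fst ℝ _ _ ∘L ContinuousLinearMap.proj l ∘L
    ContinuousLinearMap.fst ℝ _ _)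

/-- The right-hand side of the perturbed KKT system. -/
def kktTarget (P : DistNLP R n mE mI p) (μ : ℝ) :
    (∀ l, Vec (n l) × Vec (mI l) × Vec (mE l)) × Vec p :=
  (fun _ => (0, WithLp.toLp 2 fun _ => -μ, 0), P.b)

theorem hasStrictFDerivAt_kktMap {w : (∀ l, Vec (n l) × Vec (mI l) × Vec (mE l)) × Vec p}
    (h : ∀ l, P.SmoothAt l (w.1 l).1) : HasStrictFDerivAt P.kktMap (P.kktDeriv w) w := by
  refine HasStrictFDerivAt.prodMk (hasStrictFDerivAt_pi.2 fun l => ?_) ?_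
  · have h0 : HasStrictFDerivAt
        (fun w : (∀ l, Vec (n l) × Vec (mI l) × Vec (mE l)) × Vec p => w.1 l)
        (ContinuousLinearMap.proj l ∘L ContinuousLinearMap.fst ℝ _ _) w :=
      (ContinuousLinearMap.proj (R := ℝ) (φ := fun l => Vec (n l) × Vec (mI l) × Vec (mE l)) l ∘L
        ContinuousLinearMap.fst ℝ _ (Vec p)).hasStrictFDerivAt
    have h1 : HasStrictFDerivAt
        (fun w : (∀ l, Vec (n l) × Vec (mI l) × Vec (mE l)) × Vec p => P.kktLoc l (w.1 l))
        (P.kktLocDeriv l (w.1 l) ∘L ContinuousLinearMap.proj l ∘L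
          ContinuousLinearMap.fst ℝ _ _) w :=
      HasStrictFDerivAt.comp w (h l).hasStrictFDerivAt_kktLoc h0
    have h2 : HasStrictFDerivAt
        (fun w : (∀ l, Vec (n l) × Vec (mI l) × Vec (mE l)) × Vec p =>
          (ContinuousLinearMap.adjoint (P.A l) w.2, (0 : Vec (mI l) × Vec (mE l))))
        (((ContinuousLinearMap.adjoint (P.A l)).prod 0) ∘L ContinuousLinearMap.snd ℝ _ _) w :=
      (((ContinuousLinearMap.adjoint (P.A l)).prod (0 : Vec p →L[ℝ] Vec (mI l) × Vec (mE l))) ∘L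
        ContinuousLinearMap.snd ℝ (∀ l, Vec (n l) × Vec (mI l) × Vec (mE l))
          (Vec p)).hasStrictFDerivAt
    exact h1.add h2
  · refine (∑ l, P.A l ∘L ContinuousLinearMap.fst ℝ _ _ ∘L
      ContinuousLinearMap.proj (R := ℝ) (φ := fun l => Vec (n l) × Vec (mI l) × Vec (mE l)) l ∘L
      ContinuousLinearMap.fst ℝ _ (Vec p)).hasStrictFDerivAt.congr_of_eventuallyEq
      (.of_forall fun y => ?_)
    simp

theorem kktDeriv_apply (w d : (∀ l, Vec (n l) × Vec (mI l) × Vec (mE l)) × Vec p) :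
    P.kktDeriv w d = (fun l => (P.hessLag l (w.1 l).2.1 (w.1 l).2.2 (w.1 l).1 (d.1 l).1 +
        ContinuousLinearMap.adjoint (P.Rjac l (w.1 l).1) (d.1 l).2.1 +
        ContinuousLinearMap.adjoint (P.J l (w.1 l).1) (d.1 l).2.2 +
        ContinuousLinearMap.adjoint (P.A l) d.2,
      diagOp (fun m => (w.1 l).2.1 m) (P.Rjac l (w.1 l).1 (d.1 l).1) +
        diagOp (fun m => P.cI l (w.1 l).1 m) (d.1 l).2.1,
      P.J l (w.1 l).1 (d.1 l).1), ∑ l, P.A l (d.1 l).1) := by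
  refine Prod.ext (funext fun l => ?_) ?_
  · change P.kktLocDeriv l (w.1 l) (d.1 l) + (ContinuousLinearMap.adjoint (P.A l) d.2, 0) = _
    simp [kktLocDeriv]
  · change (∑ l, P.A l ∘L ContinuousLinearMap.fst ℝ _ _ ∘L
      ContinuousLinearMap.proj (R := ℝ) (φ := fun l => Vec (n l) × Vec (mI l) × Vec (mE l)) l ∘L
      ContinuousLinearMap.fst ℝ _ (Vec p)) d = _
    simp

theorem kktMap_eq_target_iff {w : (∀ l, Vec (n l) × Vec (mI l) × Vec (mE l)) × Vec p} {μ : ℝ} :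
    P.kktMap w = P.kktTarget μ ↔
      (∀ l, P.gradLag l (w.1 l).2.1 (w.1 l).2.2 (w.1 l).1 +
        ContinuousLinearMap.adjoint (P.A l) w.2 = 0) ∧
      (∀ l m, (w.1 l).2.1 m * P.cI l (w.1 l).1 m = -μ) ∧ (∀ l, P.cE l (w.1 l).1 = 0) ∧
      ∑ l, P.A l (w.1 l).1 = P.b := by
  have h1 : ∀ l, (P.kktLoc l (w.1 l) + (ContinuousLinearMap.adjoint (P.A l) w.2, 0) =
      (0, WithLp.toLp 2 fun _ => -μ, 0)) ↔ (P.gradLag l (w.1 l).2.1 (w.1 l).2.2 (w.1 l).1 +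
        ContinuousLinearMap.adjoint (P.A l) w.2 = 0) ∧
      (∀ m, (w.1 l).2.1 m * P.cI l (w.1 l).1 m = -μ) ∧ P.cE l (w.1 l).1 = 0 := by
    intro l
    simp only [kktLoc, Prod.ext_iff, Prod.fst_add, Prod.snd_add, add_zero, PiLp.ext_iff,
      diagOp_apply]
  rw [kktMap, kktTarget, Prod.mk.injEq, funext_iff]
  simp only [h1, forall_and, and_assoc]

section Regular

variable {xs : ∀ l, Vec (n l)} {lams : Vec p} {gams : ∀ l, Vec (mE l)} {kaps : ∀ l, Vec (mI l)}

/-- At a regular KKT point (LICQ, strict complementarity, second-order sufficiency) the KKT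
matrix is nonsingular. -/
theorem kktDeriv_injective (hKKT : P.IsKKT xs lams gams kaps) (hLICQ : P.LICQ xs)
    (hSCC : P.SCC xs kaps) (hSOSC : P.SOSC xs gams kaps)
    (d : (∀ l, Vec (n l) × Vec (mI l) × Vec (mE l)) × Vec p)
    (hd : P.kktDeriv (fun l => (xs l, kaps l, gams l), lams) d = 0) : d = 0 := by
  rw [kktDeriv_apply] at hd
  obtain ⟨h1, h2⟩ := Prod.ext_iff.1 hd
  have hloc := fun l => congrFun h1 l
  simp only [Prod.fst_zero, Prod.snd_zero, Pi.zero_apply, Prod.mk_eq_zero] at hloc h2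
  have hcomp : ∀ l m, kaps l m * P.Rjac l (xs l) (d.1 l).1 m +
      P.cI l (xs l) m * (d.1 l).2.1 m = 0 := by
    intro l m
    have h3 := congrArg (fun v : Vec (mI l) => v m) (hloc l).2.1
    simpa [diagOp_apply] using h3
  have hact : ∀ l m, P.cI l (xs l) m = 0 → P.Rjac l (xs l) (d.1 l).1 m = 0 := by
    intro l m h0
    have h3 := hcomp l m
    rw [h0, zero_mul, add_zero] at h3
    exact (mul_eq_zero.1 h3).resolve_left (hSCC l m h0).ne'
  have hinact : ∀ l m, P.cI l (xs l) m ≠ 0 → (d.1 l).2.1 m = 0 := by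
    intro l m h0
    have h3 := hcomp l m
    rw [(mul_eq_zero.1 (hKKT.compl l m)).resolve_right h0, zero_mul, zero_add] at h3
    exact (mul_eq_zero.1 h3).resolve_left h0
  have hx : (fun l => (d.1 l).1) = 0 := by
    by_contra hne
    have hpos := hSOSC (fun l => (d.1 l).1) ⟨h2, fun l => (hloc l).2.2, fun l m h0 =>
      ⟨(hact l m h0).le, fun _ => hact l m h0⟩⟩ hne
    have hterm : ∀ l, ⟪(d.1 l).1, P.hessLag l (kaps l) (gams l) (xs l) (d.1 l).1⟫ =
        -⟪P.A l (d.1 l).1, d.2⟫ := by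
      intro l
      have h3 : P.hessLag l (kaps l) (gams l) (xs l) (d.1 l).1 =
          -(ContinuousLinearMap.adjoint (P.Rjac l (xs l)) (d.1 l).2.1 +
            ContinuousLinearMap.adjoint (P.J l (xs l)) (d.1 l).2.2 +
            ContinuousLinearMap.adjoint (P.A l) d.2) := by
        rw [eq_neg_iff_add_eq_zero, ← (hloc l).1]
        abel
      have h4 : ⟪P.Rjac l (xs l) (d.1 l).1, (d.1 l).2.1⟫ = 0 := by
        rw [PiLp.inner_apply]
        refine Finset.sum_eq_zero fun m _ => ?_
        by_cases h0 : P.cI l (xs l) m = 0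
        · rw [hact l m h0, inner_zero_left]
        · rw [hinact l m h0, inner_zero_right]
      rw [h3, inner_neg_right, inner_add_right, inner_add_right,
        ContinuousLinearMap.adjoint_inner_right, ContinuousLinearMap.adjoint_inner_right,
        ContinuousLinearMap.adjoint_inner_right, h4, (hloc l).2.2, inner_zero_left]
      ring
    rw [Finset.sum_congr rfl fun l _ => hterm l, Finset.sum_neg_distrib, ← sum_inner, h2,
      inner_zero_left, neg_zero] at hpos
    exact lt_irrefl _ hpos
  have hx' : ∀ l, (d.1 l).1 = 0 := fun l => congrFun hx l
  obtain ⟨hu, hv, hw⟩ := hLICQ d.2 (fun l => (d.1 l).2.2) (fun l => (d.1 l).2.1) hinact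
    (fun l => by
      rw [← (hloc l).1, hx' l, map_zero]
      abel)
  refine Prod.ext (funext fun l => Prod.ext (hx' l) (Prod.ext (congrFun hw l) (congrFun hv l))) hu

/-- Indicator of the inequality constraints that are active at `xs`. -/
def activeMask (P : DistNLP R n mE mI p) (xs : ∀ l, Vec (n l)) (l : R) (m : Fin (mI l)) : ℝ :=
  if P.cI l (xs l) m = 0 then 1 else 0

/-- Near a regular KKT point, solutions of the perturbed KKT system are strictly feasible and
satisfy the second-order condition of the barrier problem: the curvature of the barrier in the
directions of the active constraints dominates. -/
theorem eventually_perturbedKKT_regular (hP : P.Smooth) (hKKT : P.IsKKT xs lams gams kaps)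
    (hSCC : P.SCC xs kaps) (hSOSC : P.SOSC xs gams kaps) :
    ∀ᶠ w in 𝓝 ((fun l => (xs l, kaps l, gams l), lams) :
        (∀ l, Vec (n l) × Vec (mI l) × Vec (mE l)) × Vec p),
      ∀ μ > 0, P.kktMap w = P.kktTarget μ →
        (∀ l, P.SmoothAt l (w.1 l).1) ∧ (∀ l m, P.cI l (w.1 l).1 m < 0) ∧
        (∀ l, (w.1 l).2.1 = P.kapOf μ l (w.1 l).1) ∧
        ∀ d : ∀ l, Vec (n l), d ≠ 0 → ∑ l, P.A l (d l) = 0 →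
          (∀ l, P.J l (w.1 l).1 (d l) = 0) →
          0 < ∑ l, ⟪d l, P.condHess μ l (w.1 l).1 (w.1 l).2.2 (d l)⟫ := by
  have hsm : ∀ l, P.SmoothAt l (xs l) := fun l => hP.smoothAt (hKKT.feas.2 l)
  set w₀ : (∀ l, Vec (n l) × Vec (mI l) × Vec (mE l)) × Vec p :=
    (fun l => (xs l, kaps l, gams l), lams) with hw₀
  have hloc : ∀ l, ContinuousAt
      (fun w : (∀ l, Vec (n l) × Vec (mI l) × Vec (mE l)) × Vec p => w.1 l) w₀ := fun l => by
    fun_prop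
  have hlocx : ∀ l, ContinuousAt
      (fun w : (∀ l, Vec (n l) × Vec (mI l) × Vec (mE l)) × Vec p => (w.1 l).1) w₀ := fun l => by
    fun_prop
  have hlock : ∀ l m, ContinuousAt
      (fun w : (∀ l, Vec (n l) × Vec (mI l) × Vec (mE l)) × Vec p => (w.1 l).2.1 m) w₀ :=
    fun l m => by fun_prop
  have hcI : ∀ l m, ContinuousAt
      (fun w : (∀ l, Vec (n l) × Vec (mI l) × Vec (mE l)) × Vec p => P.cI l (w.1 l).1 m) w₀ :=
    fun l m => ((hsm l).continuousAt_cI_apply m).comp_of_eq (hlocx l) rfl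
  have hQ : ContinuousAt (fun w : (∀ l, Vec (n l) × Vec (mI l) × Vec (mE l)) × Vec p =>
      blockForm fun l => P.hessLag l (w.1 l).2.1 (w.1 l).2.2 (w.1 l).1) w₀ := by
    refine continuousAt_clm_apply.2 fun d => continuousAt_clm_apply.2 fun d' => ?_
    simp only [blockForm_apply]
    refine tendsto_finsetSum _ fun l _ => ?_
    have h1 := ((hsm l).continuousAt_hessLag (kaps l) (gams l)).comp_of_eq (hloc l) rfl
    exact (h1.clm_apply continuousAt_const).inner continuousAt_const
  -- linearized equality constraints together with the linearized active constraints; on the kernel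
  -- at `w₀` the second-order sufficient condition applies
  set L : ((∀ l, Vec (n l) × Vec (mI l) × Vec (mE l)) × Vec p) → (∀ l, Vec (n l)) →L[ℝ]
      (Vec p × (∀ l, Vec (mE l))) × (∀ l, Vec (mI l)) := fun w =>
    (P.constrJac fun l => (w.1 l).1).prod (ContinuousLinearMap.pi fun l =>
      diagOp (P.activeMask xs l) ∘L P.Rjac l (w.1 l).1 ∘L ContinuousLinearMap.proj l) with hLdef
  have hLapp : ∀ w d, L w d = ((∑ l, P.A l (d l), fun l => P.J l (w.1 l).1 (d l)),
      fun l => diagOp (P.activeMask xs l) (P.Rjac l (w.1 l).1 (d l))) := by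
    intro w d
    rw [← constrJac_apply (P := P) (fun l => (w.1 l).1) d]
    rfl
  have hL : ContinuousAt L w₀ := by
    refine continuousAt_clm_apply.2 fun d => ?_
    simp only [hLapp]
    refine (continuousAt_const.prodMk (continuousAt_pi.2 fun l => ?_)).prodMk
      (continuousAt_pi.2 fun l => ?_)
    · have h1 := (hsm l).continuousAt_J.comp_of_eq (hlocx l) rfl
      exact h1.clm_apply continuousAt_const
    · have h1 := (hsm l).continuousAt_Rjac.comp_of_eq (hlocx l) rfl
      exact (diagOp (P.activeMask xs l)).continuous.continuousAt.comp
        (h1.clm_apply continuousAt_const)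
  obtain ⟨c, hc, hpen⟩ := eventually_pos_add_penalty hQ hL (by
    intro d hd hLd
    rw [hLapp, Prod.mk_eq_zero, Prod.mk_eq_zero] at hLd
    rw [blockForm_apply]
    simp only [real_inner_comm]
    refine hSOSC d ⟨hLd.1.1, fun l => congrFun hLd.1.2 l, fun l m h0 => ?_⟩ hd
    have h1 := congrArg (fun v : Vec (mI l) => v m) (congrFun hLd.2 l)
    simp only [diagOp_apply, activeMask, h0, if_true, one_mul] at h1
    exact ⟨h1.le, fun _ => h1⟩)
  have hsm' : ∀ᶠ w in 𝓝 w₀, ∀ l, P.SmoothAt l (w.1 l).1 :=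
    eventually_all.2 fun l => (hlocx l).eventually (hsm l).eventually
  -- for active constraints the barrier weight `κ / s` exceeds the penalty parameter `c`
  have hsign : ∀ᶠ w in 𝓝 w₀, ∀ l m,
      (P.cI l (xs l) m = 0 → 0 < (w.1 l).2.1 m ∧ c * -P.cI l (w.1 l).1 m < (w.1 l).2.1 m) ∧
      (P.cI l (xs l) m ≠ 0 → P.cI l (w.1 l).1 m < 0) := by
    refine eventually_all.2 fun l => eventually_all.2 fun m => ?_
    by_cases h0 : P.cI l (xs l) m = 0
    · have hk : 0 < kaps l m := hSCC l m h0
      have h1 : ∀ᶠ w in 𝓝 w₀, 0 < (w.1 l).2.1 m := (hlock l m).eventually (lt_mem_nhds hk)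
      have h2 : ∀ᶠ w in 𝓝 w₀, c * -P.cI l (w.1 l).1 m < (w.1 l).2.1 m := by
        refine ContinuousAt.eventually_lt (continuousAt_const.mul (hcI l m).neg) (hlock l m) ?_
        simp only [hw₀, h0, neg_zero, mul_zero]
        exact hk
      filter_upwards [h1, h2] with w hw1 hw2
      exact ⟨fun _ => ⟨hw1, hw2⟩, fun h => absurd h0 h⟩
    · have h1 : ∀ᶠ w in 𝓝 w₀, P.cI l (w.1 l).1 m < 0 :=
        (hcI l m).eventually (gt_mem_nhds (lt_of_le_of_ne ((hKKT.feas.2 l).2 m) h0))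
      filter_upwards [h1] with w hw1
      exact ⟨fun h => absurd h h0, fun _ => hw1⟩
  filter_upwards [hpen, hsm', hsign] with w hw1 hw2 hw3 μ hμ hkkt
  obtain ⟨-, hcompl, -, -⟩ := kktMap_eq_target_iff.1 hkkt
  have hneg : ∀ l m, P.cI l (w.1 l).1 m < 0 := by
    intro l m
    by_cases h0 : P.cI l (xs l) m = 0
    · have h1 := ((hw3 l m).1 h0).1
      have h2 := hcompl l m
      by_contra! h3
      have := mul_nonneg h1.le h3
      linarith
    · exact (hw3 l m).2 h0
  have hkap : ∀ l, (w.1 l).2.1 = P.kapOf μ l (w.1 l).1 := by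
    intro l
    ext m
    rw [kapOf_apply, eq_div_iff (hneg l m).ne, hcompl l m]
  refine ⟨hw2, hneg, hkap, fun d hd hA hJ => ?_⟩
  have h1 := hw1 d hd
  have h2 : ‖L w d‖ ^ 2 ≤ ∑ l, ∑ m, P.activeMask xs l m * P.Rjac l (w.1 l).1 (d l) m ^ 2 := by
    rw [hLapp, hA]
    simp only [hJ]
    have h3 : ‖((((0 : Vec p), fun l => (0 : Vec (mE l))), fun l =>
        diagOp (P.activeMask xs l) (P.Rjac l (w.1 l).1 (d l))) :
        (Vec p × (∀ l, Vec (mE l))) × (∀ l, Vec (mI l)))‖ =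
        ‖fun l => diagOp (P.activeMask xs l) (P.Rjac l (w.1 l).1 (d l))‖ := by
      have h4 : ((0 : Vec p), fun l => (0 : Vec (mE l))) = 0 := rfl
      rw [h4, Prod.norm_mk, norm_zero, max_eq_right (norm_nonneg _)]
    rw [h3]
    refine (sq_norm_le_sum_sq_norm _).trans (Finset.sum_le_sum fun l _ => ?_)
    rw [EuclideanSpace.real_norm_sq_eq]
    refine Finset.sum_le_sum fun m _ => ?_
    rw [diagOp_apply, activeMask]
    split_ifs <;> simp
  have h3 : ∀ l, ⟪d l, P.condHess μ l (w.1 l).1 (w.1 l).2.2 (d l)⟫ =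
      ⟪P.hessLag l (w.1 l).2.1 (w.1 l).2.2 (w.1 l).1 (d l), d l⟫ +
        ∑ m, (w.1 l).2.1 m / (-P.cI l (w.1 l).1 m) * P.Rjac l (w.1 l).1 (d l) m ^ 2 := by
    intro l
    rw [condHess, ← hkap l, add_apply, inner_add_right, real_inner_comm]
    congr 1
    rw [ContinuousLinearMap.comp_apply, ContinuousLinearMap.adjoint_inner_right,
      PiLp.inner_apply]
    refine Finset.sum_congr rfl fun m _ => ?_
    rw [ContinuousLinearMap.comp_apply, diagOp_apply]
    simp only [RCLike.inner_apply, conj_trivial]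
    ring
  rw [Finset.sum_congr rfl fun l _ => h3 l, Finset.sum_add_distrib]
  rw [blockForm_apply] at h1
  have h4 : c * ∑ l, ∑ m, P.activeMask xs l m * P.Rjac l (w.1 l).1 (d l) m ^ 2 ≤
      ∑ l, ∑ m, (w.1 l).2.1 m / (-P.cI l (w.1 l).1 m) * P.Rjac l (w.1 l).1 (d l) m ^ 2 := by
    rw [Finset.mul_sum]
    refine Finset.sum_le_sum fun l _ => ?_
    rw [Finset.mul_sum]
    refine Finset.sum_le_sum fun m _ => ?_
    rw [← mul_assoc]
    refine mul_le_mul_of_nonneg_right ?_ (sq_nonneg _)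
    have hn : 0 < -P.cI l (w.1 l).1 m := neg_pos.2 (hneg l m)
    rw [le_div_iff₀ hn, activeMask]
    split_ifs with h0
    · rw [mul_one]
      exact ((hw3 l m).1 h0).2.le
    · have h5 : 0 ≤ (w.1 l).2.1 m := by
        rw [hkap l, kapOf_apply]
        exact div_nonneg_of_nonpos (by linarith) (hneg l m).le
      simpa using h5
  have h5 : c * ‖L w d‖ ^ 2 ≤
      c * ∑ l, ∑ m, P.activeMask xs l m * P.Rjac l (w.1 l).1 (d l) m ^ 2 := by gcongr
  linarith

end Regular

end DistNLP

/-! ### Lagrange multipliers of barrier solutions -/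

namespace DistNLP

variable {R : Type*} {n mE mI : R → ℕ} {p : ℕ} {P : DistNLP R n mE mI p}

theorem SmoothAt.contDiffAt_barrierObj {l : R} {x : Vec (n l)} (h : P.SmoothAt l x)
    (hI : ∀ m, P.cI l x m < 0) (μ : ℝ) :
    ContDiffAt ℝ 1 (fun y => P.barrierObj μ l (y, -P.cI l y)) x := by
  have h1 : ContDiffAt ℝ 1 (P.cI l) x := h.cI.of_le (by norm_num)
  have h2 : ∀ m, ContDiffAt ℝ 1 (fun y => Real.log ((-P.cI l y) m)) x := fun m =>
    (contDiffAt_euclidean.1 h1 m).neg.log (neg_ne_zero.2 (hI m).ne)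
  exact (h.f.of_le (by norm_num)).sub
    (contDiffAt_const.mul (ContDiffAt.sum fun m _ => h2 m))

/-- The map `(κ, γ, λ) ↦ (Rᵀ κ + Jᵀ γ + Aᵀ λ, inactive part of κ)`, with the Jacobians taken at `x`
and activity at `xs`. LICQ at `xs` says that it is injective for `x = xs`. -/
def multiplierMap (P : DistNLP R n mE mI p) (xs x : ∀ l, Vec (n l)) :
    ((∀ l, Vec (mI l) × Vec (mE l)) × Vec p) →L[ℝ] (∀ l, Vec (n l) × Vec (mI l)) :=
  ContinuousLinearMap.pi fun l =>
    (ContinuousLinearMap.adjoint (P.Rjac l (x l)) ∘L ContinuousLinearMap.fst ℝ _ _ ∘L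
        ContinuousLinearMap.proj l ∘L ContinuousLinearMap.fst ℝ _ _ +
      ContinuousLinearMap.adjoint (P.J l (x l)) ∘L ContinuousLinearMap.snd ℝ _ _ ∘L
        ContinuousLinearMap.proj l ∘L ContinuousLinearMap.fst ℝ _ _ +
      ContinuousLinearMap.adjoint (P.A l) ∘L ContinuousLinearMap.snd ℝ _ _).prod
    (diagOp (fun m => 1 - P.activeMask xs l m) ∘L ContinuousLinearMap.fst ℝ _ _ ∘L
      ContinuousLinearMap.proj l ∘L ContinuousLinearMap.fst ℝ _ _)

theorem multiplierMap_apply (xs x : ∀ l, Vec (n l))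
    (v : (∀ l, Vec (mI l) × Vec (mE l)) × Vec p) :
    P.multiplierMap xs x v = fun l => (ContinuousLinearMap.adjoint (P.Rjac l (x l)) (v.1 l).1 +
      ContinuousLinearMap.adjoint (P.J l (x l)) (v.1 l).2 +
      ContinuousLinearMap.adjoint (P.A l) v.2,
      diagOp (fun m => 1 - P.activeMask xs l m) (v.1 l).1) := by
  funext l
  simp [multiplierMap]

theorem multiplierMap_injective {xs : ∀ l, Vec (n l)} (hLICQ : P.LICQ xs)
    (v : (∀ l, Vec (mI l) × Vec (mE l)) × Vec p) (hv : P.multiplierMap xs xs v = 0) : v = 0 := by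
  rw [multiplierMap_apply] at hv
  have hloc := fun l => Prod.ext_iff.1 (congrFun hv l)
  simp only [Pi.zero_apply, Prod.fst_zero, Prod.snd_zero] at hloc
  obtain ⟨h1, h2, h3⟩ := hLICQ v.2 (fun l => (v.1 l).2) (fun l => (v.1 l).1)
    (fun l m hm => by
      have h4 := congrArg (fun q : Vec (mI l) => q m) (hloc l).2
      simpa [diagOp_apply, activeMask, hm] using h4)
    (fun l => by
      rw [← (hloc l).1]
      abel)
  exact Prod.ext (funext fun l => Prod.ext (congrFun h3 l) (congrFun h2 l)) h1

variable [Fintype R]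

/-- Riesz representation on the space of equality multipliers. -/
theorem exists_inner_representation (Λ : Module.Dual ℝ (Vec p × (∀ l, Vec (mE l)))) :
    ∃ (u : Vec p) (v : ∀ l, Vec (mE l)), ∀ a c, Λ (a, c) = ⟪u, a⟫ + ∑ l, ⟪v l, c l⟫ := by
  classical
  have hriesz : ∀ {k : ℕ} (φ : Vec k →ₗ[ℝ] ℝ), ∃ u : Vec k, ∀ a, φ a = ⟪u, a⟫ := fun φ =>
    ⟨(InnerProductSpace.toDual ℝ _).symm φ.toContinuousLinearMap, fun a => by simp⟩
  obtain ⟨u, hu⟩ := hriesz (Λ ∘ₗ LinearMap.inl ℝ _ _)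
  choose v hv using fun l => hriesz (Λ ∘ₗ LinearMap.inr ℝ _ _ ∘ₗ
    LinearMap.single ℝ (fun l => Vec (mE l)) l)
  refine ⟨u, v, fun a c => ?_⟩
  have h1 : (a, c) = LinearMap.inl ℝ (Vec p) (∀ l, Vec (mE l)) a +
      LinearMap.inr ℝ (Vec p) (∀ l, Vec (mE l)) (∑ l, Pi.single l (c l)) := by
    rw [Finset.univ_sum_single]
    simp
  rw [h1, map_add, map_sum, map_sum, ← hu]
  congr 1
  exact Finset.sum_congr rfl fun l _ => hv l (c l)

/-- A barrier solution at which the equality constraints have independent gradients admits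
multipliers. -/
theorem IsBarrierSolution.exists_multipliers {μ : ℝ} {x : ∀ l, Vec (n l)} {s : ∀ l, Vec (mI l)}
    (hsol : P.IsBarrierSolution μ x s) (h : ∀ l, P.SmoothAt l (x l))
    (hinj : ∀ (u : Vec p) (v : ∀ l, Vec (mE l)),
      (∀ l, ContinuousLinearMap.adjoint (P.A l) u +
        ContinuousLinearMap.adjoint (P.J l (x l)) (v l) = 0) → u = 0 ∧ v = 0) :
    ∃ (lam : Vec p) (gam : ∀ l, Vec (mE l)), ∀ l,
      P.gradLag l (P.kapOf μ l (x l)) (gam l) (x l) +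
        ContinuousLinearMap.adjoint (P.A l) lam = 0 := by
  classical
  obtain ⟨⟨hA, hfeas⟩, hmin⟩ := hsol
  have hE : ∀ l, P.cE l (x l) = 0 := fun l => (hfeas l).1
  have hs : ∀ l, s l = -P.cI l (x l) := fun l => (neg_cI_pos_of_mem (hfeas l)).1
  have hI : ∀ l m, P.cI l (x l) m < 0 := fun l => (neg_cI_pos_of_mem (hfeas l)).2
  have hproj : ∀ (l : R) (y : ∀ l, Vec (n l)), HasFDerivAt (fun y : ∀ l, Vec (n l) => y l)
      (ContinuousLinearMap.proj (R := ℝ) (φ := fun l => Vec (n l)) l) y :=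
    fun l y => (ContinuousLinearMap.proj (R := ℝ) (φ := fun l => Vec (n l)) l).hasFDerivAt
  -- the reduced problem, with the slacks eliminated
  set φ : (∀ l, Vec (n l)) → ℝ := fun y => ∑ l, P.barrierObj μ l (y l, -P.cI l (y l)) with hφ
  have hφmin : IsLocalMinOn φ {y | P.constr y = P.constr x} x := by
    have ht : Tendsto (fun y : ∀ l, Vec (n l) => (y, fun l => -P.cI l (y l)))
        (𝓝[{y | P.constr y = P.constr x}] x) (𝓝[P.barrierFeasible] (x, s)) := by
      refine tendsto_nhdsWithin_iff.2 ⟨?_, ?_⟩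
      · have h1 : ContinuousAt (fun y : ∀ l, Vec (n l) => (y, fun l => -P.cI l (y l))) x :=
          continuousAt_id.prodMk (continuousAt_pi.2 fun l =>
            ((h l).continuousAt_cI.comp_of_eq (continuousAt_apply l x) rfl).neg)
        have h2 : (x, s) = (x, fun l => -P.cI l (x l)) := by
          rw [show s = fun l => -P.cI l (x l) from funext hs]
        rw [h2]
        exact h1.tendsto.mono_left nhdsWithin_le_nhds
      · have h1 : ∀ᶠ y in 𝓝 x, ∀ l m, P.cI l (y l) m < 0 :=
          eventually_all.2 fun l => (continuous_apply l).continuousAt.eventually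
            ((h l).eventually_cI_neg (hI l))
        filter_upwards [eventually_mem_nhdsWithin, mem_nhdsWithin_of_mem_nhds h1] with y hy hyI
        obtain ⟨hy1, hy2⟩ := Prod.ext_iff.1 (show P.constr y = P.constr x from hy)
        refine ⟨(show ∑ l, P.A l (y l) = ∑ l, P.A l (x l) from hy1).trans hA, fun l => ?_⟩
        exact mem_barrierLocalFeasible ((congrFun hy2 l).trans (hE l)) (hyI l)
    have h3 := ht.eventually hmin
    refine h3.mono fun y hy => ?_
    simpa only [hs] using hy
  have hφd : HasStrictFDerivAt φ (∑ l, innerL _ (P.gradLag l (P.kapOf μ l (x l)) 0 (x l)) ∘L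
      ContinuousLinearMap.proj l) x := by
    have h1 : ContDiffAt ℝ 1 φ x := ContDiffAt.sum fun l _ =>
      ContDiffAt.comp (g := fun y => P.barrierObj μ l (y, -P.cI l y)) x
        ((h l).contDiffAt_barrierObj (hI l) μ)
        (ContinuousLinearMap.proj (R := ℝ) (φ := fun l => Vec (n l)) l).contDiff.contDiffAt
    refine h1.hasStrictFDerivAt' (HasFDerivAt.fun_sum fun l _ => ?_) one_ne_zero
    exact HasFDerivAt.comp x ((h l).hasFDerivAt_barrierObj (hI l) μ) (hproj l x)
  obtain ⟨Λ, Λ₀, hne, hΛ⟩ := IsLocalExtrOn.exists_linear_map_of_hasStrictFDerivAt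
    (Or.inl hφmin) (hasStrictFDerivAt_constr h) hφd
  obtain ⟨u, v, huv⟩ := exists_inner_representation Λ
  have hloc : ∀ l, ContinuousLinearMap.adjoint (P.A l) u +
      ContinuousLinearMap.adjoint (P.J l (x l)) (v l) +
        Λ₀ • P.gradLag l (P.kapOf μ l (x l)) 0 (x l) = 0 := by
    intro l
    refine ext_inner_right ℝ fun d => ?_
    have h1 := hΛ (Pi.single l d)
    rw [constrJac_apply, huv] at h1
    have h2 : ∑ l', P.A l' ((Pi.single l d : ∀ l, Vec (n l)) l') = P.A l d := by
      rw [Finset.sum_eq_single l (fun l' _ hl' => by rw [Pi.single_eq_of_ne hl', map_zero])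
        (fun h => absurd (Finset.mem_univ l) h), Pi.single_eq_same]
    have h3 : ∑ l', ⟪v l', P.J l' (x l') ((Pi.single l d : ∀ l, Vec (n l)) l')⟫ =
        ⟪v l, P.J l (x l) d⟫ := by
      rw [Finset.sum_eq_single l
        (fun l' _ hl' => by rw [Pi.single_eq_of_ne hl', map_zero, inner_zero_right])
        (fun h => absurd (Finset.mem_univ l) h), Pi.single_eq_same]
    have h4 : (∑ l', innerL _ (P.gradLag l' (P.kapOf μ l' (x l')) 0 (x l')) ∘L
        ContinuousLinearMap.proj l') (Pi.single l d : ∀ l, Vec (n l)) =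
        ⟪P.gradLag l (P.kapOf μ l (x l)) 0 (x l), d⟫ := by
      rw [sum_apply, Finset.sum_eq_single l
        (fun l' _ hl' => by
          rw [ContinuousLinearMap.comp_apply, ContinuousLinearMap.proj_apply,
            Pi.single_eq_of_ne hl', map_zero])
        (fun h => absurd (Finset.mem_univ l) h), ContinuousLinearMap.comp_apply,
        ContinuousLinearMap.proj_apply, Pi.single_eq_same, innerL_apply]
    rw [h2, h3, h4] at h1
    rw [inner_zero_left, inner_add_left, inner_add_left, real_inner_smul_left,
      ContinuousLinearMap.adjoint_inner_left, ContinuousLinearMap.adjoint_inner_left]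
    exact h1
  -- the multiplier of the objective does not vanish, by independence of the constraint gradients
  have hΛ₀ : Λ₀ ≠ 0 := by
    rintro rfl
    obtain ⟨rfl, rfl⟩ := hinj u v fun l => by simpa using hloc l
    refine hne (Prod.ext (LinearMap.ext fun q => ?_) rfl)
    have := huv q.1 q.2
    simpa using this
  refine ⟨Λ₀⁻¹ • u, Λ₀⁻¹ • v, fun l => ?_⟩
  have h1 := hloc l
  have h2 := congrArg (fun q => Λ₀⁻¹ • q) h1
  simp only [smul_add, smul_zero, smul_smul, inv_mul_cancel₀ hΛ₀, one_smul] at h2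
  rw [← h2, (h l).gradLag_eq, (h l).gradLag_eq]
  simp only [map_smul, map_zero, Pi.smul_apply]
  abel

/-! ### The central path -/

section Regular

variable {xs : ∀ l, Vec (n l)} {lams : Vec p} {gams : ∀ l, Vec (mE l)} {kaps : ∀ l, Vec (mI l)}

/-- The lower bound behind the uniqueness of multipliers, uniformly near a point where LICQ
holds. -/
theorem eventually_norm_le_multiplierMap (hsm : ∀ l, P.SmoothAt l (xs l)) (hLICQ : P.LICQ xs) :
    ∃ C > 0, ∀ᶠ x in 𝓝 xs, ∀ v, ‖v‖ ≤ C * ‖P.multiplierMap xs x v‖ := by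
  refine eventually_norm_le_mul_norm_apply (continuousAt_clm_apply.2 fun v => ?_)
    (multiplierMap_injective hLICQ)
  simp only [multiplierMap_apply]
  refine continuousAt_pi.2 fun l => ContinuousAt.prodMk ?_ continuousAt_const
  have hR : ContinuousAt (fun x : ∀ l, Vec (n l) => adjointL _ _ (P.Rjac l (x l))) xs :=
    (adjointL _ _).continuous.continuousAt.comp
      ((hsm l).continuousAt_Rjac.comp_of_eq (continuousAt_apply l xs) rfl)
  have hJ : ContinuousAt (fun x : ∀ l, Vec (n l) => adjointL _ _ (P.J l (x l))) xs :=
    (adjointL _ _).continuous.continuousAt.comp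
      ((hsm l).continuousAt_J.comp_of_eq (continuousAt_apply l xs) rfl)
  exact ((hR.clm_apply continuousAt_const).add (hJ.clm_apply continuousAt_const)).add
    continuousAt_const

/-- LICQ for the equality constraints alone persists near a point where LICQ holds. -/
theorem eventually_adjoint_injective (hsm : ∀ l, P.SmoothAt l (xs l)) (hLICQ : P.LICQ xs) :
    ∀ᶠ x in 𝓝 xs, ∀ (u : Vec p) (v : ∀ l, Vec (mE l)),
      (∀ l, ContinuousLinearMap.adjoint (P.A l) u +
        ContinuousLinearMap.adjoint (P.J l (x l)) (v l) = 0) → u = 0 ∧ v = 0 := by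
  obtain ⟨C, -, hC⟩ := eventually_norm_le_multiplierMap hsm hLICQ
  refine hC.mono fun x hx u v huv => ?_
  have h1 := hx (fun l => (0, v l), u)
  have h2 : P.multiplierMap xs x (fun l => (0, v l), u) = 0 := by
    rw [multiplierMap_apply]
    funext l
    simp [add_comm, huv l]
  rw [h2, norm_zero, mul_zero, norm_le_zero_iff, Prod.mk_eq_zero] at h1
  exact ⟨h1.2, funext fun l => (Prod.ext_iff.1 (congrFun h1.1 l)).2⟩

/-- Barrier solutions near `xs`, for small `μ`, come with multipliers near those of `xs`. -/
theorem eventually_barrierSolution_multipliers (hP : P.Smooth)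
    (hKKT : P.IsKKT xs lams gams kaps) (hLICQ : P.LICQ xs)
    {N : Set ((∀ l, Vec (n l) × Vec (mI l) × Vec (mE l)) × Vec p)}
    (hN : N ∈ 𝓝 ((fun l => (xs l, kaps l, gams l), lams) :
        (∀ l, Vec (n l) × Vec (mI l) × Vec (mE l)) × Vec p)) :
    ∀ᶠ q : (∀ l, Vec (n l)) × ℝ in 𝓝 (xs, 0), ∀ s, P.IsBarrierSolution q.2 q.1 s →
      ∃ w ∈ N, (∀ l, (w.1 l).1 = q.1 l) ∧ P.kktMap w = P.kktTarget q.2 := by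
  have hsm : ∀ l, P.SmoothAt l (xs l) := fun l => hP.smoothAt (hKKT.feas.2 l)
  obtain ⟨C, hC, hCx⟩ := eventually_norm_le_multiplierMap hsm hLICQ
  obtain ⟨ε, hε, hball⟩ := Metric.mem_nhds_iff.1 hN
  -- the value of `multiplierMap` at the difference between the multipliers of a barrier solution
  -- and those of `xs`; it vanishes in the limit since inactive constraints have `κ = O(μ)`
  set err : (∀ l, Vec (n l)) × ℝ → (∀ l, Vec (n l) × Vec (mI l)) := fun q l =>
    (-(P.gradLag l (kaps l) (gams l) (q.1 l) + ContinuousLinearMap.adjoint (P.A l) lams),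
      diagOp (fun m => 1 - P.activeMask xs l m) (P.kapOf q.2 l (q.1 l))) with herr
  have herr0 : err (xs, 0) = 0 := by
    funext l
    refine Prod.ext ?_ ?_
    · simp only [herr, hKKT.stat l, neg_zero]
      rfl
    · ext m
      simp [herr, diagOp_apply]
  have herrc : ContinuousAt err (xs, 0) := by
    refine continuousAt_pi.2 fun l => ContinuousAt.prodMk ?_ ?_
    · have h1 : ContinuousAt (fun q : (∀ l, Vec (n l)) × ℝ => (q.1 l, kaps l, gams l)) (xs, 0) := by
        fun_prop
      exact ((((hsm l).contDiffAt_gradLag (kaps l) (gams l)).continuousAt.comp_of_eq h1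
        rfl).add continuousAt_const).neg
    · have hx : ContinuousAt (fun q : (∀ l, Vec (n l)) × ℝ => q.1 l) (xs, 0) := by fun_prop
      have h1 : ContinuousAt (fun q : (∀ l, Vec (n l)) × ℝ => fun m =>
          (1 - P.activeMask xs l m) * (-q.2 / P.cI l (q.1 l) m)) (xs, 0) := by
        refine continuousAt_pi.2 fun m => ?_
        by_cases h0 : P.cI l (xs l) m = 0
        · simp only [activeMask, h0, if_true, sub_self, zero_mul]
          exact continuousAt_const
        · exact continuousAt_const.mul (continuousAt_snd.neg.div
            (((hsm l).continuousAt_cI_apply m).comp_of_eq hx rfl) h0)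
      have h2 : (fun q : (∀ l, Vec (n l)) × ℝ =>
          diagOp (fun m => 1 - P.activeMask xs l m) (P.kapOf q.2 l (q.1 l))) = fun q =>
          WithLp.toLp 2 fun m => (1 - P.activeMask xs l m) * (-q.2 / P.cI l (q.1 l) m) := by
        funext q
        ext m
        rw [diagOp_apply, kapOf_apply]
      rw [h2]
      exact (PiLp.continuous_toLp 2 _).continuousAt.comp h1
  have herrε : ∀ᶠ q in 𝓝 (xs, (0 : ℝ)), ‖err q‖ < ε / C := by
    have h1 := herrc.norm
    rw [ContinuousAt, herr0, norm_zero] at h1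
    exact h1.eventually (gt_mem_nhds (by positivity))
  have hfst : Tendsto (fun q : (∀ l, Vec (n l)) × ℝ => q.1) (𝓝 (xs, 0)) (𝓝 xs) :=
    continuousAt_fst
  have hxε : ∀ᶠ q : (∀ l, Vec (n l)) × ℝ in 𝓝 (xs, 0), dist q.1 xs < ε :=
    hfst.eventually (Metric.ball_mem_nhds xs hε)
  have hsmq : ∀ᶠ q : (∀ l, Vec (n l)) × ℝ in 𝓝 (xs, 0), ∀ l, P.SmoothAt l (q.1 l) :=
    eventually_all.2 fun l =>
      (((continuous_apply l).tendsto xs).comp hfst).eventually (hsm l).eventually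
  filter_upwards [herrε, hxε, hsmq, hfst.eventually hCx,
    hfst.eventually (eventually_adjoint_injective hsm hLICQ)] with q hq1 hq2 hq3 hq4 hq5 s hs
  obtain ⟨lam, gam, hstat⟩ := hs.exists_multipliers hq3 hq5
  have hfeas := hs.1
  have hI : ∀ l m, P.cI l (q.1 l) m < 0 := fun l => (neg_cI_pos_of_mem (hfeas.2 l)).2
  refine ⟨(fun l => (q.1 l, P.kapOf q.2 l (q.1 l), gam l), lam), hball ?_, fun l => rfl,
    kktMap_eq_target_iff.2 ⟨hstat, fun l m => ?_, fun l => (hfeas.2 l).1, hfeas.1⟩⟩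
  · have h1 := hq4 (fun l => (P.kapOf q.2 l (q.1 l) - kaps l, gam l - gams l), lam - lams)
    have h2 : P.multiplierMap xs q.1
        (fun l => (P.kapOf q.2 l (q.1 l) - kaps l, gam l - gams l), lam - lams) = err q := by
      rw [multiplierMap_apply]
      funext l
      refine Prod.ext ?_ ?_
      · have h3 := hstat l
        simp only [herr]
        rw [(hq3 l).gradLag_eq] at h3 ⊢
        simp only [map_sub]
        rw [← sub_eq_zero, ← h3]
        abel
      · ext m
        have h4 : (1 - P.activeMask xs l m) * kaps l m = 0 := by
          by_cases h0 : P.cI l (xs l) m = 0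
          · simp [activeMask, h0]
          · rw [(mul_eq_zero.1 (hKKT.compl l m)).resolve_right h0, mul_zero]
        simp only [herr, diagOp_apply, PiLp.sub_apply, mul_sub, h4, sub_zero]
    rw [h2] at h1
    have h3 : C * ‖err q‖ < ε := by
      rwa [lt_div_iff₀ hC, mul_comm] at hq1
    have h4 := h1.trans_lt h3
    rw [Prod.norm_mk, max_lt_iff] at h4
    have h5 := (pi_norm_lt_iff hε).1 h4.1
    rw [dist_pi_lt_iff hε] at hq2
    rw [Metric.mem_ball, Prod.dist_eq, max_lt_iff]
    refine ⟨(dist_pi_lt_iff hε).2 fun l => ?_, by simpa [dist_eq_norm] using h4.2⟩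
    have h6 := h5 l
    rw [Prod.norm_mk, max_lt_iff] at h6
    rw [Prod.dist_eq, Prod.dist_eq, max_lt_iff, max_lt_iff, dist_eq_norm (P.kapOf _ _ _),
      dist_eq_norm (gam l)]
    exact ⟨hq2 l, h6.1, h6.2⟩
  · rw [kapOf_apply, div_mul_cancel₀ _ (hI l m).ne]

/-- The central path: for small `μ > 0` the perturbed KKT system has a solution near the regular
KKT point, and no other one nearby. -/
theorem exists_centralPath (hP : P.Smooth) (hKKT : P.IsKKT xs lams gams kaps)
    (hLICQ : P.LICQ xs) (hSCC : P.SCC xs kaps) (hSOSC : P.SOSC xs gams kaps)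
    {N : Set ((∀ l, Vec (n l) × Vec (mI l) × Vec (mE l)) × Vec p)}
    (hN : N ∈ 𝓝 ((fun l => (xs l, kaps l, gams l), lams) :
        (∀ l, Vec (n l) × Vec (mI l) × Vec (mE l)) × Vec p)) :
    ∃ N' ⊆ N, N' ∈ 𝓝 ((fun l => (xs l, kaps l, gams l), lams) :
        (∀ l, Vec (n l) × Vec (mI l) × Vec (mE l)) × Vec p) ∧
    ∃ path : ℝ → (∀ l, Vec (n l) × Vec (mI l) × Vec (mE l)) × Vec p,
      Tendsto path (𝓝 0) (𝓝 (fun l => (xs l, kaps l, gams l), lams)) ∧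
      ∀ᶠ μ in 𝓝 (0 : ℝ), path μ ∈ N' ∧ P.kktMap (path μ) = P.kktTarget μ ∧
        ∀ w ∈ N', P.kktMap w = P.kktTarget μ → w = path μ := by
  have hsm : ∀ l, P.SmoothAt l (xs l) := fun l => hP.smoothAt (hKKT.feas.2 l)
  set w₀ : (∀ l, Vec (n l) × Vec (mI l) × Vec (mE l)) × Vec p :=
    (fun l => (xs l, kaps l, gams l), lams) with hw₀
  obtain ⟨⟨C, hC, hlip⟩, hmap⟩ := hasStrictFDerivAt_inverse (hasStrictFDerivAt_kktMap (w := w₀) hsm)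
    (kktDeriv_injective hKKT hLICQ hSCC hSOSC)
  have hF0 : P.kktMap w₀ = P.kktTarget 0 := kktMap_eq_target_iff.2
    ⟨hKKT.stat, fun l m => by rw [neg_zero]; exact hKKT.compl l m,
      fun l => (hKKT.feas.2 l).1, hKKT.feas.1⟩
  have htarget : Tendsto P.kktTarget (𝓝 0) (𝓝 (P.kktTarget 0)) := by
    have : Continuous P.kktTarget := by
      unfold kktTarget
      fun_prop
    exact this.tendsto 0
  rw [nhds_prod_eq] at hlip
  obtain ⟨t, ht, hlip⟩ := (eventually_prod_self_iff
    (r := fun w w' => ‖w - w'‖ ≤ C * ‖P.kktMap w - P.kktMap w'‖)).1 hlip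
  have hN' : N ∩ t ∈ 𝓝 w₀ := inter_mem hN ht
  have hex : ∀ᶠ μ in 𝓝 (0 : ℝ), ∃ w ∈ N ∩ t, P.kktMap w = P.kktTarget μ := by
    refine htarget.eventually (p := fun y => ∃ w ∈ N ∩ t, P.kktMap w = y) ?_
    rw [← hF0, ← hmap]
    exact image_mem_map hN'
  classical
  refine ⟨N ∩ t, Set.inter_subset_left, hN', fun μ =>
    if h : ∃ w ∈ N ∩ t, P.kktMap w = P.kktTarget μ then h.choose else w₀, ?_, ?_⟩
  · rw [tendsto_iff_norm_sub_tendsto_zero]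
    have h1 : Tendsto (fun μ => C * ‖P.kktTarget μ - P.kktTarget 0‖) (𝓝 0) (𝓝 0) := by
      have := (tendsto_iff_norm_sub_tendsto_zero.1 htarget).const_mul C
      rwa [mul_zero] at this
    refine squeeze_zero' (.of_forall fun μ => norm_nonneg _) (hex.mono fun μ hμ => ?_) h1
    rw [dif_pos hμ]
    have h2 := hlip _ hμ.choose_spec.1.2 _ (mem_of_mem_nhds ht)
    rwa [hμ.choose_spec.2, hF0] at h2
  · refine hex.mono fun μ hμ => ?_
    simp only [dif_pos hμ]
    refine ⟨hμ.choose_spec.1, hμ.choose_spec.2, fun w hw hwμ => ?_⟩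
    have h2 := hlip _ hw.2 _ hμ.choose_spec.1.2
    rw [hwμ, hμ.choose_spec.2, sub_self, norm_zero, mul_zero, norm_le_zero_iff, sub_eq_zero] at h2
    exact h2

end Regular

end DistNLP

/-! ### The decoupled problems -/

namespace DistNLP

variable {R : Type*} {n mE mI : R → ℕ} {p : ℕ} (P : DistNLP R n mE mI p)

/-- The KKT system of the decoupled problem of region `l` in the unknowns `(x, γ)`, with slack and
inequality multiplier eliminated. -/
structure IsDecoupledKKT (μ ρ : ℝ) (Sg : ∀ l, Vec (n l) →L[ℝ] Vec (n l)) (l : R)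
    (z : Vec (n l)) (lam : Vec p) (x : Vec (n l)) (gam : Vec (mE l)) : Prop where
  eqE : P.cE l x = 0
  ineq : ∀ m, P.cI l x m < 0
  stat : P.gradLag l (P.kapOf μ l x) gam x + ContinuousLinearMap.adjoint (P.A l) lam +
    ρ • Sg l (x - z) = 0

/-- The part of the decoupled KKT system that depends on `(x, γ)`; the parameters `(z, λ)` enter
the right-hand side linearly. -/
def decMap (μ ρ : ℝ) (Sg : ∀ l, Vec (n l) →L[ℝ] Vec (n l)) (l : R)
    (q : Vec (n l) × Vec (mE l)) : Vec (n l) × Vec (mE l) :=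
  (P.gradLag l (P.kapOf μ l q.1) q.2 q.1 + (ρ • Sg l) q.1, P.cE l q.1)

variable {P} {μ ρ : ℝ} {Sg : ∀ l, Vec (n l) →L[ℝ] Vec (n l)} {l : R}

theorem IsDecoupledKKT.decMap_eq {z x : Vec (n l)} {lam : Vec p} {gam : Vec (mE l)}
    (h : P.IsDecoupledKKT μ ρ Sg l z lam x gam) :
    P.decMap μ ρ Sg l (x, gam) =
      ((ρ • Sg l) z - ContinuousLinearMap.adjoint (P.A l) lam, 0) := by
  refine Prod.ext ?_ h.eqE
  have h1 := h.stat
  simp only [decMap, smul_apply]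
  rw [map_sub, smul_sub] at h1
  rw [eq_sub_iff_add_eq, ← sub_eq_zero, ← h1]
  abel

theorem isDecoupledKKT_of_decMap_eq {z x : Vec (n l)} {lam : Vec p} {gam : Vec (mE l)}
    (hI : ∀ m, P.cI l x m < 0) (h : P.decMap μ ρ Sg l (x, gam) =
      ((ρ • Sg l) z - ContinuousLinearMap.adjoint (P.A l) lam, 0)) :
    P.IsDecoupledKKT μ ρ Sg l z lam x gam := by
  obtain ⟨h1, h2⟩ := Prod.ext_iff.1 h
  refine ⟨h2, hI, ?_⟩
  simp only [decMap, smul_apply] at h1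
  rw [map_sub, smul_sub]
  rw [eq_sub_iff_add_eq, ← sub_eq_zero] at h1
  rw [← h1]
  abel

theorem IsDecoupledSolution.cI_neg {z : ∀ l, Vec (n l)} {lam : Vec p}
    {y : LocalVars R n mE mI} (h : P.IsDecoupledSolution μ ρ Sg z lam y l) :
    ∀ m, P.cI l (y.x l) m < 0 := (neg_cI_pos_of_mem h.feas).2

theorem IsDecoupledSolution.s_eq {z : ∀ l, Vec (n l)} {lam : Vec p}
    {y : LocalVars R n mE mI} (h : P.IsDecoupledSolution μ ρ Sg z lam y l) :
    y.s l = -P.cI l (y.x l) := (neg_cI_pos_of_mem h.feas).1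

theorem IsDecoupledSolution.kap_eq {z : ∀ l, Vec (n l)} {lam : Vec p}
    {y : LocalVars R n mE mI} (h : P.IsDecoupledSolution μ ρ Sg z lam y l) :
    y.kap l = P.kapOf μ l (y.x l) := eq_kapOf h.feas.2.1 h.feas.2.2 h.compl

theorem IsDecoupledSolution.isDecoupledKKT {z : ∀ l, Vec (n l)} {lam : Vec p}
    {y : LocalVars R n mE mI} (h : P.IsDecoupledSolution μ ρ Sg z lam y l) :
    P.IsDecoupledKKT μ ρ Sg l (z l) lam (y.x l) (y.gam l) := by
  refine ⟨h.feas.1, h.cI_neg, ?_⟩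
  rw [← h.kap_eq]
  exact h.stat

/-- The data of region `l` at a point where the decoupled problem is regular: a strictly feasible
point of smoothness with independent equality gradients, which solves the decoupled KKT
system for `z = x`, and at which the regularized condensed Hessian is positive definite on the
kernel of `J_ℓ`. -/
structure IsDecoupledRegular (P : DistNLP R n mE mI p) (μ ρ : ℝ)
    (Sg : ∀ l, Vec (n l) →L[ℝ] Vec (n l)) (l : R) (x : Vec (n l)) (lam : Vec p)
    (gam : Vec (mE l)) : Prop where
  smooth : P.SmoothAt l x
  kkt : P.IsDecoupledKKT μ ρ Sg l x lam x gam
  indep : ∀ v, ContinuousLinearMap.adjoint (P.J l x) v = 0 → v = 0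
  pos : ∀ d, d ≠ 0 → P.J l x d = 0 → 0 < ⟪d, (P.condHess μ l x gam + ρ • Sg l) d⟫

variable {x : Vec (n l)} {lam : Vec p} {gam : Vec (mE l)}

/-- The local form of the inverse function theorem for the decoupled KKT system. -/
theorem IsDecoupledRegular.decMap_inverse (h : P.IsDecoupledRegular μ ρ Sg l x lam gam) :
    (∃ C > 0, ∀ᶠ q : (Vec (n l) × Vec (mE l)) × Vec (n l) × Vec (mE l) in
      𝓝 ((x, gam), (x, gam)),
      ‖q.1 - q.2‖ ≤ C * ‖P.decMap μ ρ Sg l q.1 - P.decMap μ ρ Sg l q.2‖) ∧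
      map (P.decMap μ ρ Sg l) (𝓝 (x, gam)) = 𝓝 (P.decMap μ ρ Sg l (x, gam)) := by
  have hE : HasStrictFDerivAt (P.cE l) (P.J l x) x := h.smooth.cE.hasStrictFDerivAt (by simp)
  have hfst : HasStrictFDerivAt (fun q : Vec (n l) × Vec (mE l) => q.1)
    (ContinuousLinearMap.fst ℝ _ _) (x, gam) := hasStrictFDerivAt_fst
  have hlin : HasStrictFDerivAt (fun q : Vec (n l) × Vec (mE l) => (ρ • Sg l) q.1)
      ((ρ • Sg l) ∘L ContinuousLinearMap.fst ℝ _ _) (x, gam) :=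
    HasStrictFDerivAt.comp (x, gam) (ρ • Sg l).hasStrictFDerivAt hfst
  have hE' : HasStrictFDerivAt (fun q : Vec (n l) × Vec (mE l) => P.cE l q.1)
      (P.J l x ∘L ContinuousLinearMap.fst ℝ _ _) (x, gam) :=
    HasStrictFDerivAt.comp (x, gam) hE hfst
  have hstrict : HasStrictFDerivAt (P.decMap μ ρ Sg l) _ (x, gam) :=
    ((h.smooth.hasStrictFDerivAt_condGrad h.kkt.ineq μ gam).add hlin).prodMk hE'
  refine hasStrictFDerivAt_inverse hstrict fun v hv => ?_
  obtain ⟨h1, h2⟩ := Prod.ext_iff.1 hv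
  simp only [ContinuousLinearMap.prod_apply, add_apply, ContinuousLinearMap.comp_apply,
    ContinuousLinearMap.coe_fst', ContinuousLinearMap.coe_snd', Prod.fst_zero,
    Prod.snd_zero] at h1 h2
  have hv1 : v.1 = 0 := by
    by_contra hne
    have h3 := h.pos v.1 hne h2
    have h4 : (P.condHess μ l x gam + ρ • Sg l) v.1 =
        -ContinuousLinearMap.adjoint (P.J l x) v.2 := by
      rw [eq_neg_iff_add_eq_zero, ← h1, add_apply]
      abel
    rw [h4, inner_neg_right, ContinuousLinearMap.adjoint_inner_right, h2, inner_zero_left,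
      neg_zero] at h3
    exact lt_irrefl _ h3
  refine Prod.ext hv1 (h.indep _ ?_)
  rw [hv1] at h1
  simpa using h1

/-- Solutions of the decoupled KKT system with `x` near a regular point have multipliers near
those of that point. -/
theorem IsDecoupledRegular.eventually_mem (h : P.IsDecoupledRegular μ ρ Sg l x lam gam)
    {N : Set (Vec (n l) × Vec (mE l))} (hN : N ∈ 𝓝 (x, gam)) :
    ∀ᶠ q : Vec (n l) × Vec (n l) × Vec p in 𝓝 (x, x, lam), ∀ g,
      P.IsDecoupledKKT μ ρ Sg l q.2.1 q.2.2 q.1 g → (q.1, g) ∈ N := by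
  have hJ : ContinuousAt (fun y => adjointL _ _ (P.J l y)) x :=
    (adjointL _ _).continuous.continuousAt.comp h.smooth.continuousAt_J
  obtain ⟨C, hC, hCx⟩ := eventually_norm_le_mul_norm_apply hJ h.indep
  obtain ⟨ε, hε, hball⟩ := Metric.mem_nhds_iff.1 hN
  have hfst : Tendsto (fun q : Vec (n l) × Vec (n l) × Vec p => q.1) (𝓝 (x, x, lam)) (𝓝 x) :=
    continuousAt_fst
  -- the dual residual with the multiplier `gam` of the base point: it bounds `J†(g - gam)`
  set err : Vec (n l) × Vec (n l) × Vec p → Vec (n l) := fun q =>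
    P.gradLag l (P.kapOf μ l q.1) gam q.1 + ContinuousLinearMap.adjoint (P.A l) q.2.2 +
      ρ • Sg l (q.1 - q.2.1) with herr
  have herr0 : err (x, x, lam) = 0 := h.kkt.stat
  have herrc : ContinuousAt err (x, x, lam) := by
    have h1 := (h.smooth.hasFDerivAt_condGrad_left h.kkt.ineq μ gam).continuousAt.comp_of_eq
      (f := fun q : Vec (n l) × Vec (n l) × Vec p => q.1) (x := (x, x, lam)) continuousAt_fst rfl
    have h2 : ContinuousAt (fun q : Vec (n l) × Vec (n l) × Vec p =>
      ContinuousLinearMap.adjoint (P.A l) q.2.2) (x, x, lam) := by fun_prop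
    have h3 : ContinuousAt (fun q : Vec (n l) × Vec (n l) × Vec p =>
      ρ • Sg l (q.1 - q.2.1)) (x, x, lam) := by fun_prop
    exact (h1.add h2).add h3
  have herrε : ∀ᶠ q in 𝓝 (x, x, lam), ‖err q‖ < ε / C := by
    have h1 := herrc.norm
    rw [ContinuousAt, herr0, norm_zero] at h1
    exact h1.eventually (gt_mem_nhds (by positivity))
  filter_upwards [herrε, hfst.eventually hCx, hfst.eventually h.smooth.eventually,
    hfst.eventually (Metric.ball_mem_nhds x hε)] with q hq1 hq2 hq3 hq4 g hg
  refine hball ?_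
  have h1 := hq2 (g - gam)
  have h2 : adjointL _ _ (P.J l q.1) (g - gam) = -err q := by
    have h3 := hg.stat
    simp only [herr]
    rw [hq3.gradLag_eq] at h3 ⊢
    rw [adjointL_apply, map_sub, eq_neg_iff_add_eq_zero, ← h3]
    abel
  rw [h2, norm_neg] at h1
  have h3 : C * ‖err q‖ < ε := by
    rwa [lt_div_iff₀ hC, mul_comm] at hq1
  rw [Metric.mem_ball, Prod.dist_eq, max_lt_iff]
  exact ⟨hq4, by rw [dist_eq_norm]; exact h1.trans_lt h3⟩

/-- Decoupled solutions depend in a Lipschitz way on `(z, λ)`. -/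
theorem IsDecoupledRegular.eventually_norm_le (h : P.IsDecoupledRegular μ ρ Sg l x lam gam) :
    ∃ C > 0, ∀ᶠ q : Vec (n l) × Vec (n l) × Vec p in 𝓝 (x, x, lam), ∀ g,
      P.IsDecoupledKKT μ ρ Sg l q.2.1 q.2.2 q.1 g →
        ‖(q.1, g) - (x, gam)‖ ≤ C * (‖q.2.1 - x‖ + ‖q.2.2 - lam‖) := by
  obtain ⟨⟨C, hC, hlip⟩, -⟩ := h.decMap_inverse
  have hlip' : ∀ᶠ q in 𝓝 (x, gam), ‖q - (x, gam)‖ ≤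
      C * ‖P.decMap μ ρ Sg l q - P.decMap μ ρ Sg l (x, gam)‖ :=
    (Continuous.prodMk_left (x, gam)).continuousAt.eventually hlip
  set K : ℝ := ‖ρ • Sg l‖ + ‖ContinuousLinearMap.adjoint (P.A l)‖ with hK
  refine ⟨C * (K + 1), by positivity, (h.eventually_mem hlip').mono fun q hq g hg => ?_⟩
  refine (hq g hg).trans ?_
  rw [hg.decMap_eq, h.kkt.decMap_eq, mul_assoc]
  refine mul_le_mul_of_nonneg_left ?_ hC.le
  have h1 : ((ρ • Sg l) q.2.1 - ContinuousLinearMap.adjoint (P.A l) q.2.2, (0 : Vec (mE l))) -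
      ((ρ • Sg l) x - ContinuousLinearMap.adjoint (P.A l) lam, 0) =
      ((ρ • Sg l) (q.2.1 - x) - ContinuousLinearMap.adjoint (P.A l) (q.2.2 - lam), 0) := by
    rw [Prod.mk_sub_mk, sub_zero, map_sub, map_sub]
    congr 1
    abel
  rw [h1, Prod.norm_mk, norm_zero, max_eq_left (norm_nonneg _)]
  have h2 := (ρ • Sg l).le_opNorm (q.2.1 - x)
  have h3 := (ContinuousLinearMap.adjoint (P.A l)).le_opNorm (q.2.2 - lam)
  have h4 := norm_sub_le ((ρ • Sg l) (q.2.1 - x))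
    (ContinuousLinearMap.adjoint (P.A l) (q.2.2 - lam))
  have h5 : 0 ≤ ‖ρ • Sg l‖ := norm_nonneg _
  have h6 : 0 ≤ ‖ContinuousLinearMap.adjoint (P.A l)‖ := norm_nonneg _
  have h7 := norm_nonneg (q.2.1 - x)
  have h8 := norm_nonneg (q.2.2 - lam)
  nlinarith [mul_nonneg h5 h8, mul_nonneg h6 h7]

/-- The neighbourhood in which decoupled KKT points are unique does not depend on `(z, λ)`. -/
theorem IsDecoupledRegular.exists_unique_nhds (h : P.IsDecoupledRegular μ ρ Sg l x lam gam) :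
    ∃ t ∈ 𝓝 (x, gam), ∀ q ∈ t, ∀ q' ∈ t, ∀ z lam', P.IsDecoupledKKT μ ρ Sg l z lam' q.1 q.2 →
      P.IsDecoupledKKT μ ρ Sg l z lam' q'.1 q'.2 → q = q' := by
  obtain ⟨⟨C, hC, hlip⟩, -⟩ := h.decMap_inverse
  rw [nhds_prod_eq] at hlip
  obtain ⟨t, ht, hlip⟩ := (eventually_prod_self_iff (r := fun w w' => ‖w - w'‖ ≤
    C * ‖P.decMap μ ρ Sg l w - P.decMap μ ρ Sg l w'‖)).1 hlip
  refine ⟨t, ht, fun q hq q' hq' z lam' h1 h2 => ?_⟩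
  have h3 := hlip q hq q' hq'
  rwa [h1.decMap_eq, h2.decMap_eq, sub_self, norm_zero, mul_zero, norm_le_zero_iff,
    sub_eq_zero] at h3

/-- Near a regular point the decoupled problem has a local minimizer satisfying its KKT system. -/
theorem IsDecoupledRegular.eventually_exists (h : P.IsDecoupledRegular μ ρ Sg l x lam gam)
    (hSg : IsSelfAdjoint (Sg l)) {N : Set (Vec (n l) × Vec (mE l))} (hN : N ∈ 𝓝 (x, gam)) :
    ∀ᶠ q : Vec (n l) × Vec p in 𝓝 (x, lam), ∃ w ∈ N,
      P.IsDecoupledKKT μ ρ Sg l q.1 q.2 w.1 w.2 ∧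
      ∀ z : ∀ l, Vec (n l), z l = q.1 →
        IsLocalMinOn (P.decoupledObj μ ρ Sg z q.2 l) (P.barrierLocalFeasible l)
          (w.1, -P.cI l w.1) := by
  have hfst : Tendsto (fun q : Vec (n l) × Vec (mE l) => q.1) (𝓝 (x, gam)) (𝓝 x) :=
    continuousAt_fst
  have hpos : ∀ᶠ q : Vec (n l) × Vec (mE l) in 𝓝 (x, gam), ∀ d, d ≠ 0 → P.J l q.1 d = 0 →
      0 < ⟪d, (P.condHess μ l q.1 q.2 + ρ • Sg l) d⟫ := by
    have h1 : ContinuousAt (fun q : Vec (n l) × Vec (mE l) =>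
        innerL (Vec (n l)) ∘L (P.condHess μ l q.1 q.2 + ρ • Sg l)) (x, gam) :=
      continuousAt_const.clm_comp
        ((h.smooth.continuousAt_condHess h.kkt.ineq μ gam).add continuousAt_const)
    have h2 : ContinuousAt (fun q : Vec (n l) × Vec (mE l) => P.J l q.1) (x, gam) :=
      h.smooth.continuousAt_J.comp_of_eq continuousAt_fst rfl
    refine (eventually_pos_on_ker h1 h2 fun d hd hJ => ?_).mono fun q hq d hd hJ => ?_
    · rw [ContinuousLinearMap.comp_apply, innerL_apply, real_inner_comm]
      exact h.pos d hd hJ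
    · have := hq d hd hJ
      rwa [ContinuousLinearMap.comp_apply, innerL_apply, real_inner_comm] at this
  have hall : N ∩ {q | P.SmoothAt l q.1 ∧ (∀ m, P.cI l q.1 m < 0) ∧ ∀ d, d ≠ 0 →
      P.J l q.1 d = 0 → 0 < ⟪d, (P.condHess μ l q.1 q.2 + ρ • Sg l) d⟫} ∈ 𝓝 (x, gam) := by
    filter_upwards [hN, hfst.eventually h.smooth.eventually,
      hfst.eventually (h.smooth.eventually_cI_neg h.kkt.ineq), hpos] with q h1 h2 h3 h4
    exact ⟨h1, h2, h3, h4⟩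
  have hrhs : Tendsto (fun q : Vec (n l) × Vec p =>
      ((ρ • Sg l) q.1 - ContinuousLinearMap.adjoint (P.A l) q.2, (0 : Vec (mE l))))
      (𝓝 (x, lam)) (𝓝 (P.decMap μ ρ Sg l (x, gam))) := by
    rw [h.kkt.decMap_eq]
    have : Continuous (fun q : Vec (n l) × Vec p =>
      ((ρ • Sg l) q.1 - ContinuousLinearMap.adjoint (P.A l) q.2, (0 : Vec (mE l)))) := by
      fun_prop
    exact this.tendsto (x, lam)
  rw [← h.decMap_inverse.2] at hrhs
  refine (hrhs.eventually (image_mem_map hall)).mono fun q hq => ?_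
  obtain ⟨w, ⟨hwN, hw1, hw2, hw3⟩, hw⟩ := hq
  have hkkt : P.IsDecoupledKKT μ ρ Sg l q.1 q.2 w.1 w.2 := isDecoupledKKT_of_decMap_eq hw2 hw
  refine ⟨w, hwN, hkkt, fun z hz => ?_⟩
  refine hw1.isLocalMinOn_decoupledObj hkkt.eqE hw2 hSg ?_ hw3
  rw [hz]
  exact hkkt.stat

end DistNLP

/-! ### Second-order estimates along the decoupled solutions -/

namespace DistNLP

variable {R : Type*} {n mE mI : R → ℕ} {p : ℕ} {P : DistNLP R n mE mI p}
  {μ ρ : ℝ} {Sg : ∀ l, Vec (n l) →L[ℝ] Vec (n l)} {l : R}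
  {x : Vec (n l)} {lam : Vec p} {gam : Vec (mE l)}

theorem range_J_eq_top (h : ∀ v, ContinuousLinearMap.adjoint (P.J l x) v = 0 → v = 0) :
    (fderiv ℝ (P.cE l) x).range = ⊤ := by
  rw [← Submodule.orthogonal_eq_bot_iff, ContinuousLinearMap.orthogonal_range]
  exact LinearMap.ker_eq_bot'.2 h

/-- The condensed gradient is approximated to second order along the equality constraints, where
its derivative is Lipschitz. -/
theorem IsDecoupledRegular.isBigO_condGrad_sub (h : P.IsDecoupledRegular μ ρ Sg l x lam gam)
    (hP : P.Smooth) :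
    (fun y => P.gradLag l (P.kapOf μ l y) gam y - P.gradLag l (P.kapOf μ l x) gam x -
      P.condHess μ l x gam (y - x)) =O[𝓝[{y | P.cE l y = P.cE l x}] x] fun y => ‖y - x‖ ^ 2 := by
  refine isBigO_taylor_on_levelSet (h := fun y => P.gradLag l (P.kapOf μ l y) gam y)
    (h' := fun y => P.condHess μ l y gam) (h.smooth.cE.of_le (by norm_num))
    (range_J_eq_top h.indep) ?_ ?_
  · filter_upwards [h.smooth.eventually, h.smooth.eventually_cI_neg h.kkt.ineq] with y h1 h2
    exact h1.hasFDerivAt_condGrad_left h2 μ gam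
  · have hx : x ∈ P.localFeasible l := ⟨h.kkt.eqE, fun m => (h.kkt.ineq m).le⟩
    have h1 := hP.isBigO_condHess hx h.kkt.ineq μ gam
    have h2 : Tendsto (fun y : Vec (n l) => (y, gam)) (𝓝[{y | P.cE l y = P.cE l x}] x)
        (𝓝[{q : Vec (n l) × Vec (mE l) | q.1 ∈ P.localFeasible l}] (x, gam)) := by
      refine tendsto_nhdsWithin_iff.2 ⟨?_, ?_⟩
      · exact ((Continuous.prodMk_left gam).tendsto x).mono_left nhdsWithin_le_nhds
      · filter_upwards [self_mem_nhdsWithin,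
          mem_nhdsWithin_of_mem_nhds (h.smooth.eventually_cI_neg h.kkt.ineq)] with y h3 h4
        exact ⟨h3.trans h.kkt.eqE, fun m => (h4 m).le⟩
    refine (h1.comp_tendsto h2).trans (Asymptotics.isBigO_of_le _ fun y => ?_)
    simp [Prod.norm_def]

/-- Displacements along the equality constraints are tangential up to second order. -/
theorem IsDecoupledRegular.isBigO_J_apply_sub (h : P.IsDecoupledRegular μ ρ Sg l x lam gam) :
    (fun y => P.J l y (y - x)) =O[𝓝[{y | P.cE l y = P.cE l x}] x] fun y => ‖y - x‖ ^ 2 := by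
  have hJ : (fun y => P.J l y - P.J l x) =O[𝓝[{y | P.cE l y = P.cE l x}] x] fun y => y - x :=
    (h.smooth.contDiffAt_J.differentiableAt one_ne_zero).isBigO_sub.mono nhdsWithin_le_nhds
  have h1 := isBigO_taylor_on_levelSet (h := P.cE l) (h' := P.J l)
    (h.smooth.cE.of_le (by norm_num)) (range_J_eq_top h.indep)
    (h.smooth.eventually.mono fun y hy => hy.hasFDerivAt_cE) hJ
  have h2 : (fun y => (P.J l y - P.J l x) (y - x)) =O[𝓝[{y | P.cE l y = P.cE l x}] x]
      fun y => ‖y - x‖ ^ 2 := by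
    have h3 : (fun y => (P.J l y - P.J l x) (y - x)) =O[𝓝[{y | P.cE l y = P.cE l x}] x]
        fun y => ‖P.J l y - P.J l x‖ * ‖y - x‖ :=
      Asymptotics.isBigO_of_le _ fun y => by
        simpa using (P.J l y - P.J l x).le_opNorm (y - x)
    refine h3.trans ?_
    simp only [sq]
    exact hJ.norm_norm.mul (Asymptotics.isBigO_refl _ _)
  refine (h2.sub h1).congr' ?_ EventuallyEq.rfl
  filter_upwards [self_mem_nhdsWithin] with y hy
  have hy' : P.cE l y = P.cE l x := hy
  simp only [hy', sub_self, zero_sub, sub_apply]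
  abel

/-- The estimates for the decoupled solution of one region and an accurate Hessian
approximation `H`, in terms of the distance `‖z - x‖ + ‖λ' - λ‖` to the base point. -/
theorem IsDecoupledRegular.eventually_estimates (h : P.IsDecoupledRegular μ ρ Sg l x lam gam)
    (hP : P.Smooth) {M : ℝ} (hM : 0 ≤ M) :
    ∃ C > 0, ∀ᶠ q : Vec (n l) × Vec (n l) × Vec p in 𝓝 (x, x, lam), ∀ g H,
      P.IsDecoupledKKT μ ρ Sg l q.2.1 q.2.2 q.1 g →
      ‖P.condHess μ l q.1 g - H‖ ≤ M * ‖q.1 - q.2.1‖ →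
      ‖q.1 - x‖ ≤ C * (‖q.2.1 - x‖ + ‖q.2.2 - lam‖) ∧
      ‖H - P.condHess μ l x gam‖ ≤ C * (‖q.2.1 - x‖ + ‖q.2.2 - lam‖) ∧
      ‖H (q.1 - x) - (P.gradLag l (P.kapOf μ l q.1) gam q.1 -
        P.gradLag l (P.kapOf μ l x) gam x)‖ ≤
          C * ‖q.1 - x‖ * (‖q.2.1 - x‖ + ‖q.2.2 - lam‖) ∧
      ‖P.J l q.1 (q.1 - x)‖ ≤ C * ‖q.1 - x‖ * (‖q.2.1 - x‖ + ‖q.2.2 - lam‖) := by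
  have hx : x ∈ P.localFeasible l := ⟨h.kkt.eqE, fun m => (h.kkt.ineq m).le⟩
  obtain ⟨C₁, hC₁, hlip⟩ := h.eventually_norm_le
  obtain ⟨C₂, hC₂, hhess⟩ := (hP.isBigO_condHess hx h.kkt.ineq μ gam).exists_pos
  obtain ⟨C₃, hC₃, htay⟩ := (h.isBigO_condGrad_sub hP).exists_pos
  obtain ⟨C₄, hC₄, hJ⟩ := h.isBigO_J_apply_sub.exists_pos
  have hhess' := h.eventually_mem (eventually_nhdsWithin_iff.1 hhess.bound)
  have hfst : Tendsto (fun q : Vec (n l) × Vec (n l) × Vec p => q.1) (𝓝 (x, x, lam)) (𝓝 x) :=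
    continuousAt_fst
  set D : ℝ := M * (C₁ + 1) + C₂ * C₁ with hD
  have hD0 : 0 ≤ D := by positivity
  refine ⟨C₁ + D + C₃ * C₁ + C₄ * C₁, by positivity, ?_⟩
  filter_upwards [hlip, hhess', hfst.eventually (eventually_nhdsWithin_iff.1 htay.bound),
    hfst.eventually (eventually_nhdsWithin_iff.1 hJ.bound)] with q h1 h2 h3 h4 g H hg hH
  have hcE : q.1 ∈ {y | P.cE l y = P.cE l x} := hg.eqE.trans h.kkt.eqE.symm
  replace h1 := h1 g hg
  replace h2 := h2 g hg ⟨hg.eqE, fun m => (hg.ineq m).le⟩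
  replace h3 := h3 hcE
  replace h4 := h4 hcE
  simp only [norm_pow, norm_norm] at h3 h4
  set e : ℝ := ‖q.2.1 - x‖ + ‖q.2.2 - lam‖ with he
  have he0 : 0 ≤ e := by positivity
  have hxe : ‖q.1 - x‖ ≤ C₁ * e := (norm_fst_le ((q.1, g) - (x, gam))).trans h1
  have hz : ‖q.1 - q.2.1‖ ≤ (C₁ + 1) * e := by
    have h5 : q.1 - q.2.1 = (q.1 - x) - (q.2.1 - x) := by abel
    rw [h5]
    refine (norm_sub_le _ _).trans ?_
    have h6 : ‖q.2.1 - x‖ ≤ e := by rw [he]; linarith [norm_nonneg (q.2.2 - lam)]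
    linarith
  have hHe : ‖H - P.condHess μ l x gam‖ ≤ D * e := by
    have h5 : H - P.condHess μ l x gam =
        (P.condHess μ l q.1 g - P.condHess μ l x gam) - (P.condHess μ l q.1 g - H) := by abel
    rw [h5]
    refine (norm_sub_le _ _).trans ?_
    have h6 := mul_le_mul_of_nonneg_left hz hM
    have h7 := mul_le_mul_of_nonneg_left h1 hC₂.le
    rw [hD]
    nlinarith
  have hn := norm_nonneg (q.1 - x)
  have hC1e : 0 ≤ C₁ * e := by positivity
  have hDe : 0 ≤ D * e := by positivity
  have h3e : 0 ≤ C₃ * C₁ * e := by positivity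
  have h4e : 0 ≤ C₄ * C₁ * e := by positivity
  have hsq : ‖q.1 - x‖ ^ 2 ≤ C₁ * e * ‖q.1 - x‖ := by
    rw [sq]; exact mul_le_mul_of_nonneg_right hxe hn
  have hsum : (C₁ + D + C₃ * C₁ + C₄ * C₁) * e =
    C₁ * e + D * e + C₃ * C₁ * e + C₄ * C₁ * e := by ring
  have hsum' : (C₁ + D + C₃ * C₁ + C₄ * C₁) * ‖q.1 - x‖ * e =
    (C₁ * e + D * e + C₃ * C₁ * e + C₄ * C₁ * e) * ‖q.1 - x‖ := by ring
  rw [hsum, hsum']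
  refine ⟨by linarith, by linarith, ?_, ?_⟩
  · have h5 : H (q.1 - x) - (P.gradLag l (P.kapOf μ l q.1) gam q.1 -
        P.gradLag l (P.kapOf μ l x) gam x) = (H - P.condHess μ l x gam) (q.1 - x) -
        (P.gradLag l (P.kapOf μ l q.1) gam q.1 - P.gradLag l (P.kapOf μ l x) gam x -
          P.condHess μ l x gam (q.1 - x)) := by
      rw [sub_apply]; abel
    rw [h5]
    refine (norm_sub_le _ _).trans ?_
    have h6 := (H - P.condHess μ l x gam).le_of_opNorm_le hHe (q.1 - x)
    have h7 := mul_le_mul_of_nonneg_left hsq hC₃.le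
    nlinarith [mul_nonneg hC1e hn, mul_nonneg h4e hn]
  · have h7 := mul_le_mul_of_nonneg_left hsq hC₄.le
    nlinarith [mul_nonneg hC1e hn, mul_nonneg h3e hn, mul_nonneg hDe hn]

/-! ### The coupled Newton system -/

section Newton

variable [Fintype R]

variable (P) in
/-- The matrix of the coupled Newton system for the Hessian approximations `w.1` and the
Jacobians at `w.2`, acting on `((Δx, Δγ), Δλ)`. -/
def newtonOp (w : (∀ l, Vec (n l) →L[ℝ] Vec (n l)) × ∀ l, Vec (n l)) :
    ((∀ l, Vec (n l) × Vec (mE l)) × Vec p) →L[ℝ] ((∀ l, Vec (n l) × Vec (mE l)) × Vec p) :=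
  (ContinuousLinearMap.pi fun l =>
    (w.1 l ∘L ContinuousLinearMap.fst ℝ _ _ ∘L ContinuousLinearMap.proj l ∘L
        ContinuousLinearMap.fst ℝ _ _ +
      adjointL _ _ (P.J l (w.2 l)) ∘L ContinuousLinearMap.snd ℝ _ _ ∘L
        ContinuousLinearMap.proj l ∘L ContinuousLinearMap.fst ℝ _ _ +
      ContinuousLinearMap.adjoint (P.A l) ∘L ContinuousLinearMap.snd ℝ _ _).prod
    (P.J l (w.2 l) ∘L ContinuousLinearMap.fst ℝ _ _ ∘L ContinuousLinearMap.proj l ∘L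
      ContinuousLinearMap.fst ℝ _ _)).prod
  (∑ l, P.A l ∘L ContinuousLinearMap.fst ℝ _ _ ∘L ContinuousLinearMap.proj l ∘L
    ContinuousLinearMap.fst ℝ _ _)

theorem newtonOp_apply (w : (∀ l, Vec (n l) →L[ℝ] Vec (n l)) × ∀ l, Vec (n l))
    (d : (∀ l, Vec (n l) × Vec (mE l)) × Vec p) :
    P.newtonOp w d = (fun l => (w.1 l (d.1 l).1 +
      ContinuousLinearMap.adjoint (P.J l (w.2 l)) (d.1 l).2 +
      ContinuousLinearMap.adjoint (P.A l) d.2, P.J l (w.2 l) (d.1 l).1),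
      ∑ l, P.A l (d.1 l).1) := by
  refine Prod.ext rfl ?_
  simp [newtonOp, sum_apply]

/-- `(x, λ, γ)` is a regular primal-dual solution of the coupled barrier problem: it satisfies the
perturbed KKT conditions, the equality gradients are independent, and the second-order sufficient
condition holds. Slack and inequality multiplier are eliminated. -/
structure IsBarrierRegular (P : DistNLP R n mE mI p) (μ : ℝ) (x : ∀ l, Vec (n l)) (lam : Vec p)
    (gam : ∀ l, Vec (mE l)) : Prop where
  smooth : ∀ l, P.SmoothAt l (x l)
  eqE : ∀ l, P.cE l (x l) = 0
  ineq : ∀ l m, P.cI l (x l) m < 0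
  cons : ∑ l, P.A l (x l) = P.b
  stat : ∀ l, P.gradLag l (P.kapOf μ l (x l)) (gam l) (x l) +
    ContinuousLinearMap.adjoint (P.A l) lam = 0
  indep : ∀ (u : Vec p) (v : ∀ l, Vec (mE l)), (∀ l, ContinuousLinearMap.adjoint (P.A l) u +
    ContinuousLinearMap.adjoint (P.J l (x l)) (v l) = 0) → u = 0 ∧ v = 0
  pos : ∀ d : ∀ l, Vec (n l), d ≠ 0 → ∑ l, P.A l (d l) = 0 → (∀ l, P.J l (x l) (d l) = 0) →
    0 < ∑ l, ⟪d l, P.condHess μ l (x l) (gam l) (d l)⟫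

variable {x : ∀ l, Vec (n l)} {gam : ∀ l, Vec (mE l)}

theorem IsBarrierRegular.isDecoupledRegular (h : P.IsBarrierRegular μ x lam gam)
    (hpos : ∀ d, d ≠ 0 → P.J l (x l) d = 0 →
      0 < ⟪d, (P.condHess μ l (x l) (gam l) + ρ • Sg l) d⟫) :
    P.IsDecoupledRegular μ ρ Sg l (x l) lam (gam l) where
  smooth := h.smooth l
  kkt := ⟨h.eqE l, h.ineq l, by rw [sub_self, map_zero, smul_zero, add_zero]; exact h.stat l⟩
  indep v hv := by
    classical
    have h1 := (h.indep 0 (Pi.single l v) fun l' => ?_).2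
    · simpa using congrFun h1 l
    · rw [map_zero, zero_add]
      rcases eq_or_ne l' l with rfl | hne
      · rwa [Pi.single_eq_same]
      · rw [Pi.single_eq_of_ne hne, map_zero]
  pos := hpos

/-- The Newton matrix with exact condensed Hessians is nonsingular at a regular barrier solution. -/
theorem IsBarrierRegular.newtonOp_injective (h : P.IsBarrierRegular μ x lam gam)
    (d : (∀ l, Vec (n l) × Vec (mE l)) × Vec p)
    (hd : P.newtonOp (fun l => P.condHess μ l (x l) (gam l), x) d = 0) : d = 0 := by
  rw [newtonOp_apply] at hd
  obtain ⟨h1, h2⟩ := Prod.ext_iff.1 hd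
  have h3 : ∀ l, P.condHess μ l (x l) (gam l) (d.1 l).1 +
      ContinuousLinearMap.adjoint (P.J l (x l)) (d.1 l).2 +
      ContinuousLinearMap.adjoint (P.A l) d.2 = 0 := fun l => congrArg Prod.fst (congrFun h1 l)
  have h4 : ∀ l, P.J l (x l) (d.1 l).1 = 0 := fun l => congrArg Prod.snd (congrFun h1 l)
  have h2 : ∑ l, P.A l (d.1 l).1 = 0 := h2
  have hx : (fun l => (d.1 l).1) = 0 := by
    by_contra hne
    have h5 := h.pos _ hne h2 h4
    have h6 : ∑ l, ⟪(d.1 l).1, P.condHess μ l (x l) (gam l) (d.1 l).1⟫ =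
        -⟪∑ l, P.A l (d.1 l).1, d.2⟫ := by
      rw [sum_inner, ← Finset.sum_neg_distrib]
      refine Finset.sum_congr rfl fun l _ => ?_
      have h7 : P.condHess μ l (x l) (gam l) (d.1 l).1 =
          -(ContinuousLinearMap.adjoint (P.J l (x l)) (d.1 l).2 +
            ContinuousLinearMap.adjoint (P.A l) d.2) := by
        rw [eq_neg_iff_add_eq_zero, ← h3 l]; abel
      rw [h7, inner_neg_right, inner_add_right, ContinuousLinearMap.adjoint_inner_right,
        ContinuousLinearMap.adjoint_inner_right, h4, inner_zero_left, zero_add]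
    rw [h6, h2, inner_zero_left, neg_zero] at h5
    exact lt_irrefl _ h5
  have hx' : ∀ l, (d.1 l).1 = 0 := fun l => congrFun hx l
  obtain ⟨h8, h9⟩ := h.indep d.2 (fun l => (d.1 l).2) fun l => by
    rw [← h3 l, hx' l, map_zero, zero_add, add_comm]
  exact Prod.ext (funext fun l => Prod.ext (hx' l) (congrFun h9 l)) h8

theorem IsBarrierRegular.eventually_norm_le_newtonOp (h : P.IsBarrierRegular μ x lam gam) :
    ∃ C > 0, ∀ᶠ w in 𝓝 (fun l => P.condHess μ l (x l) (gam l), x),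
      ∀ d, ‖d‖ ≤ C * ‖P.newtonOp w d‖ := by
  refine eventually_norm_le_mul_norm_apply (continuousAt_clm_apply.2 fun d => ?_)
    h.newtonOp_injective
  simp only [newtonOp_apply]
  have hJ : ∀ l, ContinuousAt (fun w : (∀ l, Vec (n l) →L[ℝ] Vec (n l)) × ∀ l, Vec (n l) =>
      P.J l (w.2 l)) (fun l => P.condHess μ l (x l) (gam l), x) := fun l =>
    (h.smooth l).continuousAt_J.comp_of_eq
      (f := fun w : (∀ l, Vec (n l) →L[ℝ] Vec (n l)) × ∀ l, Vec (n l) => w.2 l)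
      (((continuous_apply l).comp continuous_snd).continuousAt) rfl
  refine ContinuousAt.prodMk (continuousAt_pi.2 fun l => ContinuousAt.prodMk ?_ ?_)
    continuousAt_const
  · have h1 : ContinuousAt (fun w : (∀ l, Vec (n l) →L[ℝ] Vec (n l)) × ∀ l, Vec (n l) =>
        w.1 l (d.1 l).1) (fun l => P.condHess μ l (x l) (gam l), x) := by fun_prop
    have h2 := ((adjointL _ _).continuous.continuousAt.comp (hJ l)).clm_apply
      (continuousAt_const (y := (d.1 l).2))
    exact (h1.add h2).add continuousAt_const
  · exact (hJ l).clm_apply continuousAt_const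

end Newton

end DistNLP

/-! ### One iteration near a regular barrier solution -/

namespace DistNLP

variable {R : Type*} [Fintype R] {n mE mI : R → ℕ} {p : ℕ} {P : DistNLP R n mE mI p}
  {μ ρ : ℝ} {Sg : ∀ l, Vec (n l) →L[ℝ] Vec (n l)}
  {x : ∀ l, Vec (n l)} {lam : Vec p} {gam : ∀ l, Vec (mE l)}

variable (P) in
/-- The right-hand side of the coupled Newton system at a point that satisfies the local
constraints, with slack and inequality multiplier eliminated. -/
def newtonRhs (μ : ℝ) (lam : Vec p) (x : ∀ l, Vec (n l)) (gam : ∀ l, Vec (mE l)) :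
    (∀ l, Vec (n l) × Vec (mE l)) × Vec p :=
  (fun l => (-(P.gradLag l (P.kapOf μ l (x l)) (gam l) (x l) +
    ContinuousLinearMap.adjoint (P.A l) lam), 0), -(∑ l, P.A l (x l) - P.b))

theorem isCoordStep_iff_newtonOp {z : ∀ l, Vec (n l)} {y : LocalVars R n mE mI}
    (hy : ∀ l, P.IsDecoupledSolution μ ρ Sg z lam y l) (H : ∀ l, Vec (n l) →L[ℝ] Vec (n l))
    (d : CoordStep R n mE p) :
    P.IsCoordStep μ lam y H d ↔ P.newtonOp (H, y.x) (fun l => (d.dx l, d.dgam l), d.dlam) =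
      P.newtonRhs μ lam y.x y.gam := by
  have hg : ∀ l, P.newtonGrad μ lam y l = P.gradLag l (P.kapOf μ l (y.x l)) (y.gam l) (y.x l) +
      ContinuousLinearMap.adjoint (P.A l) lam := by
    intro l
    -- the complementarity defect `μ + κ cI = μ - κ s` vanishes at a decoupled solution
    have h1 : (WithLp.toLp 2 fun m => (μ + y.kap l m * P.cI l (y.x l) m) / y.s l m :
        Vec (mI l)) = 0 := by
      ext m
      have h2 := (hy l).compl m
      have h3 : y.s l m = -P.cI l (y.x l) m := by rw [(hy l).s_eq]; rfl
      have h4 : μ + y.kap l m * P.cI l (y.x l) m = 0 := by rw [← h2, h3]; ring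
      simp [h4]
    rw [newtonGrad, h1, map_zero, add_zero, (hy l).kap_eq]
  rw [newtonOp_apply, newtonRhs, Prod.mk.injEq, funext_iff]
  simp only [Prod.mk.injEq]
  constructor
  · rintro ⟨h1, h2, h3⟩
    exact ⟨fun l => ⟨(h1 l).trans (by rw [hg]), (h2 l).trans (by rw [(hy l).feas.1, neg_zero])⟩, h3⟩
  · rintro ⟨h1, h2⟩
    exact ⟨fun l => (h1 l).1.trans (by rw [hg]),
      fun l => (h1 l).2.trans (by rw [(hy l).feas.1, neg_zero]), h2⟩

/-- The error after the coordination step is governed by the Taylor remainder of the condensed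
KKT system: multipliers enter linearly and cancel. -/
theorem IsBarrierRegular.newtonOp_error (h : P.IsBarrierRegular μ x lam gam)
    {x' : ∀ l, Vec (n l)} (hx' : ∀ l, P.SmoothAt l (x' l)) {lam' : Vec p}
    {g : ∀ l, Vec (mE l)} {H : ∀ l, Vec (n l) →L[ℝ] Vec (n l)}
    {d : (∀ l, Vec (n l) × Vec (mE l)) × Vec p}
    (hd : P.newtonOp (H, x') d = P.newtonRhs μ lam' x' g) :
    P.newtonOp (H, x') (d + (fun l => (x' l - x l, g l - gam l), lam' - lam)) =
      (fun l => (H l (x' l - x l) - (P.gradLag l (P.kapOf μ l (x' l)) (gam l) (x' l) -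
        P.gradLag l (P.kapOf μ l (x l)) (gam l) (x l)), P.J l (x' l) (x' l - x l)), 0) := by
  rw [map_add, hd, newtonOp_apply, newtonRhs]
  refine Prod.ext (funext fun l => Prod.ext ?_ (zero_add _)) ?_
  · have h1 := h.stat l
    change -(P.gradLag l (P.kapOf μ l (x' l)) (g l) (x' l) +
      ContinuousLinearMap.adjoint (P.A l) lam') + (H l (x' l - x l) +
      ContinuousLinearMap.adjoint (P.J l (x' l)) (g l - gam l) +
      ContinuousLinearMap.adjoint (P.A l) (lam' - lam)) =
      H l (x' l - x l) - (P.gradLag l (P.kapOf μ l (x' l)) (gam l) (x' l) -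
        P.gradLag l (P.kapOf μ l (x l)) (gam l) (x l))
    rw [eq_neg_of_add_eq_zero_left h1, (hx' l).gradLag_eq, (hx' l).gradLag_eq, map_sub, map_sub]
    simp only [map_sub]
    abel
  · change -(∑ l, P.A l (x' l) - P.b) + ∑ l, P.A l (x' l - x l) = 0
    simp only [map_sub, Finset.sum_sub_distrib, h.cons]
    abel

/-- Near a regular barrier solution the coordination step is well defined, contracts
quadratically, and keeps slacks within the fraction-to-boundary bound. -/
theorem IsBarrierRegular.eventually_newton_step (h : P.IsBarrierRegular μ x lam gam)
    (hP : P.Smooth) (hreg : ∀ l, P.IsDecoupledRegular μ ρ Sg l (x l) lam (gam l))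
    {M τ : ℝ} (hM : 0 ≤ M) (hτ : 0 < τ) :
    ∃ C > 0, ∀ᶠ q : (∀ l, Vec (n l)) × (∀ l, Vec (n l)) × Vec p in 𝓝 (x, x, lam),
      ∀ (g : ∀ l, Vec (mE l)) (H : ∀ l, Vec (n l) →L[ℝ] Vec (n l)),
      (∀ l, P.IsDecoupledKKT μ ρ Sg l (q.2.1 l) q.2.2 (q.1 l) (g l)) →
      (∀ l, ‖P.condHess μ l (q.1 l) (g l) - H l‖ ≤ M * ‖q.1 l - q.2.1 l‖) →
      Function.Injective (P.newtonOp (H, q.1)) ∧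
      ∀ d, P.newtonOp (H, q.1) d = P.newtonRhs μ q.2.2 q.1 g →
        ‖(q.1 + fun l => (d.1 l).1) - x‖ + ‖q.2.2 + d.2 - lam‖ ≤
          C * ‖q.1 - x‖ * (‖q.2.1 - x‖ + ‖q.2.2 - lam‖) ∧
        ∀ l m, |P.Rjac l (q.1 l) (d.1 l).1 m| ≤ τ * -P.cI l (q.1 l) m := by
  choose C hC hest using fun l => (hreg l).eventually_estimates hP hM
  obtain ⟨C₁, hC₁, hinv⟩ := h.eventually_norm_le_newtonOp
  set C₀ : ℝ := ∑ l, C l with hC₀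
  have hC₀0 : 0 ≤ C₀ := Finset.sum_nonneg fun l _ => (hC l).le
  have hCl : ∀ l, C l ≤ C₀ := fun l =>
    Finset.single_le_sum (fun l _ => (hC l).le) (Finset.mem_univ l)
  have hproj : ∀ l, Tendsto (fun q : (∀ l, Vec (n l)) × (∀ l, Vec (n l)) × Vec p =>
      (q.1 l, q.2.1 l, q.2.2)) (𝓝 (x, x, lam)) (𝓝 (x l, x l, lam)) := fun l =>
    Continuous.tendsto (by fun_prop) (x, x, lam)
  have hfst : Tendsto (fun q : (∀ l, Vec (n l)) × (∀ l, Vec (n l)) × Vec p => q.1)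
      (𝓝 (x, x, lam)) (𝓝 x) := continuousAt_fst
  have hest' := eventually_all.2 fun l => (hproj l).eventually (hest l)
  have hsmooth : ∀ᶠ q : (∀ l, Vec (n l)) × (∀ l, Vec (n l)) × Vec p in 𝓝 (x, x, lam),
      ∀ l, P.SmoothAt l (q.1 l) := eventually_all.2 fun l =>
    (((continuous_apply l).tendsto x).comp hfst).eventually (h.smooth l).eventually
  -- the fraction-to-boundary bound for small steps
  have hftb : ∀ᶠ q : (∀ l, Vec (n l)) × (∀ l, Vec (n l)) in 𝓝 (x, 0), ∀ l m,
      |P.Rjac l (q.1 l) (q.2 l) m| < τ * -P.cI l (q.1 l) m := by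
    refine eventually_all.2 fun l => eventually_all.2 fun m => ?_
    have hp : ContinuousAt (fun q : (∀ l, Vec (n l)) × (∀ l, Vec (n l)) => q.1 l) (x, 0) := by
      fun_prop
    have hp2 : ContinuousAt (fun q : (∀ l, Vec (n l)) × (∀ l, Vec (n l)) => q.2 l) (x, 0) := by
      fun_prop
    have h1 : ContinuousAt (fun q : (∀ l, Vec (n l)) × (∀ l, Vec (n l)) =>
        P.Rjac l (q.1 l) (q.2 l)) (x, 0) :=
      ((h.smooth l).continuousAt_Rjac.comp_of_eq hp rfl).clm_apply hp2
    have h2 : ContinuousAt (fun q : (∀ l, Vec (n l)) × (∀ l, Vec (n l)) =>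
        |P.Rjac l (q.1 l) (q.2 l) m|) (x, 0) :=
      ((EuclideanSpace.proj (𝕜 := ℝ) m).continuous.continuousAt.comp h1).abs
    have h3 : ContinuousAt (fun q : (∀ l, Vec (n l)) × (∀ l, Vec (n l)) =>
        τ * -P.cI l (q.1 l) m) (x, 0) :=
      (((h.smooth l).continuousAt_cI_apply m).comp_of_eq hp rfl).neg.const_mul τ
    refine h2.eventually_lt h3 ?_
    simp only [Pi.zero_apply, map_zero, PiLp.zero_apply, abs_zero]
    exact mul_pos hτ (neg_pos.2 (h.ineq l m))
  obtain ⟨ε₁, hε₁, hball₁⟩ := Metric.eventually_nhds_iff.1 hinv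
  obtain ⟨ε₂, hε₂, hball₂⟩ := Metric.eventually_nhds_iff.1 hftb
  set C₂ : ℝ := C₁ * C₀ with hC₂
  have hC₂0 : 0 ≤ C₂ := by positivity
  have hsmall : ∀ᶠ q : (∀ l, Vec (n l)) × (∀ l, Vec (n l)) × Vec p in 𝓝 (x, x, lam),
      ‖q.1 - x‖ < min ε₁ ε₂ ∧ C₀ * (‖q.2.1 - x‖ + ‖q.2.2 - lam‖) < ε₁ ∧
      2 * C₂ * ‖q.1 - x‖ * (‖q.2.1 - x‖ + ‖q.2.2 - lam‖) + ‖q.1 - x‖ < ε₂ := by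
    have c1 : Continuous (fun q : (∀ l, Vec (n l)) × (∀ l, Vec (n l)) × Vec p =>
      ‖q.1 - x‖) := by fun_prop
    have c2 : Continuous (fun q : (∀ l, Vec (n l)) × (∀ l, Vec (n l)) × Vec p =>
      ‖q.2.1 - x‖ + ‖q.2.2 - lam‖) := by fun_prop
    have e1 := (c1.continuousAt (x := (x, x, lam))).eventually_lt
      (continuousAt_const (y := min ε₁ ε₂)) (by simp [hε₁, hε₂])
    have e2 := ((c2.const_mul C₀).continuousAt (x := (x, x, lam))).eventually_lt
      (continuousAt_const (y := ε₁)) (by simp [hε₁])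
    have e3 := ((((c1.const_mul (2 * C₂)).mul c2).add c1).continuousAt
      (x := (x, x, lam))).eventually_lt (continuousAt_const (y := ε₂)) (by simp [hε₂])
    filter_upwards [e1, e2, e3] with q h1 h2 h3
    exact ⟨h1, h2, h3⟩
  refine ⟨2 * C₂ + 1, by positivity, ?_⟩
  filter_upwards [hest', hsmooth, hsmall] with q h1 h2 ⟨h3, h4, h5⟩ g H hg hH
  set e : ℝ := ‖q.2.1 - x‖ + ‖q.2.2 - lam‖ with he
  have he0 : 0 ≤ e := by positivity
  have hle : ∀ l, ‖q.2.1 l - x l‖ + ‖q.2.2 - lam‖ ≤ e := fun l =>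
    add_le_add_left (norm_le_pi_norm (q.2.1 - x) l) _
  have hlx : ∀ l, ‖q.1 l - x l‖ ≤ ‖q.1 - x‖ := fun l => norm_le_pi_norm (q.1 - x) l
  have hbound := hball₁ (y := (H, q.1)) (by
    rw [Prod.dist_eq, max_lt_iff, dist_eq_norm q.1]
    refine ⟨(dist_pi_lt_iff hε₁).2 fun l => ?_, h3.trans_le (min_le_left _ _)⟩
    rw [dist_eq_norm]
    refine lt_of_le_of_lt ?_ h4
    exact (h1 l (g l) (H l) (hg l) (hH l)).2.1.trans
      (mul_le_mul (hCl l) (hle l) (by positivity) hC₀0))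
  refine ⟨(injective_iff_map_eq_zero _).2 fun d hd => ?_, fun d hd => ?_⟩
  · have := hbound d
    rwa [hd, norm_zero, mul_zero, norm_le_zero_iff] at this
  have hv := hbound (d + (fun l => (q.1 l - x l, g l - gam l), q.2.2 - lam))
  rw [h.newtonOp_error h2 hd] at hv
  have hrem : ∀ l, C l * ‖q.1 l - x l‖ * (‖q.2.1 l - x l‖ + ‖q.2.2 - lam‖) ≤
      C₀ * ‖q.1 - x‖ * e := fun l =>
    mul_le_mul (mul_le_mul (hCl l) (hlx l) (norm_nonneg _) hC₀0) (hle l) (by positivity)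
      (by positivity)
  have hv' : ‖d + (fun l => (q.1 l - x l, g l - gam l), q.2.2 - lam)‖ ≤
      C₂ * ‖q.1 - x‖ * e := by
    refine hv.trans ?_
    rw [hC₂, mul_assoc C₁, mul_assoc C₁]
    refine mul_le_mul_of_nonneg_left ?_ hC₁.le
    rw [Prod.norm_mk, norm_zero, max_eq_left (norm_nonneg _)]
    refine (pi_norm_le_iff_of_nonneg (by positivity)).2 fun l => ?_
    obtain ⟨-, -, h6, h7⟩ := h1 l (g l) (H l) (hg l) (hH l)
    exact norm_prod_le_iff.2 ⟨h6.trans (hrem l), h7.trans (hrem l)⟩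
  have hvx : ‖(q.1 + fun l => (d.1 l).1) - x‖ ≤ C₂ * ‖q.1 - x‖ * e := by
    refine (pi_norm_le_iff_of_nonneg (by positivity)).2 fun l => ?_
    have h6 : ((q.1 + fun l => (d.1 l).1) - x) l =
        ((d + (fun l => (q.1 l - x l, g l - gam l), q.2.2 - lam)).1 l).1 := by
      change q.1 l + (d.1 l).1 - x l = (d.1 l).1 + (q.1 l - x l)
      abel
    rw [h6]
    exact (norm_fst_le _).trans ((norm_le_pi_norm _ l).trans ((norm_fst_le _).trans hv'))
  have hvl : ‖q.2.2 + d.2 - lam‖ ≤ C₂ * ‖q.1 - x‖ * e := by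
    have h6 : q.2.2 + d.2 - lam =
        (d + (fun l => (q.1 l - x l, g l - gam l), q.2.2 - lam)).2 := by
      change q.2.2 + d.2 - lam = d.2 + (q.2.2 - lam)
      abel
    rw [h6]
    exact (norm_snd_le _).trans hv'
  have hxe : 0 ≤ ‖q.1 - x‖ * e := by positivity
  refine ⟨by linarith, fun l m => ?_⟩
  refine (hball₂ (y := (q.1, fun l => (d.1 l).1)) ?_ l m).le
  rw [Prod.dist_eq, max_lt_iff, dist_eq_norm, dist_eq_norm, sub_zero]
  refine ⟨h3.trans_le (min_le_right _ _), lt_of_le_of_lt ?_ h5⟩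
  have h6 : (fun l => (d.1 l).1) = ((q.1 + fun l => (d.1 l).1) - x) - (q.1 - x) := by abel
  rw [h6]
  refine (norm_sub_le _ _).trans ?_
  have : 0 ≤ C₂ * ‖q.1 - x‖ * e := by positivity
  linarith

/-- One iteration near a regular barrier solution: the decoupled problems have a unique nearby
solution, the coordination step is unique, and the errors contract quadratically. -/
theorem IsBarrierRegular.exists_local_iteration (h : P.IsBarrierRegular μ x lam gam)
    (hP : P.Smooth) (hSg : ∀ l, IsSelfAdjoint (Sg l))
    (hreg : ∀ l, P.IsDecoupledRegular μ ρ Sg l (x l) lam (gam l))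
    {M τ : ℝ} (hM : 0 ≤ M) (hτ : 0 < τ) :
    ∃ r > 0, ∃ δ > 0, ∃ C > 0, ∀ (z : ∀ l, Vec (n l)) (lam' : Vec p),
      dist z x < δ → dist lam' lam < δ →
      (∃! y : LocalVars R n mE mI,
        (∀ l, P.IsDecoupledSolution μ ρ Sg z lam' y l) ∧ dist y.x x < r) ∧
      ∀ y : LocalVars R n mE mI, (∀ l, P.IsDecoupledSolution μ ρ Sg z lam' y l) →
        dist y.x x < r →
        ‖y.x - x‖ ≤ C * (‖z - x‖ + ‖lam' - lam‖) ∧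
        ∀ H, P.HessAccurate M z y H →
          (∃! d : CoordStep R n mE p, P.IsCoordStep μ lam' y H d) ∧
          ∀ d : CoordStep R n mE p, P.IsCoordStep μ lam' y H d →
            ‖y.x + d.dx - x‖ + ‖lam' + d.dlam - lam‖ ≤
              C * ‖y.x - x‖ * (‖z - x‖ + ‖lam' - lam‖) ∧
            ∀ l m, |P.Rjac l (y.x l) (d.dx l) m| ≤ τ * y.s l m := by
  obtain ⟨C₁, hC₁, hstep⟩ := h.eventually_newton_step hP hreg hM hτ
  choose C hC hlip using fun l => (hreg l).eventually_norm_le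
  choose t ht huniq using fun l => (hreg l).exists_unique_nhds
  have hproj : ∀ l, Tendsto (fun q : (∀ l, Vec (n l)) × (∀ l, Vec (n l)) × Vec p =>
      (q.1 l, q.2.1 l, q.2.2)) (𝓝 (x, x, lam)) (𝓝 (x l, x l, lam)) := fun l =>
    Continuous.tendsto (by fun_prop) (x, x, lam)
  have hall := hstep.and ((eventually_all.2 fun l => (hproj l).eventually (hlip l)).and
    (eventually_all.2 fun l => (hproj l).eventually ((hreg l).eventually_mem (ht l))))
  obtain ⟨r, hr, hball⟩ := Metric.eventually_nhds_iff.1 hall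
  have hex : ∀ᶠ q : (∀ l, Vec (n l)) × Vec p in 𝓝 (x, lam), ∀ l, ∃ w ∈ Metric.ball (x l, gam l) r,
      P.IsDecoupledKKT μ ρ Sg l (q.1 l) q.2 w.1 w.2 ∧
      ∀ z : ∀ l, Vec (n l), z l = q.1 l →
        IsLocalMinOn (P.decoupledObj μ ρ Sg z q.2 l) (P.barrierLocalFeasible l)
          (w.1, -P.cI l w.1) := by
    refine eventually_all.2 fun l => ?_
    have h1 : Tendsto (fun q : (∀ l, Vec (n l)) × Vec p => (q.1 l, q.2)) (𝓝 (x, lam))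
      (𝓝 (x l, lam)) := Continuous.tendsto (by fun_prop) (x, lam)
    exact h1.eventually ((hreg l).eventually_exists (hSg l) (Metric.ball_mem_nhds _ hr))
  obtain ⟨δ, hδ, hexball⟩ := Metric.eventually_nhds_iff.1 hex
  set C₀ : ℝ := ∑ l, C l with hC₀
  have hC₀0 : 0 ≤ C₀ := Finset.sum_nonneg fun l _ => (hC l).le
  have hCl : ∀ l, C l ≤ C₀ := fun l =>
    Finset.single_le_sum (fun l _ => (hC l).le) (Finset.mem_univ l)
  refine ⟨r, hr, min r δ, lt_min hr hδ, C₀ + C₁, by positivity, fun z lam' hz hlam => ?_⟩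
  rw [lt_min_iff] at hz hlam
  have hnear : ∀ y : LocalVars R n mE mI, dist y.x x < r → dist (y.x, z, lam') (x, x, lam) < r :=
    fun y hy => by
      rw [Prod.dist_eq, Prod.dist_eq, max_lt_iff, max_lt_iff]
      exact ⟨hy, hz.1, hlam.1⟩
  refine ⟨?_, fun y hy hyr => ?_⟩
  · choose w hw hkkt hmin using hexball (y := (z, lam')) (by
      rw [Prod.dist_eq, max_lt_iff]; exact ⟨hz.2, hlam.2⟩)
    refine ⟨⟨fun l => (w l).1, fun l => -P.cI l (w l).1, fun l => (w l).2,
      fun l => P.kapOf μ l (w l).1⟩, ⟨fun l => ?_, ?_⟩, ?_⟩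
    · refine ⟨mem_barrierLocalFeasible (hkkt l).eqE (hkkt l).ineq, hmin l z rfl, (hkkt l).stat,
        fun m => ?_⟩
      have h1 := ((hkkt l).ineq m).ne
      change -P.cI l (w l).1 m * (-μ / P.cI l (w l).1 m) = μ
      field_simp
    · refine (dist_pi_lt_iff hr).2 fun l => ?_
      have h1 := hw l
      rw [Metric.mem_ball, Prod.dist_eq, max_lt_iff] at h1
      exact h1.1
    · rintro y ⟨hy, hyr⟩
      have h1 : dist (fun l => (w l).1) x < r := (dist_pi_lt_iff hr).2 fun l => by
        have h1 := hw l
        rw [Metric.mem_ball, Prod.dist_eq, max_lt_iff] at h1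
        exact h1.1
      have h2 : ∀ l, (y.x l, y.gam l) = w l := fun l =>
        huniq l _ ((hball (hnear y hyr)).2.2 l _ (hy l).isDecoupledKKT) _
          ((hball (y := ((fun l => (w l).1), z, lam')) (by
            rw [Prod.dist_eq, Prod.dist_eq, max_lt_iff, max_lt_iff]
            exact ⟨h1, hz.1, hlam.1⟩)).2.2 l _ (hkkt l)) _ _ (hy l).isDecoupledKKT (hkkt l)
      have h3 : ∀ l, y.x l = (w l).1 := fun l => congrArg Prod.fst (h2 l)
      refine LocalVars.ext (funext h3) (funext fun l => ?_)
        (funext fun l => congrArg Prod.snd (h2 l)) (funext fun l => ?_)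
      · rw [(hy l).s_eq, h3]
      · rw [(hy l).kap_eq, h3]
  · obtain ⟨h1, h2, -⟩ := hball (hnear y hyr)
    have he : 0 ≤ ‖z - x‖ + ‖lam' - lam‖ := by positivity
    refine ⟨?_, fun H hH => ?_⟩
    · refine (pi_norm_le_iff_of_nonneg (by positivity)).2 fun l => ?_
      refine (norm_fst_le ((y.x l, y.gam l) - (x l, gam l))).trans
        ((h2 l _ (hy l).isDecoupledKKT).trans ?_)
      refine mul_le_mul ((hCl l).trans (le_add_of_nonneg_right hC₁.le))
        (add_le_add_left (norm_le_pi_norm (z - x) l) _) (by positivity) (by positivity)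
    · obtain ⟨hinj, hd⟩ := h1 y.gam H (fun l => (hy l).isDecoupledKKT) fun l => by
        rw [← barrierHess_eq_condHess (hy l).feas.2.1 (hy l).kap_eq]
        exact hH l
      have hsurj : Function.Surjective (P.newtonOp (H, y.x)) :=
        (LinearMap.injective_iff_surjective (f := (P.newtonOp (H, y.x)).toLinearMap)).1 hinj
      refine ⟨?_, fun d hd' => ?_⟩
      · obtain ⟨v, hv⟩ := hsurj (P.newtonRhs μ lam' y.x y.gam)
        refine ⟨⟨fun l => (v.1 l).1, fun l => (v.1 l).2, v.2⟩,
          (isCoordStep_iff_newtonOp hy H _).2 hv, fun d hd' => ?_⟩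
        have h3 := hinj (((isCoordStep_iff_newtonOp hy H d).1 hd').trans hv.symm)
        rw [← h3]
      · obtain ⟨h3, h4⟩ := hd _ ((isCoordStep_iff_newtonOp hy H d).1 hd')
        refine ⟨h3.trans ?_, fun l m => ?_⟩
        · have h5 : 0 ≤ C₀ * ‖y.x - x‖ * (‖z - x‖ + ‖lam' - lam‖) := by positivity
          linarith
        · have h5 : y.s l m = -P.cI l (y.x l) m := by rw [(hy l).s_eq]; rfl
          rw [h5]
          exact h4 l m

end DistNLP

/-! ### Full-step runs -/

/-- The full step is admissible when the increment is small relative to the variable. -/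
theorem isGreatest_boundarySteps_one {k : ℕ} {τ : ℝ} {v dv : Vec k}
    (h : ∀ m, |dv m| ≤ τ * v m) : IsGreatest (boundarySteps τ v dv) 1 := by
  refine ⟨⟨one_pos, le_rfl, fun m => ?_⟩, fun β hβ => hβ.2.1⟩
  have := neg_le_of_abs_le (h m)
  linarith

namespace DistNLP

variable {R : Type*} {n mE mI : R → ℕ} {p : ℕ} {P : DistNLP R n mE mI p}
  {μ ρ τ : ℝ} {Sg : ∀ l, Vec (n l) →L[ℝ] Vec (n l)}
  {x : ∀ l, Vec (n l)} {lam : Vec p} {gam : ∀ l, Vec (mE l)}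

/-- The increments of slacks and inequality multipliers are as small, relative to these
variables, as the linearized inequality constraints. -/
theorem IsDecoupledSolution.abs_increment_le {z : ∀ l, Vec (n l)} {y : LocalVars R n mE mI} {l : R}
    (hy : P.IsDecoupledSolution μ ρ Sg z lam y l) (hμ : 0 < μ) {d : Vec (n l)}
    (hd : ∀ m, |P.Rjac l (y.x l) d m| ≤ τ * y.s l m) {ds dkap : Vec (mI l)}
    (hds : ds = -P.cI l (y.x l) - y.s l - P.Rjac l (y.x l) d)
    (hdk : ∀ m, dkap m = -y.kap l m + (μ - y.kap l m * ds m) / y.s l m) :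
    (∀ m, |ds m| ≤ τ * y.s l m) ∧ ∀ m, |dkap m| ≤ τ * y.kap l m := by
  have h1 : ∀ m, |ds m| ≤ τ * y.s l m := fun m => by
    rw [hds, ← hy.s_eq, sub_self, zero_sub, PiLp.neg_apply, abs_neg]
    exact hd m
  refine ⟨h1, fun m => ?_⟩
  have hs : 0 < y.s l m := hy.feas.2.2 m
  have hk : 0 < y.kap l m := by
    have h2 : 0 < y.s l m * y.kap l m := by rw [hy.compl m]; exact hμ
    exact (mul_pos_iff_of_pos_left hs).1 h2
  have h2 : dkap m = -(y.kap l m / y.s l m * ds m) := by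
    rw [hdk m, ← hy.compl m]
    field_simp
    ring
  rw [h2, abs_neg, abs_mul, abs_of_pos (div_pos hk hs)]
  calc y.kap l m / y.s l m * |ds m| ≤ y.kap l m / y.s l m * (τ * y.s l m) :=
        mul_le_mul_of_nonneg_left (h1 m) (div_pos hk hs).le
    _ = τ * y.kap l m := by field_simp

variable [Fintype R]

theorem IsIteration.beta_eq_one {w : Iterate R n mE mI p} (hw : P.IsIteration μ ρ Sg τ w)
    (hμ : 0 < μ)
    (hd : ∀ l m, |P.Rjac l (w.sol.x l) (w.step.dx l) m| ≤ τ * w.sol.s l m) :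
    w.betaP = 1 ∧ w.betaD = 1 := by
  have h1 := fun l => (hw.decoupled l).abs_increment_le hμ (hd l) (hw.slack l) (hw.dual l)
  constructor
  · obtain ⟨l, hl⟩ := hw.betaP.1
    rw [← hl]
    exact (hw.betaPLoc l).unique (isGreatest_boundarySteps_one (h1 l).1)
  · obtain ⟨l, hl⟩ := hw.betaD.1
    rw [← hl]
    exact (hw.betaDLoc l).unique (isGreatest_boundarySteps_one (h1 l).2)

theorem exists_isIteration [Nonempty R] {z : ∀ l, Vec (n l)} {y : LocalVars R n mE mI}
    (hy : ∀ l, P.IsDecoupledSolution μ ρ Sg z lam y l) (hμ : 0 < μ)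
    {H : ∀ l, Vec (n l) →L[ℝ] Vec (n l)} {d : CoordStep R n mE p}
    (hd : P.IsCoordStep μ lam y H d)
    (hdx : ∀ l m, |P.Rjac l (y.x l) (d.dx l) m| ≤ τ * y.s l m) :
    ∃ w : Iterate R n mE mI p, P.IsIteration μ ρ Sg τ w ∧ w.z = z ∧ w.lam = lam ∧ w.sol = y ∧
      w.H = H ∧ w.step = d ∧ w.betaP = 1 ∧ w.betaD = 1 := by
  set ds : ∀ l, Vec (mI l) := fun l => -P.cI l (y.x l) - y.s l - P.Rjac l (y.x l) (d.dx l)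
    with hds
  set dkap : ∀ l, Vec (mI l) := fun l =>
    WithLp.toLp 2 fun m => -y.kap l m + (μ - y.kap l m * ds l m) / y.s l m with hdkap
  have h1 := fun l => (hy l).abs_increment_le hμ (hdx l) (ds := ds l) (dkap := dkap l) rfl
    fun m => rfl
  have hleast : IsLeast (Set.range fun _ : R => (1 : ℝ)) 1 := by
    rw [Set.range_const]; exact isLeast_singleton
  exact ⟨⟨z, lam, y, H, d, ds, dkap, fun _ => 1, fun _ => 1, 1, 1⟩,
    { decoupled := hy
      coord := hd
      slack := fun l => rfl
      dual := fun l m => rfl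
      betaPLoc := fun l => isGreatest_boundarySteps_one (h1 l).1
      betaDLoc := fun l => isGreatest_boundarySteps_one (h1 l).2
      betaP := hleast
      betaD := hleast }, rfl, rfl, rfl, rfl, rfl, rfl, rfl⟩

/-- Local quadratic convergence of the inner iteration to a regular solution of the barrier
problem. -/
theorem IsBarrierRegular.exists_quadratic_convergence [Nonempty R]
    (h : P.IsBarrierRegular μ x lam gam) (hμ : 0 < μ)
    (hP : P.Smooth) (hSg : ∀ l, IsSelfAdjoint (Sg l))
    (hreg : ∀ l, P.IsDecoupledRegular μ ρ Sg l (x l) lam (gam l))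
    {M : ℝ} (hM : 0 ≤ M) (hτ : 0 < τ) :
    ∃ r > 0, ∃ δ > 0, ∃ C > 0,
      (∀ z lam', dist z x < δ → dist lam' lam < δ →
        ∃! y : LocalVars R n mE mI,
          (∀ l, P.IsDecoupledSolution μ ρ Sg z lam' y l) ∧ dist y.x x < r) ∧
      (∀ z lam' y H, dist z x < δ → dist lam' lam < δ →
        (∀ l, P.IsDecoupledSolution μ ρ Sg z lam' y l) → dist y.x x < r →
        P.HessAccurate M z y H →
        ∃! d : CoordStep R n mE p, P.IsCoordStep μ lam' y H d) ∧
      (∀ z lam', dist z x < δ → dist lam' lam < δ →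
        ∃ w : ℕ → Iterate R n mE mI p, (w 0).z = z ∧ (w 0).lam = lam' ∧
          P.IsLocalFullStepRun μ ρ Sg τ M r x w) ∧
      ∀ w : ℕ → Iterate R n mE mI p, P.IsLocalFullStepRun μ ρ Sg τ M r x w →
        dist (w 0).z x < δ → dist (w 0).lam lam < δ →
        Tendsto (fun k => (w k).sol.x) atTop (𝓝 x) ∧
        Tendsto (fun k => (w k).z) atTop (𝓝 x) ∧
        Tendsto (fun k => (w k).lam) atTop (𝓝 lam) ∧
        ∀ k,
          ‖(w (k + 1)).z - x‖ + ‖(w (k + 1)).lam - lam‖ ≤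
            C * (‖(w k).z - x‖ + ‖(w k).lam - lam‖) ^ 2 ∧
          ‖(w k).sol.x - x‖ ≤ C * (‖(w k).z - x‖ + ‖(w k).lam - lam‖) ∧
          ‖(w (k + 1)).sol.x - x‖ ≤
            C * ‖(w k).sol.x - x‖ * (‖(w k).z - x‖ + ‖(w k).lam - lam‖) := by
  obtain ⟨r, hr, δ₀, hδ₀, C, hC, hiter⟩ := h.exists_local_iteration hP hSg hreg hM hτ
  set δ : ℝ := min δ₀ (1 / (4 * C ^ 2)) with hδdef
  have hδ : 0 < δ := lt_min hδ₀ (by positivity)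
  have hδδ₀ : δ ≤ δ₀ := min_le_left _ _
  have hδC : 4 * C ^ 2 * δ ≤ 1 := by
    have h1 := min_le_right δ₀ (1 / (4 * C ^ 2))
    rwa [le_div_iff₀ (by positivity), mul_comm] at h1
  -- with `C² · 2δ ≤ 1/2` the error at least halves, so the neighbourhood is invariant
  have hhalf : ∀ (z : ∀ l, Vec (n l)) (lam' : Vec p) (y : LocalVars R n mE mI) H
      (d : CoordStep R n mE p), dist z x < δ → dist lam' lam < δ →
      (∀ l, P.IsDecoupledSolution μ ρ Sg z lam' y l) → dist y.x x < r →
      P.HessAccurate M z y H → P.IsCoordStep μ lam' y H d →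
      ‖y.x + d.dx - x‖ + ‖lam' + d.dlam - lam‖ ≤ C ^ 2 * (‖z - x‖ + ‖lam' - lam‖) ^ 2 ∧
      ‖y.x + d.dx - x‖ + ‖lam' + d.dlam - lam‖ ≤ (‖z - x‖ + ‖lam' - lam‖) / 2 := by
    intro z lam' y H d hz hlam hy hyr hH hd
    obtain ⟨h1, h2⟩ := (hiter z lam' (hz.trans_le hδδ₀) (hlam.trans_le hδδ₀)).2 y hy hyr
    have h3 := ((h2 H hH).2 d hd).1
    rw [dist_eq_norm] at hz hlam
    set e : ℝ := ‖z - x‖ + ‖lam' - lam‖ with he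
    have he0 : 0 ≤ e := by positivity
    have h4 : C * ‖y.x - x‖ * e ≤ C ^ 2 * e ^ 2 := by
      have := mul_le_mul_of_nonneg_left h1 (mul_nonneg hC.le he0)
      nlinarith
    refine ⟨h3.trans h4, (h3.trans h4).trans ?_⟩
    have h5 : C ^ 2 * e ≤ 1 / 2 := by
      have h6 : e ≤ 2 * δ := by linarith
      have := mul_le_mul_of_nonneg_left h6 (sq_nonneg C)
      linarith
    have := mul_le_mul_of_nonneg_right h5 he0
    linarith
  have hinv : ∀ {a : ∀ l, Vec (n l)} {b : Vec p} {a' : ∀ l, Vec (n l)} {b' : Vec p},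
      dist a x < δ → dist b lam < δ →
      ‖a' - x‖ + ‖b' - lam‖ ≤ (‖a - x‖ + ‖b - lam‖) / 2 → dist a' x < δ ∧ dist b' lam < δ := by
    intro a b a' b' ha hb hle
    rw [dist_eq_norm] at ha hb ⊢
    rw [dist_eq_norm]
    have h1 := norm_nonneg (a' - x)
    have h2 := norm_nonneg (b' - lam)
    constructor <;> linarith
  refine ⟨r, hr, δ, hδ, C ^ 2 + C, by positivity, fun z lam' hz hlam =>
    (hiter z lam' (hz.trans_le hδδ₀) (hlam.trans_le hδδ₀)).1, fun z lam' y H hz hlam hy hyr hH =>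
    (((hiter z lam' (hz.trans_le hδδ₀) (hlam.trans_le hδδ₀)).2 y hy hyr).2 H hH).1,
    fun z lam' hz hlam => ?_, fun w hw hz hlam => ?_⟩
  · -- one admissible iteration from every point of the neighbourhood, with exact Hessians
    have hex : ∀ q : {q : (∀ l, Vec (n l)) × Vec p // dist q.1 x < δ ∧ dist q.2 lam < δ},
        ∃ w : Iterate R n mE mI p, P.IsIteration μ ρ Sg τ w ∧ P.HessAccurate M w.z w.sol w.H ∧
          dist w.sol.x x < r ∧ w.z = q.1.1 ∧ w.lam = q.1.2 ∧ w.betaP = 1 ∧ w.betaD = 1 ∧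
          dist (w.sol.x + w.step.dx) x < δ ∧ dist (w.lam + w.step.dlam) lam < δ := by
      rintro ⟨⟨z, lam'⟩, hz, hlam⟩
      obtain ⟨⟨y, ⟨hy, hyr⟩, -⟩, hstep⟩ :=
        hiter z lam' (hz.trans_le hδδ₀) (hlam.trans_le hδδ₀)
      have hH : P.HessAccurate M z y fun l => P.barrierHess l y := fun l => by
        rw [sub_self, norm_zero]; positivity
      obtain ⟨⟨d, hd, -⟩, hd'⟩ := (hstep y hy hyr).2 _ hH
      obtain ⟨w, hw, rfl, rfl, rfl, hw4, rfl, hw6, hw7⟩ :=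
        exists_isIteration hy hμ hd ((hd' d hd).2)
      refine ⟨w, hw, by rw [hw4]; exact hH, hyr, rfl, rfl, hw6, hw7, ?_⟩
      exact hinv hz hlam (hhalf _ _ _ _ _ hz hlam hy hyr hH hd).2
    choose F hF hFH hFr hFz hFlam hFP hFD hFx hFl using hex
    set u : ℕ → {q : (∀ l, Vec (n l)) × Vec p // dist q.1 x < δ ∧ dist q.2 lam < δ} := fun k =>
      Nat.rec ⟨(z, lam'), hz, hlam⟩ (fun _ q => ⟨((F q).sol.x + (F q).step.dx,
        (F q).lam + (F q).step.dlam), hFx q, hFl q⟩) k with hu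
    refine ⟨fun k => F (u k), hFz _, hFlam _, ⟨⟨fun k => hF _, fun k l => ?_, fun k => ?_⟩,
      fun k => hFH _, fun k => hFr _⟩⟩
    · have h1 : (F (u (k + 1))).z = (F (u k)).sol.x + (F (u k)).step.dx := hFz _
      rw [h1, hFP, one_smul, mul_one, one_smul, Pi.add_apply]
      abel
    · have h1 : (F (u (k + 1))).lam = (F (u k)).lam + (F (u k)).step.dlam := hFlam _
      rw [h1, hFD, mul_one, one_smul]
  · have hnext : ∀ k, dist (w k).z x < δ → dist (w k).lam lam < δ →
        (w (k + 1)).z = (w k).sol.x + (w k).step.dx ∧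
          (w (k + 1)).lam = (w k).lam + (w k).step.dlam := by
      intro k hzk hlk
      have hy := (hw.run.iter k).decoupled
      have h1 := ((((hiter _ _ (hzk.trans_le hδδ₀) (hlk.trans_le hδδ₀)).2 _ hy
        (hw.near k)).2 _ (hw.hess k)).2 _ (hw.run.iter k).coord).2
      obtain ⟨h2, h3⟩ := (hw.run.iter k).beta_eq_one hμ h1
      refine ⟨funext fun l => ?_, ?_⟩
      · rw [hw.run.updateZ k l, h2, one_smul, mul_one, one_smul, Pi.add_apply]
        abel
      · rw [hw.run.updateLam k, h3, mul_one, one_smul]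
    have hδk : ∀ k, dist (w k).z x < δ ∧ dist (w k).lam lam < δ := by
      intro k
      induction k with
      | zero => exact ⟨hz, hlam⟩
      | succ k ih =>
        obtain ⟨h1, h2⟩ := hnext k ih.1 ih.2
        rw [h1, h2]
        exact hinv ih.1 ih.2 (hhalf _ _ _ _ _ ih.1 ih.2 (hw.run.iter k).decoupled (hw.near k)
          (hw.hess k) (hw.run.iter k).coord).2
    set e : ℕ → ℝ := fun k => ‖(w k).z - x‖ + ‖(w k).lam - lam‖ with he
    have he0 : ∀ k, 0 ≤ e k := fun k => by positivity
    have hstep : ∀ k, e (k + 1) ≤ C ^ 2 * e k ^ 2 ∧ e (k + 1) ≤ e k / 2 := fun k => by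
      obtain ⟨h1, h2⟩ := hnext k (hδk k).1 (hδk k).2
      simp only [he]
      rw [h1, h2]
      exact hhalf _ _ _ _ _ (hδk k).1 (hδk k).2 (hw.run.iter k).decoupled (hw.near k)
        (hw.hess k) (hw.run.iter k).coord
    have hloc := fun k => (hiter _ _ ((hδk k).1.trans_le hδδ₀) ((hδk k).2.trans_le hδδ₀)).2 _
      (hw.run.iter k).decoupled (hw.near k)
    have hx : ∀ k, ‖(w k).sol.x - x‖ ≤ C * e k := fun k => (hloc k).1
    have hx' : ∀ k, e (k + 1) ≤ C * ‖(w k).sol.x - x‖ * e k := fun k => by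
      obtain ⟨h1, h2⟩ := hnext k (hδk k).1 (hδk k).2
      simp only [he]
      rw [h1, h2]
      exact (((hloc k).2 _ (hw.hess k)).2 _ (hw.run.iter k).coord).1
    have hgeom : ∀ k, e k ≤ e 0 * (1 / 2) ^ k := fun k => by
      induction k with
      | zero => simp
      | succ k ih => rw [pow_succ]; linarith [(hstep k).2]
    have hlim : Tendsto e atTop (𝓝 0) := by
      have h1 : Tendsto (fun k : ℕ => e 0 * (1 / 2 : ℝ) ^ k) atTop (𝓝 (e 0 * 0)) :=
        (tendsto_pow_atTop_nhds_zero_of_lt_one (by norm_num) (by norm_num)).const_mul (e 0)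
      rw [mul_zero] at h1
      exact squeeze_zero he0 hgeom h1
    refine ⟨?_, ?_, ?_, fun k => ⟨?_, ?_, ?_⟩⟩
    · refine tendsto_iff_norm_sub_tendsto_zero.2 (squeeze_zero (fun k => norm_nonneg _) hx ?_)
      simpa using hlim.const_mul C
    · exact tendsto_iff_norm_sub_tendsto_zero.2 (squeeze_zero (fun k => norm_nonneg _)
        (fun k => le_add_of_nonneg_right (norm_nonneg _)) hlim)
    · exact tendsto_iff_norm_sub_tendsto_zero.2 (squeeze_zero (fun k => norm_nonneg _)
        (fun k => le_add_of_nonneg_left (norm_nonneg _)) hlim)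
    · refine (hstep k).1.trans ?_
      have : 0 ≤ C * e k ^ 2 := by positivity
      change _ ≤ (C ^ 2 + C) * e k ^ 2
      linarith
    · refine (hx k).trans ?_
      have := he0 k
      have : 0 ≤ C ^ 2 * e k := by positivity
      change _ ≤ (C ^ 2 + C) * e k
      linarith
    · refine (hx (k + 1)).trans ((mul_le_mul_of_nonneg_left (hx' k) hC.le).trans ?_)
      have := he0 k
      have : 0 ≤ C * ‖(w k).sol.x - x‖ * e k := by positivity
      change _ ≤ (C ^ 2 + C) * ‖(w k).sol.x - x‖ * e k
      linarith

end DistNLP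

end BarrierALADIN

end

/-! ### Local quadratic convergence along the central path -/

theorem mainTheorem3 {R : Type*} [Fintype R] [Nonempty R] {n mE mI : R → ℕ} {p : ℕ}
    (P : BarrierALADIN.DistNLP R n mE mI p) (hsmooth : P.Smooth)
    (xs : ∀ l, BarrierALADIN.Vec (n l)) (lams : BarrierALADIN.Vec p)
    (gams : ∀ l, BarrierALADIN.Vec (mE l)) (kaps : ∀ l, BarrierALADIN.Vec (mI l))
    (hsol : P.IsSolution xs) (hKKT : P.IsKKT xs lams gams kaps)
    (hLICQ : P.LICQ xs) (hSCC : P.SCC xs kaps) (hSOSC : P.SOSC xs gams kaps) :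
    ∃ path : ℝ → BarrierALADIN.PrimalDual R n mE mI p,
      Tendsto (fun μ => (path μ).x) (𝓝[>] 0) (𝓝 xs) ∧
      ∃ r₀ > 0, ∃ μbar > 0, ∀ μ : ℝ, 0 < μ → μ < μbar →
        -- the barrier solution near `xs`, with its multipliers
        P.IsBarrierSolution μ (path μ).x (path μ).s ∧
        P.IsPerturbedKKT μ (path μ) ∧
        dist (path μ).x xs < r₀ ∧
        (∀ x s, P.IsBarrierSolution μ x s → dist x xs < r₀ →
          x = (path μ).x ∧ s = (path μ).s) ∧
        -- local quadratic convergence of the inner loop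
        ∀ (ρ : ℝ) (Sg : ∀ l, BarrierALADIN.Vec (n l) →L[ℝ] BarrierALADIN.Vec (n l))
          (τmin M : ℝ), 0 < ρ →
          (∀ l, IsSelfAdjoint (Sg l) ∧ ∀ v, v ≠ 0 → 0 < inner ℝ v (Sg l v)) →
          0 < τmin → τmin < 1 → 0 ≤ M →
          P.PenaltyLarge ρ Sg (path μ).toLocalVars →
          ∃ r > 0, ∃ δ > 0, ∃ C > 0,
            -- the local steps are well defined
            (∀ z lam, dist z (path μ).x < δ → dist lam (path μ).lam < δ →
              ∃! y : BarrierALADIN.LocalVars R n mE mI,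
                (∀ l, P.IsDecoupledSolution μ ρ Sg z lam y l) ∧ dist y.x (path μ).x < r) ∧
            (∀ z lam y H, dist z (path μ).x < δ → dist lam (path μ).lam < δ →
              (∀ l, P.IsDecoupledSolution μ ρ Sg z lam y l) → dist y.x (path μ).x < r →
              P.HessAccurate M z y H →
              ∃! d : BarrierALADIN.CoordStep R n mE p, P.IsCoordStep μ lam y H d) ∧
            -- runs exist from every starting point near the barrier solution
            (∀ z lam, dist z (path μ).x < δ → dist lam (path μ).lam < δ →
              ∃ w : ℕ → BarrierALADIN.Iterate R n mE mI p, (w 0).z = z ∧ (w 0).lam = lam ∧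
                P.IsLocalFullStepRun μ ρ Sg (max τmin (1 - μ)) M r (path μ).x w) ∧
            -- every such run converges quadratically
            ∀ w : ℕ → BarrierALADIN.Iterate R n mE mI p,
              P.IsLocalFullStepRun μ ρ Sg (max τmin (1 - μ)) M r (path μ).x w →
              dist (w 0).z (path μ).x < δ → dist (w 0).lam (path μ).lam < δ →
              Tendsto (fun k => (w k).sol.x) atTop (𝓝 (path μ).x) ∧
              Tendsto (fun k => (w k).z) atTop (𝓝 (path μ).x) ∧
              Tendsto (fun k => (w k).lam) atTop (𝓝 (path μ).lam) ∧
              ∀ k,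
                ‖(w (k + 1)).z - (path μ).x‖ + ‖(w (k + 1)).lam - (path μ).lam‖ ≤
                  C * (‖(w k).z - (path μ).x‖ + ‖(w k).lam - (path μ).lam‖) ^ 2 ∧
                ‖(w k).sol.x - (path μ).x‖ ≤
                  C * (‖(w k).z - (path μ).x‖ + ‖(w k).lam - (path μ).lam‖) ∧
                ‖(w (k + 1)).sol.x - (path μ).x‖ ≤
                  C * ‖(w k).sol.x - (path μ).x‖ *
                    (‖(w k).z - (path μ).x‖ + ‖(w k).lam - (path μ).lam‖) := by
  have hsm : ∀ l, P.SmoothAt l (xs l) := fun l => hsmooth.smoothAt (hKKT.feas.2 l)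
  have hproj : Tendsto (fun w : (∀ l, BarrierALADIN.Vec (n l) × BarrierALADIN.Vec (mI l) ×
      BarrierALADIN.Vec (mE l)) × BarrierALADIN.Vec p => fun l => (w.1 l).1)
      (𝓝 (fun l => (xs l, kaps l, gams l), lams)) (𝓝 xs) :=
    Continuous.tendsto (by fun_prop) _
  -- `N` is a neighbourhood in which the path is the only perturbed KKT point and is regular
  obtain ⟨N, hN, hN', w, hw, hpath⟩ := BarrierALADIN.DistNLP.exists_centralPath hsmooth hKKT
    hLICQ hSCC hSOSC ((BarrierALADIN.DistNLP.eventually_perturbedKKT_regular hsmooth hKKT hSCC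
      hSOSC).and (hproj.eventually
        (BarrierALADIN.DistNLP.eventually_adjoint_injective hsm hLICQ)))
  have hx : Tendsto (fun μ => fun l => ((w μ).1 l).1) (𝓝 0) (𝓝 xs) := hproj.comp hw
  have hunique := BarrierALADIN.DistNLP.eventually_barrierSolution_multipliers hsmooth hKKT
    hLICQ hN'
  -- the radius `r₀` serves for `x` and for `μ`, so `μbar` is at most `r₀`
  obtain ⟨r₀, hr₀, hr₀'⟩ := Metric.eventually_nhds_iff.1 hunique
  obtain ⟨μbar, hμbar, hμ'⟩ := Metric.eventually_nhds_iff.1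
    (hpath.and (hx.eventually (Metric.ball_mem_nhds xs hr₀)))
  refine ⟨fun μ => ⟨⟨fun l => ((w μ).1 l).1, fun l => -P.cI l ((w μ).1 l).1,
    fun l => ((w μ).1 l).2.2, fun l => ((w μ).1 l).2.1⟩, (w μ).2⟩,
    hx.mono_left nhdsWithin_le_nhds, r₀, hr₀, min r₀ μbar, lt_min hr₀ hμbar,
    fun μ hμ hlt => ?_⟩
  rw [lt_min_iff] at hlt
  have habs : dist μ 0 = μ := by rw [Real.dist_eq, sub_zero, abs_of_pos hμ]
  obtain ⟨⟨hwN, hkkt, huniq⟩, hdist⟩ := hμ' (y := μ) (by rw [habs]; exact hlt.2)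
  obtain ⟨hreg, hind⟩ := hN hwN
  obtain ⟨h1, h2, h3, h4⟩ := hreg μ hμ hkkt
  obtain ⟨k1, k2, k3, k4⟩ := BarrierALADIN.DistNLP.kktMap_eq_target_iff.1 hkkt
  have hB : P.IsBarrierRegular μ (fun l => ((w μ).1 l).1) (w μ).2 (fun l => ((w μ).1 l).2.2) :=
    ⟨h1, k3, h2, k4, fun l => by rw [← h3 l]; exact k1 l, hind, h4⟩
  refine ⟨BarrierALADIN.DistNLP.isBarrierSolution_of_pos h1 k3 h2 k4 hB.stat h4,
    ⟨k1, fun l m => ?_, k3, fun l => add_neg_cancel _, sub_eq_zero.2 k4⟩, hdist, ?_, ?_⟩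
  · have h5 := k2 l m
    change -μ + -P.cI l ((w μ).1 l).1 m * ((w μ).1 l).2.1 m = 0
    linarith
  · intro x s hxs hd
    obtain ⟨v, hv, hvx, hvk⟩ := hr₀' (y := (x, μ)) (by
      rw [Prod.dist_eq, max_lt_iff, habs]; exact ⟨hd, hlt.1⟩) s hxs
    have h5 : x = fun l => ((w μ).1 l).1 := by
      rw [← huniq v hv hvk]
      exact funext fun l => (hvx l).symm
    refine ⟨h5, funext fun l => ?_⟩
    change s l = -P.cI l ((w μ).1 l).1
    rw [← congrFun h5 l]
    exact (BarrierALADIN.DistNLP.neg_cI_pos_of_mem (hxs.1.2 l)).1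
  · intro ρ Sg τmin M _ hSg hτ _ hM hpen
    refine hB.exists_quadratic_convergence hμ hsmooth (fun l => (hSg l).1) (fun l =>
      hB.isDecoupledRegular fun d hd hJ => ?_) hM (hτ.trans_le (le_max_left _ _))
    have h5 := hpen l d hJ hd
    rwa [BarrierALADIN.DistNLP.barrierHess_eq_condHess (μ := μ) (add_neg_cancel _) (h3 l)] at h5
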